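/- **Setting.** Let $V$ be a finite-dimensional real vector space with a basis $B$, and $W$ a finite-dimensional real normed space. $\mathscr H(B)$ is the set of finite non-planar rooted forests with vertices labelled by $B$, $\mathscr H$ the set of unlabelled ones; $|\mathscr f|$ is the number of vertices, $\varsigma(\mathscr f)$ the number of automorphisms, $\ell(\mathscr f)$ the set of $B$-labellings of an unlabelled forest, and $\mathscr f_l$ the labelled forest given by $l\in\ell(\mathscr f)$. $\mathcal H_{\mathrm{CK}}$ (over $V^*$, with labels in the dual basis) is the Connes–Kreimer Hopf algebra, with basis the labelled forests, product the disjoint union and coproduct determined by $\Delta[\mathscr f]_\alpha=[\mathscr f]_\alpha\otimes 1+(\mathrm{id}\otimes[\,\cdot\,]_\alpha)\Delta\mathscr f$; $\mathcal H_{\mathrm{CK},+}$ is spanned by the non-empty forests. $\mathcal H_{\mathrm{GL}}$ (over $V$) is the graded dual for the pairing $\langle\mathscr f,\mathscr g\rangle=\varsigma(\mathscr f)\delta_{\mathscr f,\mathscr g}$, with product $\star$ dual to $\Delta$. $\mathcal P\subset\mathcal H_{\mathrm{CK}}$ is the space of primitive elements. For forests, $h\top\mathscr f$ is $|\mathscr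 f|^{-1}$ times the sum over the vertices $v$ of $\mathscr f$ of the forest obtained by grafting $h$ onto $v$ (extended bilinearly). $\pi:\mathcal H_{\mathrm{CK}}\to\mathcal P$ is determined by $\pi(1)=0$ and $\pi(\mathscr f)=\mathscr f-\mathscr f'\top\pi(\mathscr f'')$ with $\mathscr f'\otimes\mathscr f''$ the reduced coproduct; $\pi^*$ is its adjoint on $\mathcal H_{\mathrm{GL}}$ and $\mathcal Q=\operatorname{im}\pi^*$. Let $\rho\ge1$, $N=\lfloor\rho\rfloor$, $T\ge 0$, $\omega$ a control on $[0,T]$ (continuous, non-negative, super-additive, zero on the diagonal). $F_{s,t}\approx_mG_{s,t}$ means $F_{s,t}-G_{s,t}=O(\omega(s,t)^{m/\rho})$ uniformly on $0\le s\le t\le T$, and $\approx$ means $\approx_{N+1}$. Let $\mathbf X:\{0\le s\le t\le T\}\to\mathcal H_{\mathrm{GL}}^{\le N}$ be a $\rho$-branched rough path: $\mathbf X_{s,t}=\mathbf X_{s,u}\star\mathbf X_{u,t}$ (truncated at weight $N$), $\langle 1,\mathbf X_{s,t}\rangle=1$, $\langle\mathscr f\mathscr g,\mathbf X_{s,t}\rangle=\langle\mathscr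 f,\mathbf X_{s,t}\rangle\langle\mathscr g,\mathbf X_{s,t}\rangle$ for $|\mathscr f|+|\mathscr g|\le N$, and $\langle\mathscr f,\mathbf X_{s,t}\rangle=O(\omega(s,t)^{|\mathscr f|/\rho})$ for $|\mathscr f|\le N$. For a finite-dimensional $U$, $\mathscr D_{\mathbf X}(U)$ is the set of $\mathbf H:[0,T]\to\mathcal L(\mathcal H_{\mathrm{GL}}^{\le N-1},U)$ with $\mathbf H_t\approx_1\mathbf H_s$ and $\langle\mathbf H_t,h\rangle\approx_{N-n}\langle\mathbf H_s,\mathbf X_{s,t}\star h\rangle$ (truncated at weight $N-1$) for $h$ homogeneous of weight $n\le N-1$. Let $\mathbf H\in\mathscr D_{\mathbf X}(\mathcal L(\mathcal Q^{\le N},W))$. Through the pairings and $h\otimes p\mapsto h\top p$, $\mathcal L(\mathcal H_{\mathrm{GL}}^{\le N-1},\mathcal L(\mathcal Q^{\le N},W))\cong\mathcal H_{\mathrm{CK}}^{\le N-1}\otimes\mathcal P^{\le N}\otimes W\to\mathcal H_{\mathrm{CK}}\otimes W$, each $\mathbf H_s$ is identified with an element of $\mathcal H_{\mathrm{CK}}\otimes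 W$; $\mathbf H_{x;s}\in W$ is its pairing with $x\in\mathcal H_{\mathrm{GL}}$, $\mathbf X^{y}_{s,t}=\langle y,\mathbf X_{s,t}\rangle$, and $\int_s^t\mathbf H\,\mathrm d\mathbf X$ is the limit of $\sum_{[u,v]}\langle\mathbf H_u,\mathbf X_{u,v}\rangle$ over partitions of $[s,t]$ with vanishing mesh. **Lemma (Rough integral in coordinates).** The map $\top:\mathcal H_{\mathrm{CK}}\otimes\mathcal P\to\mathcal H_{\mathrm{CK},+}$ is a linear bijection, $\pi$ is the projection onto $\mathcal P$ with $\pi(\mathcal H_{\mathrm{CK},+}\top\mathcal P)=0$, and the identification above is well defined, with $\mathbf H_{k\star q;s}=\langle\mathbf H_s,k\rangle(q)$ for $k\in\mathcal H_{\mathrm{GL}}^{\le N-1}$, $q\in\mathcal Q^{\le N}$. For $\mathscr f\in\mathscr H(B)$ there is hence a linear map $\widehat\Pi_{\mathscr f}$ on $\mathcal H_{\mathrm{CK},+}$ with $\widehat\Pi_{\mathscr f}(h\top p)=\langle p,\mathscr f\rangle\,h\top\pi(\mathscr f)$ for $h\in\mathcal H_{\mathrm{CK}}$, $p\in\mathcal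 P$, and applying it to $\mathbf H$ under the identification yields again a path in $\mathcal L(\mathcal H_{\mathrm{GL}}^{\le N-1},\mathcal L(\mathcal Q^{\le N},W))$. If $\langle\pi(\mathscr f),\mathscr f\rangle\ne0$, then $\Pi_{\mathscr f}:=\langle\pi(\mathscr f),\mathscr f\rangle^{-1}\widehat\Pi_{\mathscr f}$, $h\top p\mapsto\frac{\langle p,\mathscr f\rangle}{\langle\pi(\mathscr f),\mathscr f\rangle}h\top\pi(\mathscr f)$, is a projection onto $\mathcal H_{\mathrm{CK}}\top\pi(\mathscr f)$. Moreover: 1. For $y\in\mathcal H_{\mathrm{CK},+}$ only finitely many $\widehat\Pi_{\mathscr f}(y)$ are non-zero, and $$y=\sum_{\mathscr f\in\mathscr H(B)}\frac{1}{\langle\mathscr f,\mathscr f\rangle}\widehat\Pi_{\mathscr f}(y);$$ here the summand is $\frac{\langle\pi(\mathscr f),\mathscr f\rangle}{\langle\mathscr f,\mathscr f\rangle}\Pi_{\mathscr f}(y)$ whenever $\langle\pi(\mathscr f),\mathscr f\rangle\neq0$. In particular $y=\sum_{\mathscr f}\frac{\langle\pi(\mathscr f),\mathscr f\rangle}{\langle\mathscr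 f,\mathscr f\rangle}\Pi_{\mathscr f}(y)$ (sum over the $\mathscr f$ with $\langle\pi(\mathscr f),\mathscr f\rangle\ne0$) if $\widehat\Pi_{\mathscr f}(y)=0$ for all $\mathscr f$ with $\langle\pi(\mathscr f),\mathscr f\rangle=0$. 2. For every $\mathscr f\in\mathscr H(B)$, $\widehat\Pi_{\mathscr f}(\mathbf H)\in\mathscr D_{\mathbf X}(\mathcal L(\mathcal Q^{\le N},W))$, the integral $\int_s^t\mathbf H_{\pi^*(\mathscr f)}\,\mathrm d\mathbf X^{\pi(\mathscr f)}:=\int_s^t\widehat\Pi_{\mathscr f}(\mathbf H)\,\mathrm d\mathbf X$ exists for $0\le s\le t\le T$, and $$\int_s^t\mathbf H_{\pi^*(\mathscr f)}\,\mathrm d\mathbf X^{\pi(\mathscr f)}\approx\sum_{\mathscr g\in\mathscr H,\ |\mathscr g|\le N}\varsigma(\mathscr g)^{-1}\sum_{l\in\ell(\mathscr g)}\mathbf H_{\mathscr g_l\star\pi^*(\mathscr f);s}\,\mathbf X^{\mathscr g_l\top\pi(\mathscr f)}_{s,t}.$$ If $\langle\pi(\mathscr f),\mathscr f\rangle\ne0$,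 then also $\Pi_{\mathscr f}(\mathbf H)\in\mathscr D_{\mathbf X}(\mathcal L(\mathcal Q^{\le N},W))$, $\int_s^t\Pi_{\mathscr f}(\mathbf H)\,\mathrm d\mathbf X$ exists and equals $\langle\pi(\mathscr f),\mathscr f\rangle^{-1}\int_s^t\mathbf H_{\pi^*(\mathscr f)}\,\mathrm d\mathbf X^{\pi(\mathscr f)}$, and it is $\approx\langle\pi(\mathscr f),\mathscr f\rangle^{-1}$ times the above sum. 3. For $0\le s\le t\le T$ the integral $\int_s^t\mathbf H\,\mathrm d\mathbf X$ exists, and $$\int_s^t\mathbf H\,\mathrm d\mathbf X=\sum_{\mathscr f\in\mathscr H,\ |\mathscr f|\le N}\varsigma(\mathscr f)^{-1}\sum_{l\in\ell(\mathscr f)}\int_s^t\mathbf H_{\pi^*(\mathscr f_l)}\,\mathrm d\mathbf X^{\pi(\mathscr f_l)}\approx\sum_{\substack{\mathscr f,\mathscr g\in\mathscr H\\|\mathscr f|,|\mathscr g|\le N}}\varsigma(\mathscr f)^{-1}\varsigma(\mathscr g)^{-1}\sum_{\substack{l\in\ell(\mathscr f)\\m\in\ell(\mathscr g)}}\mathbf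 H_{\mathscr g_m\star\pi^*(\mathscr f_l);s}\,\mathbf X^{\mathscr g_m\top\pi(\mathscr f_l)}_{s,t}.$$ -/

import Mathlib

open scoped TensorProduct

noncomputable section

/-! ## Non-planar rooted trees and forests with labelled vertices -/

/-- Planar rooted trees whose vertices carry labels in `L`. -/
inductive PlaneTree (L : Type*) : Type _
  | node : L → List (PlaneTree L) → PlaneTree L

namespace PlaneTree

variable {L : Type*}

/-- Isomorphism of labelled rooted trees that forgets the planar order. -/
inductive Iso : PlaneTree L → PlaneTree L → Prop
  | node (a : L) (l l' : List (PlaneTree L)) (σ : Fin l.length ≃ Fin l'.length)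
      (h : ∀ i, Iso (l.get i) (l'.get (σ i))) : Iso (.node a l) (.node a l')

theorem Iso.refl : ∀ t : PlaneTree L, Iso t t
  | .node a l => .node a l l (Equiv.refl _) fun i => Iso.refl (l.get i)
termination_by t => sizeOf t
decreasing_by
  have := List.sizeOf_lt_of_mem (List.get_mem l i)
  simp only [PlaneTree.node.sizeOf_spec]
  omega

theorem Iso.symm {s t : PlaneTree L} (h : Iso s t) : Iso t s := by
  induction h with
  | node a l l' σ _ ih =>
    refine .node a l' l σ.symm fun i => ?_
    have := ih (σ.symm i)
    rwa [Equiv.apply_symm_apply] at this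

theorem Iso.trans {s t u : PlaneTree L} (h : Iso s t) (h' : Iso t u) : Iso s u := by
  induction h generalizing u with
  | node a l l' σ _ ih =>
    cases h' with
    | node _ _ l'' τ h2 =>
      exact .node a l l'' (σ.trans τ) fun i => ih i (h2 (σ i))

instance setoid (L : Type*) : Setoid (PlaneTree L) :=
  ⟨Iso, Iso.refl, Iso.symm, Iso.trans⟩

/-- The number of vertices. -/
def weight : PlaneTree L → ℕ
  | .node _ l => 1 + (l.attach.map fun t => weight t.1).sum
decreasing_by
  have := List.sizeOf_lt_of_mem t.2
  simp only [PlaneTree.node.sizeOf_spec]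
  omega

theorem weight_node (a : L) (l : List (PlaneTree L)) :
    weight (.node a l) = 1 + (l.map weight).sum := by
  rw [weight, List.attach_map_val (f := fun t : PlaneTree L => weight t)]

theorem coe_map_eq_of_equiv {α β : Type*} (f : α → β) (l l' : List α)
    (σ : Fin l.length ≃ Fin l'.length) (h : ∀ i, f (l.get i) = f (l'.get (σ i))) :
    ((l.map f : List β) : Multiset β) = (l'.map f : List β) := by
  have key : ∀ k : List α, ((k.map f : List β) : Multiset β)
      = (Finset.univ : Finset (Fin k.length)).val.map fun i => f (k.get i) := by
    intro k
    have h1 : k.map f = List.ofFn fun i : Fin k.length => f (k.get i) := by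
      apply List.ext_get <;> simp
    rw [h1]
    simp [List.ofFn_eq_map, Fin.univ_val_map]
  rw [key, key]
  have h2 : (Finset.univ : Finset (Fin l'.length)).val
      = (Finset.univ : Finset (Fin l.length)).val.map σ := by
    have := congrArg Finset.val (Finset.map_univ_equiv σ)
    simp
  rw [h2, Multiset.map_map]
  exact Multiset.map_congr rfl fun i _ => h i

theorem exists_equiv_of_perm {α : Type*} {l l' : List α} (h : l.Perm l') :
    ∃ σ : Fin l.length ≃ Fin l'.length, ∀ i, l.get i = l'.get (σ i) := by
  induction h with
  | nil => exact ⟨Equiv.refl _, fun _ => rfl⟩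
  | cons x _ ih =>
    obtain ⟨σ, hσ⟩ := ih
    refine ⟨(finSuccEquiv _).trans ((Equiv.optionCongr σ).trans (finSuccEquiv _).symm), ?_⟩
    intro i
    refine Fin.cases ?_ (fun j => ?_) i
    · simp
    · simpa using hσ j
  | swap x y l =>
    refine ⟨Equiv.swap (0 : Fin (l.length + 2)) 1, ?_⟩
    intro i
    refine Fin.cases ?_ (fun j => Fin.cases ?_ (fun k => ?_) j) i
    · simp
    · simp
    · have : Equiv.swap (0 : Fin (l.length + 2)) 1 k.succ.succ = k.succ.succ :=
        Equiv.swap_apply_of_ne_of_ne (Fin.succ_ne_zero _)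
          (by rw [← Fin.succ_zero_eq_one, Ne, Fin.succ_inj]; exact Fin.succ_ne_zero _)
      rw [this]
      simp
  | trans _ _ ih ih' =>
    obtain ⟨σ, hσ⟩ := ih
    obtain ⟨τ, hτ⟩ := ih'
    exact ⟨σ.trans τ, fun i => (hσ i).trans (hτ (σ i))⟩

theorem Iso.weight_eq {s t : PlaneTree L} (h : Iso s t) : weight s = weight t := by
  induction h with
  | node a l l' σ _ ih =>
    rw [weight_node, weight_node]
    have := congrArg Multiset.sum (coe_map_eq_of_equiv weight l l' σ ih)
    simp only [Multiset.sum_coe] at this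
    rw [this]

end PlaneTree

/-- Non-planar rooted trees with vertices labelled by `L`: isomorphism classes. -/
def RTree (L : Type*) : Type _ := Quotient (PlaneTree.setoid L)

/-- A non-planar forest is a finite multiset of trees; the empty forest is `0`, and the disjoint
union (the forest product) is the sum of multisets. -/
abbrev Forest (L : Type*) : Type _ := Multiset (RTree L)

namespace RTree

variable {L : Type*}

/-- The class of a planar tree. -/
def mk (t : PlaneTree L) : RTree L := Quotient.mk (PlaneTree.setoid L) t

/-- A planar representative of a tree. -/
def out (t : RTree L) : PlaneTree L := Quotient.out t

theorem mk_out (t : RTree L) : mk t.out = t := Quotient.out_eq t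

theorem exists_mk (t : RTree L) : ∃ s, mk s = t := ⟨t.out, t.mk_out⟩

theorem mk_eq {s t : PlaneTree L} : mk s = mk t ↔ PlaneTree.Iso s t :=
  ⟨fun h => Quotient.exact h, fun h => Quotient.sound h⟩

/-- The number of vertices. -/
def weight : RTree L → ℕ :=
  Quotient.lift PlaneTree.weight fun _ _ h => PlaneTree.Iso.weight_eq h

/-- The label of the root. -/
def root : RTree L → L :=
  Quotient.lift (fun | .node a _ => a) (by rintro _ _ ⟨⟩; rfl)

/-- The forest obtained by deleting the root. -/
def children : RTree L → Forest L :=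
  Quotient.lift (fun | .node _ l => (↑(l.map mk) : Forest L)) (by
    rintro _ _ ⟨a, l, l', σ, h⟩
    exact PlaneTree.coe_map_eq_of_equiv _ l l' σ fun i => mk_eq.2 (h i))

/-- The tree `[f]_a`: the forest `f` grafted onto a new root with label `a`. -/
def node (a : L) (f : Forest L) : RTree L := mk (.node a (f.toList.map out))

theorem children_mk (a : L) (l : List (PlaneTree L)) :
    children (mk (.node a l)) = (↑(l.map mk) : Forest L) := rfl

@[simp] theorem root_node (a : L) (f : Forest L) : root (node a f) = a := rfl

@[simp] theorem children_node (a : L) (f : Forest L) : children (node a f) = f := by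
  rw [node, children_mk, List.map_map]
  have : (mk ∘ out : RTree L → RTree L) = id := funext mk_out
  rw [this, List.map_id, Multiset.coe_toList]

theorem node_root_children (t : RTree L) : node t.root t.children = t := by
  obtain ⟨⟨a, l⟩, rfl⟩ := exists_mk t
  change mk (.node a (Multiset.toList (↑(l.map mk) : Forest L) |>.map out)) = _
  set k := Multiset.toList (↑(l.map mk) : Forest L) with hk
  have hp : (l.map mk).Perm ((k.map out).map mk) := by
    rw [List.map_map]
    have : (mk ∘ out : RTree L → RTree L) = id := funext mk_out
    rw [this, List.map_id]
    exact (Multiset.coe_eq_coe.1 (Multiset.coe_toList _)).symm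
  obtain ⟨σ, hσ⟩ := PlaneTree.exists_equiv_of_perm hp
  refine mk_eq.2 (PlaneTree.Iso.symm
    (.node a l (k.map out) ((finCongr (by simp)).trans (σ.trans (finCongr (by simp)))) fun i => ?_))
  have := hσ (finCongr (by simp) i)
  simp only [List.get_eq_getElem, List.getElem_map] at this
  exact mk_eq.1 (by simpa using this)

theorem weight_eq (t : RTree L) : weight t = 1 + (t.children.map weight).sum := by
  obtain ⟨⟨a, l⟩, rfl⟩ := exists_mk t
  rw [children_mk, Multiset.map_coe, Multiset.sum_coe, List.map_map]
  exact PlaneTree.weight_node a l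

theorem weight_lt_of_mem {s t : RTree L} (h : s ∈ t.children) : weight s < weight t := by
  rw [weight_eq t]
  have := Multiset.single_le_sum (fun x _ => Nat.zero_le x) _ (Multiset.mem_map_of_mem weight h)
  omega

/-- Recursion over non-planar trees: the value at `t = [t₁ ⋯ tₙ]_a` is computed from `a` and the
multiset of the pairs `(tᵢ, value at tᵢ)`. -/
def recurse {β : Type*} (step : L → Multiset (RTree L × β) → β) (t : RTree L) : β :=
  step t.root (t.children.attach.map fun s => (s.1, recurse step s.1))
termination_by t.weight
decreasing_by exact weight_lt_of_mem s.2

theorem recurse_eq {β : Type*} (step : L → Multiset (RTree L × β) → β) (t : RTree L) :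
    recurse step t = step t.root (t.children.map fun s => (s, recurse step s)) := by
  rw [recurse]
  congr 1
  exact Multiset.attach_map_val' t.children fun s => (s, recurse step s)

end RTree

namespace Forest

variable {L : Type*}

/-- The number of vertices. -/
def weight (f : Forest L) : ℕ := (f.map RTree.weight).sum

theorem finite_weight_eq [Finite L] (n : ℕ) : {f : Forest L | f.weight = n}.Finite := by
  induction n using Nat.strong_induction_on with
  | _ n ih =>
    classical
    have hT : {t : RTree L | t.weight ≤ n}.Finite := by
      have h1 : (⋃ k ∈ Set.Iio n, ⋃ a : L, RTree.node a '' {f : Forest L | f.weight = k}).Finite :=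
        (Set.finite_Iio n).biUnion fun k hk => Set.finite_iUnion fun a => (ih k hk).image _
      refine h1.subset fun t ht => ?_
      have h2 := RTree.weight_eq t
      simp only [Set.mem_ofPred_eq] at ht
      simp only [Set.mem_iUnion]
      refine ⟨weight t.children, ?_, t.root, t.children, rfl, RTree.node_root_children t⟩
      simp only [Set.mem_Iio, weight]
      omega
    refine (Multiset.powerset (n • hT.toFinset.val)).toFinset.finite_toSet.subset fun f hf => ?_
    simp only [Set.mem_ofPred_eq] at hf
    simp only [Finset.mem_coe, Multiset.mem_toFinset, Multiset.mem_powerset]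
    have hpos : ∀ t : RTree L, 1 ≤ t.weight := fun t => by rw [RTree.weight_eq]; omega
    have hcard : f.card ≤ n := by
      rw [← hf, weight]
      have := Multiset.card_nsmul_le_sum (s := f.map RTree.weight) (a := 1) (by
        intro x hx
        obtain ⟨t, -, rfl⟩ := Multiset.mem_map.1 hx
        exact hpos t)
      simpa using this
    rw [Multiset.le_iff_count]
    intro t
    by_cases ht : t ∈ f
    · have h3 : t.weight ≤ n := by
        rw [← hf, weight]
        exact Multiset.single_le_sum (fun x _ => Nat.zero_le x) _
          (Multiset.mem_map_of_mem RTree.weight ht)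
      have h4 : Multiset.count t hT.toFinset.val = 1 :=
        Multiset.count_eq_one_of_mem hT.toFinset.nodup (by simpa using h3)
      rw [Multiset.count_nsmul, h4, mul_one]
      exact (Multiset.count_le_card _ _).trans hcard
    · rw [Multiset.count_eq_zero_of_notMem ht]
      exact Nat.zero_le _

/-- The forests with exactly `n` vertices, for a finite set of labels. -/
def ofWeight (L : Type*) [Finite L] (n : ℕ) : Finset (Forest L) := (finite_weight_eq n).toFinset

@[simp] theorem mem_ofWeight [Finite L] {n : ℕ} {f : Forest L} :
    f ∈ ofWeight L n ↔ f.weight = n := by simp [ofWeight]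

/-- The forests with at most `n` vertices, for a finite set of labels. -/
def ofWeightLE (L : Type*) [Finite L] (n : ℕ) : Finset (Forest L) := by
  classical exact (Finset.range (n + 1)).biUnion (ofWeight L)

@[simp] theorem mem_ofWeightLE [Finite L] {n : ℕ} {f : Forest L} :
    f ∈ ofWeightLE L n ↔ f.weight ≤ n := by simp [ofWeightLE]

end Forest

open scoped Classical in
/-- The symmetry factor of a tree, given by
`ς([t₁^{m₁} ⋯ tₖ^{mₖ}]_a) = ∏ᵢ mᵢ! ς(tᵢ)^{mᵢ}` for pairwise distinct `tᵢ`;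
this is the number of automorphisms of the tree. -/
def RTree.symm {L : Type*} : RTree L → ℕ :=
  RTree.recurse fun _ m =>
    (∏ t ∈ (m.map Prod.fst).toFinset, ((m.map Prod.fst).count t).factorial) * (m.map Prod.snd).prod

open scoped Classical in
/-- The symmetry factor `ς(f)` of a forest, i.e. the number of its automorphisms. -/
def Forest.symm {L : Type*} (f : Forest L) : ℕ :=
  (∏ t ∈ f.toFinset, (f.count t).factorial) * (f.map RTree.symm).prod

/-! Unlabelled trees and forests are those with labels in `Unit`. A labelling `l ∈ ℓ(f)` assigns a
label to each vertex; below are the multisets of all `t_l` and all `f_l`, with one entry for each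
labelling (so `|B| ^ |f|` entries in total). -/

/-- The multiset of the labelled trees `t_l`, for `l` ranging over all labellings of `t`. -/
def RTree.labellings (B : Type*) [Fintype B] : RTree Unit → Multiset (RTree B) :=
  RTree.recurse fun _ m =>
    (Finset.univ : Finset B).val.bind fun a =>
      (Multiset.Sections (m.map Prod.snd)).map (RTree.node a)

/-- The multiset of the labelled forests `f_l`, for `l` ranging over all labellings of `f`. -/
def Forest.labellings (B : Type*) [Fintype B] (f : Forest Unit) : Multiset (Forest B) :=
  Multiset.Sections (f.map (RTree.labellings B))

/-! ## The Connes-Kreimer and Grossman-Larson Hopf algebras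

A basis `B` of the finite-dimensional vector space `V` is fixed, so that `V^{⊗ f}` has as basis the
`B`-labellings of `f`: `H_GL(V)` is freely spanned by the `B`-labelled forests, and `H_CK(V*)` is
freely spanned by the forests labelled by the dual basis `B*`, which is indexed by `B` too. -/

/-- `H_CK(V*)`: the commutative algebra freely spanned by labelled forests, whose product is the
disjoint union of forests. -/
abbrev HCK (B : Type*) : Type _ := AddMonoidAlgebra ℝ (Forest B)

/-- `H_GL(V)`: the graded dual of `H_CK(V*)`, as a vector space spanned by labelled forests. -/
abbrev HGL (B : Type*) : Type _ := AddMonoidAlgebra ℝ (Forest B)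

/-- A forest as an element of `H_CK` or `H_GL`. -/
def fo {B : Type*} (f : Forest B) : AddMonoidAlgebra ℝ (Forest B) := AddMonoidAlgebra.single f 1

/-- The linear map with prescribed values on forests. -/
def linExt {B M : Type*} [AddCommGroup M] [Module ℝ M] (v : Forest B → M) :
    AddMonoidAlgebra ℝ (Forest B) →ₗ[ℝ] M :=
  (AddMonoidAlgebra.basis (Forest B) ℝ).constr ℝ v

theorem linExt_fo {B M : Type*} [AddCommGroup M] [Module ℝ M] (v : Forest B → M) (f : Forest B) :
    linExt v (fo f) = v f := by
  have := (AddMonoidAlgebra.basis (Forest B) ℝ).constr_basis ℝ v f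
  rwa [AddMonoidAlgebra.basis_apply] at this

/-- The dual pairing `⟨·,·⟩ : H_CK(V*) × H_GL(V) → ℝ`, with `⟨f, g⟩ = ς(f) δ_{f,g}`. -/
def pair {B : Type*} : HCK B →ₗ[ℝ] HGL B →ₗ[ℝ] ℝ :=
  linExt fun f => linExt fun g => by classical exact if f = g then (f.symm : ℝ) else 0

section Coalgebra

variable {B : Type*}

/-- The operator `f ↦ [f]_a`. -/
def Bplus (a : B) : HCK B →ₗ[ℝ] HCK B := linExt fun f => fo {RTree.node a f}

/-- The Connes-Kreimer coproduct of a tree, by the cocycle relation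
`Δ [f]_a = [f]_a ⊗ 1 + (id ⊗ [·]_a) Δ f`. -/
def coproductTree : RTree B → HCK B ⊗[ℝ] HCK B :=
  RTree.recurse fun a m =>
    fo {RTree.node a (m.map Prod.fst)} ⊗ₜ[ℝ] (1 : HCK B)
      + LinearMap.lTensor (HCK B) (Bplus a) (m.map Prod.snd).prod

/-- The Connes-Kreimer coproduct `Δ_CK`, multiplicative in the forest. The left tensor factor is
the pruned part, the right one is the part containing the roots. -/
def coproduct : HCK B →ₗ[ℝ] HCK B ⊗[ℝ] HCK B :=
  linExt fun f => (f.map coproductTree).prod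

/-- The pairing of `H_CK ⊗ H_CK` with `h ⊗ k`, for `h, k ∈ H_GL`. -/
def pairTensor (h k : HGL B) : HCK B ⊗[ℝ] HCK B →ₗ[ℝ] ℝ :=
  LinearMap.mul' ℝ ℝ ∘ₗ TensorProduct.map (pair.flip h) (pair.flip k)

/-- The Grossman-Larson product `⋆ : H_GL × H_GL → H_GL`, dual to the Connes-Kreimer coproduct:
`⟨y, h ⋆ k⟩ = ⟨Δ_CK y, h ⊗ k⟩`. -/
def starGL [Finite B] : HGL B →ₗ[ℝ] HGL B →ₗ[ℝ] HGL B :=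
  linExt fun f => linExt fun g =>
    ∑ e ∈ Forest.ofWeight B (f.weight + g.weight),
      (pairTensor (fo f) (fo g) (coproduct (fo e)) / (e.symm : ℝ)) • fo e

/-- The reduced coproduct `y ↦ Δ_CK y - y ⊗ 1 - 1 ⊗ y`. -/
def reducedCoproduct : HCK B →ₗ[ℝ] HCK B ⊗[ℝ] HCK B :=
  coproduct - (TensorProduct.mk ℝ (HCK B) (HCK B)).flip 1 - TensorProduct.mk ℝ (HCK B) (HCK B) 1

/-- The space `𝒫` of primitive elements of `H_CK`. -/
def Prim (B : Type*) : Submodule ℝ (HCK B) := LinearMap.ker reducedCoproduct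

open scoped Classical in
/-- The sum over all vertices `v` of the tree `t` of the tree obtained from `t` by grafting the
forest `h` onto `v`. -/
def graftTree (h : Forest B) : RTree B → HCK B :=
  RTree.recurse fun a m =>
    fo {RTree.node a (h + m.map Prod.fst)}
      + Bplus a (m.map fun s => fo ((m.map Prod.fst).erase s.1) * s.2).sum

open scoped Classical in
/-- The sum over all vertices `v` of the forest `f` of the forest obtained from `f` by grafting
the forest `h` onto `v`. -/
def graftForest (h f : Forest B) : HCK B :=
  (f.map fun t => fo (f.erase t) * graftTree h t).sum

/-- Natural growth `⊤ : H_CK × H_CK → H_CK`: for forests, `h ⊤ f` is the average over the vertices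
`v` of `f` of the forests obtained by grafting `h` onto `v`. -/
def growth : HCK B →ₗ[ℝ] HCK B →ₗ[ℝ] HCK B :=
  linExt fun h => linExt fun f => (f.weight : ℝ)⁻¹ • graftForest h f

/-- The projection of `H_CK` onto the span `H_{CK,+}` of the non-empty forests. -/
def posPart : HCK B →ₗ[ℝ] HCK B :=
  LinearMap.id - (linExt fun f => by classical exact if f = 0 then (1 : HCK B) else 0)

/-- The iterates of the recursion `π(y) = y - y' ⊤ π(y'')`, where `y' ⊗ y''` is the reduced
coproduct of `y`. -/
def piIter : ℕ → HCK B →ₗ[ℝ] HCK B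
  | 0 => 0
  | n + 1 => posPart - TensorProduct.lift (growth.compl₂ (piIter n)) ∘ₗ reducedCoproduct

/-- The projection `π` of `H_CK` onto its primitive elements, determined by `π(1) = 0` and
`π(f) = f - f' ⊤ π(f'')` for non-empty forests `f`; the recursion stops after `|f|` steps. -/
def piCK : HCK B →ₗ[ℝ] HCK B := linExt fun f => piIter f.weight (fo f)

/-- The adjoint `π* : H_GL → H_GL`, `⟨y, π*(h)⟩ = ⟨π(y), h⟩`. -/
def piStar [Finite B] : HGL B →ₗ[ℝ] HGL B :=
  linExt fun g =>
    ∑ f ∈ Forest.ofWeight B g.weight, (pair (piCK (fo f)) (fo g) / (f.symm : ℝ)) • fo f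

/-- `H_{CK,+}`, the span of the non-empty forests. -/
def HCKPos (B : Type*) : Submodule ℝ (HCK B) := AddMonoidAlgebra.supported ℝ ℝ {f : Forest B | f ≠ 0}

/-- The map `H_CK ⊗ 𝒫 → H_CK`, `h ⊗ p ↦ h ⊤ p`. -/
def growthPrim (B : Type*) : HCK B ⊗[ℝ] Prim B →ₗ[ℝ] HCK B :=
  TensorProduct.lift (growth.compl₂ (Prim B).subtype)

/-- The elements of weight at most `n`. -/
def weightLE (B : Type*) (n : ℕ) : Submodule ℝ (AddMonoidAlgebra ℝ (Forest B)) :=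
  AddMonoidAlgebra.supported ℝ ℝ {f : Forest B | f.weight ≤ n}

/-- The homogeneous elements of weight `n`. -/
def weightEq (B : Type*) (n : ℕ) : Submodule ℝ (AddMonoidAlgebra ℝ (Forest B)) :=
  AddMonoidAlgebra.supported ℝ ℝ {f : Forest B | f.weight = n}

/-- The truncation discarding all forests with more than `n` vertices. -/
def truncLE (n : ℕ) : AddMonoidAlgebra ℝ (Forest B) →ₗ[ℝ] weightLE B n :=
  linExt fun f => by
    classical
    exact if h : f.weight ≤ n then
      ⟨fo f, AddMonoidAlgebra.mem_supported'.2 fun g hg => by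
        have : f ≠ g := by rintro rfl; exact hg h
        simp [fo, Finsupp.single_eq_of_ne' this]⟩
    else 0

/-- `𝒫` truncated at weight `n`. -/
def PrimLE (B : Type*) (n : ℕ) : Submodule ℝ (HCK B) := Prim B ⊓ weightLE B n

/-- `𝒬`, the image of `π*` (a graded dual of `𝒫`), truncated at weight `n`. -/
def QLE (B : Type*) [Finite B] (n : ℕ) : Submodule ℝ (HGL B) :=
  LinearMap.range (piStar (B := B)) ⊓ weightLE B n

/-- `⟨π(f), f⟩ Π_f`: the linear map `h ⊤ p ↦ ⟨p, f⟩ h ⊤ π(f)` (`h ∈ H_CK`, `p ∈ 𝒫`). It is written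
through the decomposition `y = y₍₁₎ ⊤ π(y₍₂₎)` of `y ∈ H_{CK,+}`. -/
def PiHat (f : Forest B) : HCK B →ₗ[ℝ] HCK B :=
  TensorProduct.lift
    ((LinearMap.lsmul ℝ (HCK B)).flip.compl₁₂ (growth.flip (piCK (fo f)))
      (pair.flip (fo f) ∘ₗ piCK)) ∘ₗ coproduct

/-- `Π_f`, the linear map `h ⊤ p ↦ (⟨p, f⟩ / ⟨π(f), f⟩) h ⊤ π(f)`. It is only used for those `f`
with `⟨π(f), f⟩ ≠ 0`. -/
def PiProj (f : Forest B) : HCK B →ₗ[ℝ] HCK B := (pair (piCK (fo f)) (fo f))⁻¹ • PiHat f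

end Coalgebra

/-! ## Controls, branched rough paths and controlled paths -/

/-- `ω` is a control on `[0,T]`. -/
structure IsControl (T : ℝ) (ω : ℝ → ℝ → ℝ) : Prop where
  continuousOn : ContinuousOn (fun z : ℝ × ℝ => ω z.1 z.2) {z | 0 ≤ z.1 ∧ z.1 ≤ z.2 ∧ z.2 ≤ T}
  nonneg : ∀ s t, 0 ≤ s → s ≤ t → t ≤ T → 0 ≤ ω s t
  diag : ∀ t, 0 ≤ t → t ≤ T → ω t t = 0
  superadd : ∀ s u t, 0 ≤ s → s ≤ u → u ≤ t → t ≤ T → ω s u + ω u t ≤ ω s t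

/-- `F_{s,t} = O(ω(s,t)^{m/ρ})` on `0 ≤ s ≤ t ≤ T`, for `F` with values in a finite-dimensional
vector space `U`. It is stated through the linear functionals on `U`, so that no norm on `U` has to
be chosen. -/
def IsOmegaBigO (ρ T : ℝ) (ω : ℝ → ℝ → ℝ) (m : ℕ) {U : Type*} [AddCommGroup U] [Module ℝ U]
    (F : ℝ → ℝ → U) : Prop :=
  ∀ φ : U →ₗ[ℝ] ℝ, ∃ C : ℝ, ∀ s t, 0 ≤ s → s ≤ t → t ≤ T →
    |φ (F s t)| ≤ C * ω s t ^ ((m : ℝ) / ρ)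

/-- `F_{s,t} ≈_m G_{s,t}`. -/
def Approx (ρ T : ℝ) (ω : ℝ → ℝ → ℝ) (m : ℕ) {U : Type*} [AddCommGroup U] [Module ℝ U]
    (F G : ℝ → ℝ → U) : Prop :=
  IsOmegaBigO ρ T ω m fun s t => F s t - G s t

/-- `F_{s,t} ≈ G_{s,t}`, i.e. `≈_{⌊ρ⌋ + 1}`. -/
def AlmostEqual (ρ T : ℝ) (ω : ℝ → ℝ → ℝ) {U : Type*} [AddCommGroup U] [Module ℝ U]
    (F G : ℝ → ℝ → U) : Prop :=
  Approx ρ T ω (⌊ρ⌋₊ + 1) F G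

variable {B : Type*} [Finite B]

/-- `X` is a `V`-valued `ρ`-branched rough path on `[0,T]` controlled by `ω`. -/
structure IsBranchedRoughPath (ρ T : ℝ) (ω : ℝ → ℝ → ℝ) (X : ℝ → ℝ → weightLE B ⌊ρ⌋₊) :
    Prop where
  chen : ∀ s u t, 0 ≤ s → s ≤ u → u ≤ t → t ≤ T →
    X s t = truncLE ⌊ρ⌋₊ (starGL (X s u : HGL B) (X u t))
  unit : ∀ s t, 0 ≤ s → s ≤ t → t ≤ T → pair (fo 0) (X s t : HGL B) = 1
  character : ∀ s t, 0 ≤ s → s ≤ t → t ≤ T → ∀ f g : Forest B, f.weight + g.weight ≤ ⌊ρ⌋₊ →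
    pair (fo (f + g)) (X s t : HGL B) = pair (fo f) (X s t : HGL B) * pair (fo g) (X s t : HGL B)
  regular : ∀ f : Forest B, f.weight ≤ ⌊ρ⌋₊ →
    IsOmegaBigO ρ T ω f.weight fun s t => pair (fo f) (X s t : HGL B)

/-- `H ∈ 𝒟_X(U)`: `H` is a `U`-valued `X`-controlled path (`U` finite-dimensional). -/
structure IsControlledPath (ρ T : ℝ) (ω : ℝ → ℝ → ℝ) (X : ℝ → ℝ → weightLE B ⌊ρ⌋₊)
    {U : Type*} [AddCommGroup U] [Module ℝ U] (H : ℝ → weightLE B (⌊ρ⌋₊ - 1) →ₗ[ℝ] U) :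
    Prop where
  regular : ∀ h, IsOmegaBigO ρ T ω 1 fun s t => H t h - H s h
  controlled : ∀ n < ⌊ρ⌋₊, ∀ h : weightLE B (⌊ρ⌋₊ - 1), (h : HGL B) ∈ weightEq B n →
    Approx ρ T ω (⌊ρ⌋₊ - n) (fun _ t => H t h)
      (fun s t => H s (truncLE (⌊ρ⌋₊ - 1) (starGL (X s t : HGL B) h)))

/-! ## The identification `𝓛(H_GL, 𝓛(𝒬, W)) = (H_CK ⊗ 𝒫) ⊗ W → H_CK ⊗ W` and rough integrals -/

section Integral

variable {W : Type*} [NormedAddCommGroup W] [NormedSpace ℝ W]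

/-- The identification `H_CK ⊗ (𝒫 ⊗ W) → 𝓛(H_GL, 𝓛(𝒬, W))` given by the pairings (with `H_GL`
truncated at weight `N - 1` and `𝒬` truncated at weight `N`):
`h ⊗ (p ⊗ w)` is the map `k ↦ (q ↦ ⟨h, k⟩ ⟨p, q⟩ w)`. -/
def pairingIdent (B W : Type*) [Finite B] [NormedAddCommGroup W] [NormedSpace ℝ W] (N : ℕ) :
    weightLE B (N - 1) ⊗[ℝ] (PrimLE B N ⊗[ℝ] W) →ₗ[ℝ]
      (weightLE B (N - 1) →ₗ[ℝ] QLE B N →ₗ[ℝ] W) :=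
  TensorProduct.lift
    ((LinearMap.smulRightₗ ∘ₗ pair.domRestrict₁₂ (weightLE B (N - 1)) (weightLE B (N - 1))).compl₂
      (TensorProduct.lift (LinearMap.smulRightₗ ∘ₗ pair.domRestrict₁₂ (PrimLE B N) (QLE B N))))

/-- The map `⊤ ⊗ id : H_CK ⊗ (𝒫 ⊗ W) → H_CK ⊗ W`. -/
def topTensor (B W : Type*) [NormedAddCommGroup W] [NormedSpace ℝ W] (N : ℕ) :
    weightLE B (N - 1) ⊗[ℝ] (PrimLE B N ⊗[ℝ] W) →ₗ[ℝ] HCK B ⊗[ℝ] W :=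
  LinearMap.rTensor W
      (TensorProduct.lift (growth.domRestrict₁₂ (weightLE B (N - 1)) (PrimLE B N)))
    ∘ₗ (TensorProduct.assoc ℝ _ _ W).symm.toLinearMap

/-- The element of `H_CK ⊗ W` identified with an element of `𝓛(H_GL, 𝓛(𝒬, W))`. -/
def toCK {N : ℕ} (A : weightLE B (N - 1) →ₗ[ℝ] QLE B N →ₗ[ℝ] W) : HCK B ⊗[ℝ] W :=
  topTensor B W N (Function.invFun (pairingIdent B W N) A)

/-- The pairing `(H_CK ⊗ W) × H_GL → W`. -/
def pairW : HCK B ⊗[ℝ] W →ₗ[ℝ] HGL B →ₗ[ℝ] W :=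
  TensorProduct.lift (LinearMap.smulRightₗ ∘ₗ pair)

/-- The element `k ↦ (q ↦ ⟨z, k ⋆ q⟩)` of `𝓛(H_GL, 𝓛(𝒬, W))` identified with `z ∈ H_CK ⊗ W`. -/
def ofCK (N : ℕ) (z : HCK B ⊗[ℝ] W) : weightLE B (N - 1) →ₗ[ℝ] QLE B N →ₗ[ℝ] W :=
  (starGL.domRestrict₁₂ (weightLE B (N - 1)) (QLE B N)).compr₂ (pairW z)

/-- The image of `A ∈ 𝓛(H_GL, 𝓛(𝒬, W))` under an endomorphism of `H_CK`, under the
identification with elements of `H_CK ⊗ W`. -/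
def applyCK {N : ℕ} (P : HCK B →ₗ[ℝ] HCK B) (A : weightLE B (N - 1) →ₗ[ℝ] QLE B N →ₗ[ℝ] W) :
    weightLE B (N - 1) →ₗ[ℝ] QLE B N →ₗ[ℝ] W :=
  ofCK N (LinearMap.rTensor W P (toCK A))

/-- `I` is the limit of `∑_{[u,v] ∈ Π} Ξ_{u,v}` over partitions `Π` of `[s,t]` with vanishing
mesh. -/
def HasPartitionLimit (Ξ : ℝ → ℝ → W) (s t : ℝ) (I : W) : Prop :=
  ∀ ε > 0, ∃ δ > 0, ∀ (n : ℕ) (u : ℕ → ℝ), Monotone u → u 0 = s → u n = t →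
    (∀ i < n, u (i + 1) - u i < δ) → ‖∑ i ∈ Finset.range n, Ξ (u i) (u (i + 1)) - I‖ < ε

/-- The local approximation `⟨H_s, X_{s,t}⟩` of the rough integral. -/
def localApprox {N : ℕ} (X : ℝ → ℝ → weightLE B N)
    (H : ℝ → weightLE B (N - 1) →ₗ[ℝ] QLE B N →ₗ[ℝ] W) (s t : ℝ) : W :=
  pairW (toCK (H s)) (X s t : HGL B)

/-- The integral `∫_s^t H dX` exists. -/
def RoughIntegrable {N : ℕ} (X : ℝ → ℝ → weightLE B N)
    (H : ℝ → weightLE B (N - 1) →ₗ[ℝ] QLE B N →ₗ[ℝ] W) (s t : ℝ) : Prop :=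
  ∃ I, HasPartitionLimit (localApprox X H) s t I

open scoped Classical in
/-- The rough integral `∫_s^t H dX`, the limit of the sums of `⟨H_u, X_{u,v}⟩` over partitions of
`[s,t]` with vanishing mesh. -/
def roughIntegral {N : ℕ} (X : ℝ → ℝ → weightLE B N)
    (H : ℝ → weightLE B (N - 1) →ₗ[ℝ] QLE B N →ₗ[ℝ] W) (s t : ℝ) : W :=
  if h : RoughIntegrable X H s t then h.choose else 0

/-- The integral `∫_s^t H_{π*(f)} dX^{π(f)}`, defined as the rough integral of
`⟨π(f), f⟩ Π_f(H)`. -/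
def coordIntegral {N : ℕ} (X : ℝ → ℝ → weightLE B N)
    (H : ℝ → weightLE B (N - 1) →ₗ[ℝ] QLE B N →ₗ[ℝ] W) (f : Forest B) (s t : ℝ) : W :=
  roughIntegral X (fun r => applyCK (PiHat f) (H r)) s t

/-- `∑_f ς(f)⁻¹ ∑_{l ∈ ℓ(f)} F(f_l)`, over the unlabelled forests `f` of weight at most `N`. -/
def labelSum {M : Type*} [AddCommGroup M] [Module ℝ M] (B : Type*) [Fintype B] (N : ℕ)
    (F : Forest B → M) : M :=
  ∑ f ∈ Forest.ofWeightLE Unit N, (f.symm : ℝ)⁻¹ • ((f.labellings B).map F).sum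

/-- The term `H_{g ⋆ π*(f);s} X^{g ⊤ π(f)}_{s,t}`. -/
def davieTerm {N : ℕ} (X : ℝ → ℝ → weightLE B N)
    (H : ℝ → weightLE B (N - 1) →ₗ[ℝ] QLE B N →ₗ[ℝ] W) (g f : Forest B) (s t : ℝ) : W :=
  pair (growth (fo g) (piCK (fo f))) (X s t : HGL B) •
    pairW (toCK (H s)) (starGL (fo g) (piStar (fo f)))

end Integral

end

/-! ## Forests -/

section Basics

variable {B : Type*}

/-! Everything rests on one cocycle identity. Grafting `h` onto the vertices of `y` is a derivation
in `y` that interacts simply with `Bplus a`, and this gives a formula for its coproduct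
(`coproduct_graft`). For primitive `p` the formula collapses to `Δ(h ⊤ p) = (h ⊤ p) ⊗ 1 + (id ⊗ (· ⊤
p)) Δh` (`coproduct_growth`).

The recursion for `π` says that `y₍₁₎ ⊤ π(y₍₂₎) = y` on `H_{CK,+}` (`growthPi_coproduct`). With
coassociativity, the cocycle identity and induction on the weight it follows that `π(y)` is
primitive; a second induction gives `π(h ⊤ p) = ε(h) p` (`piCK_growth_prim`), hence `(id ⊗ π) Δ(h ⊤
p) = h ⊗ p`. So `y ↦ y₍₁₎ ⊗ π(y₍₂₎)` inverts `⊤`, and the formula for `PiHat` follows. Dually, `⟨h ⊤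
p, x ⋆ π*(y)⟩ = ⟨h, x⟩ ⟨p, y⟩` (`pair_growth_star`), which justifies the identification of `𝓛(H_GL,
𝓛(𝒬, W))` with elements of `H_CK ⊗ W`. Expanding a primitive `p` in forests and applying `π` gives
`p = ∑ ς(f)⁻¹ ⟨p, f⟩ π(f)`, whence the decomposition into coordinates, both of `y` and of the
controlled path.

On a controlled path, `PiHat f` keeps only `A = H(·)(π*(f))`, up to a fixed linear map on values.
The result is therefore controlled, and its local approximation is `∑_g ς(g)⁻¹ ⟨g ⊤ π(f), X_{s,t}⟩
A_s(g)`, which is already the Davie sum. Chen's relation and the cocycle identity express the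
failure of additivity of this sum through products of `⟨k ⊤ π(f), X_{u,t}⟩`, of order `|k| + |f|`,
and a controlled remainder of order `N - |f| + 1 - |k|` (`localExpansion_sub`). The total order `N +
1` exceeds `ρ`, so the sewing lemma applies. The integral of `H` itself is a finite linear
combination of the coordinate integrals.

Finally, a labelled forest `f` occurs `ς(g)/ς(f)` times among the labellings of its underlying
forest `g` (`count_labellings`), so sums over labellings become sums over labelled forests with
weights `ς(f)⁻¹` (`labelSum_eq`). -/

theorem Multiset.map_mk_fst {α β : Type*} (f : Multiset α) (r : α → β) :
    (f.map fun s => (s, r s)).map Prod.fst = f := by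
  simp [Multiset.map_map]

theorem Multiset.map_mk_snd {α β : Type*} (f : Multiset α) (r : α → β) :
    (f.map fun s => (s, r s)).map Prod.snd = f.map r := by
  simp [Multiset.map_map]

theorem RTree.weight_node (a : B) (f : Forest B) : (RTree.node a f).weight = 1 + f.weight := by
  rw [RTree.weight_eq, RTree.children_node]; rfl

theorem RTree.weight_pos (t : RTree B) : 0 < t.weight := by rw [RTree.weight_eq]; omega

namespace Forest

@[simp] theorem weight_zero : (0 : Forest B).weight = 0 := rfl

theorem weight_add (f g : Forest B) : (f + g).weight = f.weight + g.weight := by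
  simp [weight]

theorem weight_singleton (t : RTree B) : weight ({t} : Forest B) = t.weight := by simp [weight]

theorem weight_cons (t : RTree B) (f : Forest B) : weight (t ::ₘ f) = t.weight + f.weight := by
  simp [weight]

theorem weight_eq_zero {f : Forest B} : f.weight = 0 ↔ f = 0 := by
  refine ⟨fun h => Multiset.eq_zero_of_forall_notMem fun t ht => ?_, fun h => h ▸ rfl⟩
  have := Multiset.single_le_sum (fun x _ => Nat.zero_le x) _
    (Multiset.mem_map_of_mem RTree.weight ht)
  have h2 := t.weight_pos
  rw [weight] at h
  omega

/-- Induction on the weight works because splitting off a tree and deleting a root both remove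
vertices. The three cases match the unit, the product and `Bplus a`, so Hopf-algebraic identities
can be checked on these generators. -/
theorem induction {P : Forest B → Prop} (zero : P 0) (add : ∀ f g, P f → P g → P (f + g))
    (node : ∀ a f, P f → P {RTree.node a f}) (f : Forest B) : P f := by
  suffices H : ∀ n, ∀ f : Forest B, f.weight = n → P f from H _ f rfl
  intro n
  induction n using Nat.strong_induction_on with
  | _ n ih =>
    intro f
    induction f using Multiset.induction_on with
    | empty => exact fun _ => zero
    | cons t f ihf =>
      intro h
      rw [weight_cons] at h
      have ht := t.weight_pos
      rw [← Multiset.singleton_add]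
      refine add _ _ ?_ (ih _ (by omega) f rfl)
      rw [← t.node_root_children]
      refine node _ _ (ih _ ?_ _ rfl)
      have := t.weight_eq
      rw [weight]
      omega

end Forest

/-! ## The span of forests -/

theorem fo_zero : fo (0 : Forest B) = 1 := rfl

theorem fo_add (f g : Forest B) : fo (f + g) = fo f * fo g := by
  rw [fo, fo, fo, AddMonoidAlgebra.single_mul_single, one_mul]

theorem linearMap_ext_fo {M : Type*} [AddCommMonoid M] [Module ℝ M]
    {φ ψ : AddMonoidAlgebra ℝ (Forest B) →ₗ[ℝ] M} (h : ∀ f, φ (fo f) = ψ (fo f)) : φ = ψ :=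
  (AddMonoidAlgebra.basis (Forest B) ℝ).ext fun f => by
    rw [AddMonoidAlgebra.basis_apply]; exact h f

theorem supported_eq_span_fo (s : Set (Forest B)) :
    AddMonoidAlgebra.supported ℝ ℝ s = Submodule.span ℝ (fo '' s) :=
  AddMonoidAlgebra.supported_eq_span_single ℝ s

theorem fo_mem_supported {s : Set (Forest B)} {f : Forest B} (h : f ∈ s) :
    fo f ∈ AddMonoidAlgebra.supported ℝ ℝ s := by
  rw [supported_eq_span_fo]
  exact Submodule.subset_span ⟨f, h, rfl⟩

theorem map_mem_of_supported {M : Type*} [AddCommMonoid M] [Module ℝ M] {s : Set (Forest B)}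
    {φ : AddMonoidAlgebra ℝ (Forest B) →ₗ[ℝ] M} {S : Submodule ℝ M} (h : ∀ f ∈ s, φ (fo f) ∈ S)
    {x : AddMonoidAlgebra ℝ (Forest B)} (hx : x ∈ AddMonoidAlgebra.supported ℝ ℝ s) : φ x ∈ S := by
  rw [supported_eq_span_fo] at hx
  have : Submodule.span ℝ (fo '' s) ≤ S.comap φ := by
    rw [Submodule.span_le]
    rintro _ ⟨f, hf, rfl⟩
    exact h f hf
  exact this hx

theorem eqOn_supported {M : Type*} [AddCommMonoid M] [Module ℝ M] {s : Set (Forest B)}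
    {φ ψ : AddMonoidAlgebra ℝ (Forest B) →ₗ[ℝ] M} (h : ∀ f ∈ s, φ (fo f) = ψ (fo f))
    {x : AddMonoidAlgebra ℝ (Forest B)} (hx : x ∈ AddMonoidAlgebra.supported ℝ ℝ s) :
    φ x = ψ x := by
  rw [supported_eq_span_fo] at hx
  have : Submodule.span ℝ (fo '' s) ≤ LinearMap.eqLocus φ ψ := by
    rw [Submodule.span_le]
    rintro _ ⟨f, hf, rfl⟩
    exact h f hf
  exact this hx

theorem Bplus_fo (a : B) (f : Forest B) : Bplus a (fo f) = fo {RTree.node a f} := linExt_fo _ _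

/-! ## The coproduct -/

theorem coproduct_fo (f : Forest B) : coproduct (fo f) = (f.map coproductTree).prod :=
  linExt_fo _ _

theorem coproductTree_node (a : B) (f : Forest B) : coproductTree (RTree.node a f)
    = fo {RTree.node a f} ⊗ₜ[ℝ] (1 : HCK B)
      + LinearMap.lTensor (HCK B) (Bplus a) (coproduct (fo f)) := by
  rw [coproduct_fo, coproductTree, RTree.recurse_eq, RTree.root_node, RTree.children_node,
    Multiset.map_mk_fst, Multiset.map_mk_snd]

theorem coproduct_one : coproduct (1 : HCK B) = 1 := by
  rw [← fo_zero, coproduct_fo, Multiset.map_zero, Multiset.prod_zero]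

theorem coproduct_fo_add (f g : Forest B) :
    coproduct (fo (f + g)) = coproduct (fo f) * coproduct (fo g) := by
  simp only [coproduct_fo, Multiset.map_add, Multiset.prod_add]

theorem bilinear_ext_fo {M : Type*} [AddCommGroup M] [Module ℝ M]
    {φ ψ : HCK B →ₗ[ℝ] HCK B →ₗ[ℝ] M} (h : ∀ f g, φ (fo f) (fo g) = ψ (fo f) (fo g))
    (x y : HCK B) : φ x y = ψ x y := by
  have : φ = ψ := linearMap_ext_fo fun f => linearMap_ext_fo fun g => h f g
  rw [this]

theorem coproduct_mul (x y : HCK B) : coproduct (x * y) = coproduct x * coproduct y := by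
  refine bilinear_ext_fo (φ := (LinearMap.mul ℝ (HCK B)).compr₂ coproduct)
    (ψ := (LinearMap.mul ℝ (HCK B ⊗[ℝ] HCK B)).compl₁₂ coproduct coproduct) (fun f g => ?_) x y
  simp only [LinearMap.compr₂_apply, LinearMap.mul_apply', LinearMap.compl₁₂_apply, ← fo_add,
    coproduct_fo_add]

theorem coproduct_Bplus (a : B) (x : HCK B) : coproduct (Bplus a x)
    = Bplus a x ⊗ₜ[ℝ] (1 : HCK B) + LinearMap.lTensor (HCK B) (Bplus a) (coproduct x) := by
  have : coproduct ∘ₗ Bplus a = (TensorProduct.mk ℝ (HCK B) (HCK B)).flip 1 ∘ₗ Bplus a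
      + LinearMap.lTensor (HCK B) (Bplus a) ∘ₗ coproduct := by
    refine linearMap_ext_fo fun f => ?_
    simp only [LinearMap.comp_apply, LinearMap.add_apply, Bplus_fo, LinearMap.flip_apply,
      TensorProduct.mk_apply]
    rw [← coproductTree_node, coproduct_fo, Multiset.map_singleton, Multiset.prod_singleton]
  exact LinearMap.congr_fun this x

/-- The coproduct as an algebra homomorphism. -/
noncomputable def coproductHom (B : Type*) : HCK B →ₐ[ℝ] HCK B ⊗[ℝ] HCK B :=
  AlgHom.ofLinearMap coproduct coproduct_one coproduct_mul

/-- Both sides are multiplicative, so only the passage from `f` to `[f]_a` has content; there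
`coproduct_Bplus` is applied twice, and `h1`, `h2`, `h3` move `Bplus a` past the remaining maps. -/
theorem coproduct_assoc (x : HCK B) :
    TensorProduct.assoc ℝ _ _ _ (LinearMap.rTensor (HCK B) coproduct (coproduct x))
      = LinearMap.lTensor (HCK B) coproduct (coproduct x) := by
  suffices H : ∀ f : Forest B,
      (Algebra.TensorProduct.assoc ℝ ℝ ℝ (HCK B) (HCK B) (HCK B))
        (Algebra.TensorProduct.map (coproductHom B) (AlgHom.id ℝ (HCK B)) (coproduct (fo f)))
      = Algebra.TensorProduct.map (AlgHom.id ℝ (HCK B)) (coproductHom B) (coproduct (fo f)) by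
    have := linearMap_ext_fo (φ := (TensorProduct.assoc ℝ _ _ _).toLinearMap ∘ₗ
      LinearMap.rTensor (HCK B) coproduct ∘ₗ coproduct)
      (ψ := LinearMap.lTensor (HCK B) coproduct ∘ₗ coproduct) (fun f => H f)
    exact LinearMap.congr_fun this x
  intro f
  induction f using Forest.induction with
  | zero => simp [fo_zero, coproduct_one]
  | add f g hf hg => rw [coproduct_fo_add, map_mul, map_mul, map_mul, hf, hg]
  | node a f hf =>
    rw [← Bplus_fo, coproduct_Bplus]
    have h1 : ∀ z : HCK B ⊗[ℝ] HCK B,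
        Algebra.TensorProduct.map (coproductHom B) (AlgHom.id ℝ (HCK B))
          (LinearMap.lTensor (HCK B) (Bplus a) z)
        = LinearMap.lTensor (HCK B ⊗[ℝ] HCK B) (Bplus a)
          (Algebra.TensorProduct.map (coproductHom B) (AlgHom.id ℝ (HCK B)) z) := by
      intro z
      induction z using TensorProduct.induction_on with
      | zero => simp
      | tmul u v => simp
      | add z w hz hw => simp only [map_add, hz, hw]
    have h2 : ∀ z : (HCK B ⊗[ℝ] HCK B) ⊗[ℝ] HCK B,
        Algebra.TensorProduct.assoc ℝ ℝ ℝ (HCK B) (HCK B) (HCK B)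
          (LinearMap.lTensor (HCK B ⊗[ℝ] HCK B) (Bplus a) z)
        = LinearMap.lTensor (HCK B) (LinearMap.lTensor (HCK B) (Bplus a))
          (Algebra.TensorProduct.assoc ℝ ℝ ℝ (HCK B) (HCK B) (HCK B) z) := by
      intro z
      induction z using TensorProduct.induction_on with
      | zero => simp
      | tmul u v =>
        induction u using TensorProduct.induction_on with
        | zero => simp
        | tmul u u' => simp
        | add z w hz hw => simp only [TensorProduct.add_tmul, map_add, hz, hw]
      | add z w hz hw => simp only [map_add, hz, hw]
    have h3 : ∀ z : HCK B ⊗[ℝ] HCK B,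
        Algebra.TensorProduct.map (AlgHom.id ℝ (HCK B)) (coproductHom B)
          (LinearMap.lTensor (HCK B) (Bplus a) z)
        = Algebra.TensorProduct.assoc ℝ ℝ ℝ (HCK B) (HCK B) (HCK B)
            (LinearMap.lTensor (HCK B) (Bplus a) z ⊗ₜ 1)
          + LinearMap.lTensor (HCK B) (LinearMap.lTensor (HCK B) (Bplus a))
            (Algebra.TensorProduct.map (AlgHom.id ℝ (HCK B)) (coproductHom B) z) := by
      intro z
      induction z using TensorProduct.induction_on with
      | zero => simp
      | tmul u v =>
        simp only [LinearMap.lTensor_tmul, Algebra.TensorProduct.map_tmul, AlgHom.coe_id, id_eq,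
          coproductHom, AlgHom.ofLinearMap_apply, coproduct_Bplus, TensorProduct.tmul_add,
          Algebra.TensorProduct.assoc_tmul]
      | add z w hz hw =>
        simp only [map_add, TensorProduct.add_tmul, hz, hw]
        abel
    rw [map_add, map_add, map_add, h1, h2, hf, h3]
    simp only [Algebra.TensorProduct.map_tmul, AlgHom.coe_id, id_eq, map_one, coproductHom,
      AlgHom.ofLinearMap_apply, coproduct_Bplus, TensorProduct.add_tmul, map_add,
      Algebra.TensorProduct.assoc_tmul, Algebra.TensorProduct.one_def]
    abel

end Basics

section Grading

variable {B : Type*}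

/-! ## Gradings -/

theorem fo_mem_weightEq (f : Forest B) : fo f ∈ weightEq B f.weight := fo_mem_supported rfl

theorem mul_mem_weightEq {m n : ℕ} {x y : HCK B} (hx : x ∈ weightEq B m) (hy : y ∈ weightEq B n) :
    x * y ∈ weightEq B (m + n) := by
  refine map_mem_of_supported (φ := (LinearMap.mul ℝ (HCK B)).flip y) (fun f hf => ?_) hx
  refine map_mem_of_supported (φ := (LinearMap.mul ℝ (HCK B)) (fo f)) (fun g hg => ?_) hy
  rw [LinearMap.mul_apply', ← fo_add]
  refine fo_mem_supported ?_
  simp only [Set.mem_ofPred_eq] at hf hg ⊢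
  rw [Forest.weight_add, hf, hg]

theorem Bplus_mem_weightEq {n : ℕ} (a : B) {x : HCK B} (hx : x ∈ weightEq B n) :
    Bplus a x ∈ weightEq B (1 + n) := by
  refine map_mem_of_supported (fun f hf => ?_) hx
  rw [Bplus_fo]
  refine fo_mem_supported ?_
  simp only [Set.mem_ofPred_eq] at hf ⊢
  rw [Forest.weight_singleton, RTree.weight_node, hf]

/-- The tensors of total weight `n`. -/
noncomputable def tensorWeightEq (B : Type*) (n : ℕ) : Submodule ℝ (HCK B ⊗[ℝ] HCK B) :=
  Submodule.span ℝ {z | ∃ f g : Forest B, f.weight + g.weight = n ∧ z = fo f ⊗ₜ fo g}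

/-- The tensors of total weight `n` in `H_{CK,+} ⊗ H_{CK,+}`. -/
noncomputable def tensorPosWeightEq (B : Type*) (n : ℕ) : Submodule ℝ (HCK B ⊗[ℝ] HCK B) :=
  Submodule.span ℝ {z | ∃ f g : Forest B, f ≠ 0 ∧ g ≠ 0 ∧ f.weight + g.weight = n ∧
    z = fo f ⊗ₜ fo g}

theorem fo_tmul_mem_tensorWeightEq (f g : Forest B) :
    fo f ⊗ₜ[ℝ] fo g ∈ tensorWeightEq B (f.weight + g.weight) :=
  Submodule.subset_span ⟨f, g, rfl, rfl⟩

theorem fo_tmul_mem_tensorPosWeightEq {f g : Forest B} (hf : f ≠ 0) (hg : g ≠ 0) :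
    fo f ⊗ₜ[ℝ] fo g ∈ tensorPosWeightEq B (f.weight + g.weight) :=
  Submodule.subset_span ⟨f, g, hf, hg, rfl, rfl⟩

theorem tensorPosWeightEq_le (n : ℕ) : tensorPosWeightEq B n ≤ tensorWeightEq B n := by
  refine Submodule.span_mono ?_
  rintro _ ⟨f, g, -, -, h, rfl⟩
  exact ⟨f, g, h, rfl⟩

theorem mul_mem_tensorPosWeightEq {m n : ℕ} {z w : HCK B ⊗[ℝ] HCK B}
    (hz : z ∈ tensorPosWeightEq B m) (hw : w ∈ tensorWeightEq B n) :
    z * w ∈ tensorPosWeightEq B (m + n) := by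
  have := Submodule.mul_mem_mul hz hw
  rw [tensorPosWeightEq, tensorWeightEq, Submodule.span_mul_span] at this
  refine Submodule.span_mono ?_ this
  rintro _ ⟨_, ⟨f, g, hf, hg, h, rfl⟩, _, ⟨f', g', h', rfl⟩, rfl⟩
  refine ⟨f + f', g + g', ?_, ?_, ?_, ?_⟩
  · simp [hf]
  · simp [hg]
  · rw [Forest.weight_add, Forest.weight_add]; omega
  · simp only [Algebra.TensorProduct.tmul_mul_tmul, fo_add]

/-- In `Δf · Δg` the mixed terms are `f ⊗ g`, `g ⊗ f` and products containing a reduced term, and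
such products keep both factors non-empty. This bound is what drives every induction on the weight
through the reduced coproduct. -/
theorem coproduct_fo_sub_mem (f : Forest B) (h0 : f ≠ 0) :
    coproduct (fo f) - fo f ⊗ₜ 1 - 1 ⊗ₜ fo f ∈ tensorPosWeightEq B f.weight := by
  induction f using Forest.induction with
  | zero => exact absurd rfl h0
  | add f g hf hg =>
    rcases eq_or_ne f 0 with rfl | hf0
    · simpa using hg (by simpa using h0)
    rcases eq_or_ne g 0 with rfl | hg0
    · simpa using hf (by simpa using h0)
    specialize hf hf0
    specialize hg hg0
    rw [coproduct_fo_add]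
    set r := coproduct (fo f) - fo f ⊗ₜ 1 - 1 ⊗ₜ fo f with hr
    set s := coproduct (fo g) - fo g ⊗ₜ 1 - 1 ⊗ₜ fo g with hs
    have h1 : coproduct (fo f) = fo f ⊗ₜ 1 + 1 ⊗ₜ fo f + r := by rw [hr]; abel
    have h2 : coproduct (fo g) = fo g ⊗ₜ 1 + 1 ⊗ₜ fo g + s := by rw [hs]; abel
    have h3 : coproduct (fo f) * coproduct (fo g) - fo (f + g) ⊗ₜ 1 - 1 ⊗ₜ fo (f + g)
        = fo f ⊗ₜ fo g + fo g ⊗ₜ fo f + r * (fo g ⊗ₜ 1 + 1 ⊗ₜ fo g + s)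
          + s * (fo f ⊗ₜ 1 + 1 ⊗ₜ fo f) := by
      have e1 : fo (f + g) ⊗ₜ[ℝ] (1 : HCK B) = (fo f ⊗ₜ 1) * (fo g ⊗ₜ 1) := by
        rw [Algebra.TensorProduct.tmul_mul_tmul, fo_add, one_mul]
      have e2 : (1 : HCK B) ⊗ₜ[ℝ] fo (f + g) = (1 ⊗ₜ fo f) * (1 ⊗ₜ fo g) := by
        rw [Algebra.TensorProduct.tmul_mul_tmul, fo_add, one_mul]
      have e3 : fo f ⊗ₜ[ℝ] fo g = (fo f ⊗ₜ 1) * (1 ⊗ₜ fo g) := by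
        rw [Algebra.TensorProduct.tmul_mul_tmul, mul_one, one_mul]
      have e4 : fo g ⊗ₜ[ℝ] fo f = (fo g ⊗ₜ 1) * (1 ⊗ₜ fo f) := by
        rw [Algebra.TensorProduct.tmul_mul_tmul, mul_one, one_mul]
      rw [h1, h2, e1, e2, e3, e4]
      ring
    have hl : ∀ k : Forest B, fo k ⊗ₜ[ℝ] (1 : HCK B) ∈ tensorWeightEq B k.weight := fun k =>
      fo_tmul_mem_tensorWeightEq k 0
    have hr' : ∀ k : Forest B, (1 : HCK B) ⊗ₜ[ℝ] fo k ∈ tensorWeightEq B k.weight := fun k => by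
      simpa [fo_zero] using fo_tmul_mem_tensorWeightEq 0 k
    rw [h3, Forest.weight_add]
    refine add_mem (add_mem (add_mem ?_ ?_) ?_) ?_
    · exact fo_tmul_mem_tensorPosWeightEq hf0 hg0
    · rw [add_comm f.weight]
      exact fo_tmul_mem_tensorPosWeightEq hg0 hf0
    · exact mul_mem_tensorPosWeightEq hf
        (add_mem (add_mem (hl g) (hr' g)) (tensorPosWeightEq_le _ hg))
    · rw [add_comm f.weight]
      exact mul_mem_tensorPosWeightEq hg (add_mem (hl f) (hr' f))
  | node a f hf =>
    have key : ∀ n, ∀ z ∈ tensorPosWeightEq B n,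
        LinearMap.lTensor (HCK B) (Bplus a) z ∈ tensorPosWeightEq B (1 + n) := by
      intro n z hz
      have : tensorPosWeightEq B n
          ≤ (tensorPosWeightEq B (1 + n)).comap (LinearMap.lTensor (HCK B) (Bplus a)) := by
        refine Submodule.span_le.2 ?_
        rintro _ ⟨f, g, hf, -, h, rfl⟩
        simp only [SetLike.mem_coe, Submodule.mem_comap, LinearMap.lTensor_tmul, Bplus_fo]
        refine Submodule.subset_span ⟨f, {RTree.node a g}, hf, by simp, ?_, rfl⟩
        rw [Forest.weight_singleton, RTree.weight_node]
        omega
      exact this hz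
    rw [← Bplus_fo, coproduct_Bplus, add_sub_cancel_left, Bplus_fo, Forest.weight_singleton,
      RTree.weight_node]
    rcases eq_or_ne f 0 with rfl | hf0
    · rw [fo_zero, coproduct_one, Algebra.TensorProduct.one_def, LinearMap.lTensor_tmul,
        ← fo_zero, Bplus_fo, sub_self]
      exact zero_mem _
    -- Under `id ⊗ [·]_a` the term `1 ⊗ f` becomes the subtracted `1 ⊗ [f]_a`, while `f ⊗ 1` becomes
    -- `f` tensor the one-vertex tree.
    have h1 : LinearMap.lTensor (HCK B) (Bplus a) (coproduct (fo f)) - 1 ⊗ₜ fo {RTree.node a f}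
        = fo f ⊗ₜ fo {RTree.node a 0} + LinearMap.lTensor (HCK B) (Bplus a)
          (coproduct (fo f) - fo f ⊗ₜ 1 - 1 ⊗ₜ fo f) := by
      rw [map_sub, map_sub, LinearMap.lTensor_tmul, LinearMap.lTensor_tmul, Bplus_fo,
        ← fo_zero, Bplus_fo]
      abel
    rw [h1]
    refine add_mem ?_ (key _ _ (hf hf0))
    refine Submodule.subset_span ⟨_, _, hf0, by simp, ?_, rfl⟩
    rw [Forest.weight_singleton, RTree.weight_node, Forest.weight_zero]
    omega

theorem coproduct_fo_mem (f : Forest B) : coproduct (fo f) ∈ tensorWeightEq B f.weight := by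
  rcases eq_or_ne f 0 with rfl | hf
  · rw [fo_zero, coproduct_one, Algebra.TensorProduct.one_def]
    exact fo_tmul_mem_tensorWeightEq 0 0
  · have h := tensorPosWeightEq_le _ (coproduct_fo_sub_mem f hf)
    have h1 : fo f ⊗ₜ[ℝ] (1 : HCK B) ∈ tensorWeightEq B f.weight := fo_tmul_mem_tensorWeightEq f 0
    have h2 : (1 : HCK B) ⊗ₜ[ℝ] fo f ∈ tensorWeightEq B f.weight := by
      simpa [fo_zero] using fo_tmul_mem_tensorWeightEq 0 f
    have := add_mem (add_mem h h2) h1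
    simpa using this

/-! ## Weight multipliers -/

/-- The operator multiplying each forest `f` by `c |f|`. -/
noncomputable def weightMul (c : ℕ → ℝ) : HCK B →ₗ[ℝ] HCK B := linExt fun f => c f.weight • fo f

/-- The operator multiplying `f ⊗ g` by `c (|f| + |g|)`. -/
noncomputable def tensorWeightMul (c : ℕ → ℝ) : HCK B ⊗[ℝ] HCK B →ₗ[ℝ] HCK B ⊗[ℝ] HCK B :=
  TensorProduct.lift (linExt fun f => linExt fun g => c (f.weight + g.weight) • (fo f ⊗ₜ fo g))

theorem weightMul_fo (c : ℕ → ℝ) (f : Forest B) : weightMul c (fo f) = c f.weight • fo f :=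
  linExt_fo _ _

theorem tensorWeightMul_fo (c : ℕ → ℝ) (f g : Forest B) :
    tensorWeightMul c (fo f ⊗ₜ fo g) = c (f.weight + g.weight) • (fo f ⊗ₜ[ℝ] fo g) := by
  rw [tensorWeightMul, TensorProduct.lift.tmul, linExt_fo, linExt_fo]

theorem tensorWeightMul_of_mem (c : ℕ → ℝ) {n : ℕ} {z : HCK B ⊗[ℝ] HCK B}
    (hz : z ∈ tensorWeightEq B n) : tensorWeightMul c z = c n • z := by
  have : tensorWeightEq B n ≤ LinearMap.eqLocus (tensorWeightMul c) (c n • LinearMap.id) := by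
    refine Submodule.span_le.2 ?_
    rintro _ ⟨f, g, h, rfl⟩
    simp [tensorWeightMul_fo, h]
  exact this hz

theorem coproduct_weightMul (c : ℕ → ℝ) (y : HCK B) :
    coproduct (weightMul c y) = tensorWeightMul c (coproduct y) := by
  refine LinearMap.congr_fun (f := coproduct ∘ₗ weightMul c)
    (g := tensorWeightMul c ∘ₗ coproduct) (linearMap_ext_fo fun f => ?_) y
  rw [LinearMap.comp_apply, LinearMap.comp_apply, weightMul_fo, map_smul,
    tensorWeightMul_of_mem c (coproduct_fo_mem f)]

theorem mem_Prim {p : HCK B} : p ∈ Prim B ↔ coproduct p = p ⊗ₜ 1 + 1 ⊗ₜ p := by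
  rw [Prim, LinearMap.mem_ker, reducedCoproduct]
  simp only [LinearMap.sub_apply, LinearMap.flip_apply, TensorProduct.mk_apply]
  rw [sub_sub, sub_eq_zero]

/-- The coproduct preserves total weight, so a rescaling by a function of the weight passes through
it. This carries primitivity across the division by the number of vertices that separates `growth`
from `graft`. -/
theorem weightMul_mem_Prim (c : ℕ → ℝ) {p : HCK B} (hp : p ∈ Prim B) : weightMul c p ∈ Prim B := by
  rw [mem_Prim] at hp ⊢
  rw [coproduct_weightMul, hp, map_add]
  have h1 : tensorWeightMul c ∘ₗ (TensorProduct.mk ℝ (HCK B) (HCK B)).flip 1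
      = (TensorProduct.mk ℝ (HCK B) (HCK B)).flip 1 ∘ₗ weightMul c := by
    refine linearMap_ext_fo fun f => ?_
    simp only [LinearMap.comp_apply, LinearMap.flip_apply, TensorProduct.mk_apply, weightMul_fo]
    rw [← fo_zero, tensorWeightMul_fo, Forest.weight_zero, add_zero, TensorProduct.smul_tmul']
  have h2 : tensorWeightMul c ∘ₗ TensorProduct.mk ℝ (HCK B) (HCK B) 1
      = TensorProduct.mk ℝ (HCK B) (HCK B) 1 ∘ₗ weightMul c := by
    refine linearMap_ext_fo fun f => ?_
    simp only [LinearMap.comp_apply, TensorProduct.mk_apply, weightMul_fo, TensorProduct.tmul_smul]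
    rw [← fo_zero, tensorWeightMul_fo, Forest.weight_zero, zero_add]
  exact congrArg₂ (· + ·) (LinearMap.congr_fun h1 p) (LinearMap.congr_fun h2 p)

/-! ## Grafting -/

theorem graftTree_node (h : Forest B) (a : B) (f : Forest B) : graftTree h (RTree.node a f)
    = fo {RTree.node a (h + f)} + Bplus a (graftForest h f) := by
  rw [graftTree, RTree.recurse_eq, RTree.root_node, RTree.children_node, Multiset.map_mk_fst,
    Multiset.map_map]
  rfl

/-- The sum over all vertices `v` of `y` of the forests obtained by grafting `h` onto `v`. -/
noncomputable def graft : HCK B →ₗ[ℝ] HCK B →ₗ[ℝ] HCK B :=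
  linExt fun h => linExt fun f => graftForest h f

theorem graft_fo (h f : Forest B) : graft (fo h) (fo f) = graftForest h f := by
  rw [graft, linExt_fo, linExt_fo]

theorem growth_eq_graft (h y : HCK B) :
    growth h y = graft h (weightMul (fun n => (n : ℝ)⁻¹) y) := by
  refine bilinear_ext_fo (φ := growth) (ψ := graft.compl₂ (weightMul fun n => (n : ℝ)⁻¹))
    (fun h f => ?_) h y
  rw [growth, linExt_fo, linExt_fo, LinearMap.compl₂_apply, weightMul_fo, map_smul, graft_fo]

open scoped Classical in
theorem graftForest_add (h f g : Forest B) :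
    graftForest h (f + g) = graftForest h f * fo g + fo f * graftForest h g := by
  rw [graftForest, Multiset.map_add, Multiset.sum_add, graftForest, graftForest,
    ← Multiset.sum_map_mul_right, ← Multiset.sum_map_mul_left]
  congr 2
  · refine Multiset.map_congr rfl fun t ht => ?_
    rw [Multiset.erase_add_left_pos _ ht, fo_add]
    ring
  · refine Multiset.map_congr rfl fun t ht => ?_
    rw [Multiset.erase_add_right_pos _ ht, fo_add]
    ring

theorem graft_one (h : HCK B) : graft h 1 = 0 := by
  refine LinearMap.congr_fun (f := graft.flip 1) (g := 0) (linearMap_ext_fo fun f => ?_) h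
  rw [← fo_zero, LinearMap.flip_apply, graft_fo]
  simp [graftForest]

/-- A vertex of a disjoint union lies in exactly one of the factors. -/
theorem graft_mul (h x y : HCK B) : graft h (x * y) = graft h x * y + x * graft h y := by
  suffices H : ∀ f : Forest B, graft (fo f) (x * y) = graft (fo f) x * y + x * graft (fo f) y by
    refine LinearMap.congr_fun (f := graft.flip (x * y)) (g := (LinearMap.mul ℝ (HCK B)).flip y ∘ₗ
      graft.flip x + LinearMap.mul ℝ (HCK B) x ∘ₗ graft.flip y) (linearMap_ext_fo fun f => ?_) h
    exact H f
  intro f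
  refine bilinear_ext_fo (φ := (LinearMap.mul ℝ (HCK B)).compr₂ (graft (fo f)))
    (ψ := (LinearMap.mul ℝ (HCK B)) ∘ₗ (graft (fo f))
      + (LinearMap.mul ℝ (HCK B)).compl₂ (graft (fo f))) (fun g k => ?_) x y
  simp only [LinearMap.compr₂_apply, LinearMap.mul_apply', LinearMap.add_apply,
    LinearMap.comp_apply, LinearMap.compl₂_apply]
  rw [← fo_add, graft_fo, graft_fo, graft_fo, graftForest_add]

/-- The vertex that receives `h` is either the new root or a vertex of `x`. -/
theorem graft_Bplus (a : B) (h x : HCK B) :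
    graft h (Bplus a x) = Bplus a (h * x) + Bplus a (graft h x) := by
  refine bilinear_ext_fo (φ := graft.compl₂ (Bplus a))
    (ψ := (LinearMap.mul ℝ (HCK B)).compr₂ (Bplus a) + graft.compr₂ (Bplus a)) (fun h f => ?_) h x
  simp only [LinearMap.compr₂_apply, LinearMap.mul_apply', LinearMap.add_apply,
    LinearMap.compl₂_apply]
  rw [Bplus_fo, graft_fo, graft_fo, ← fo_add, Bplus_fo, ← graftTree_node, graftForest]
  simp [fo_zero]

theorem graft_fo_mem_weightEq (h f : Forest B) :
    graft (fo h) (fo f) ∈ weightEq B (h.weight + f.weight) := by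
  induction f using Forest.induction with
  | zero => rw [fo_zero, graft_one]; exact zero_mem _
  | add f g hf hg =>
    rw [fo_add, graft_mul, Forest.weight_add]
    refine add_mem ?_ ?_
    · rw [← add_assoc]
      exact mul_mem_weightEq hf (fo_mem_weightEq g)
    · have := mul_mem_weightEq (fo_mem_weightEq f) hg
      rwa [← add_assoc, add_comm f.weight, add_assoc] at this
  | node a f hf =>
    rw [← Bplus_fo, graft_Bplus, Forest.weight_singleton, RTree.weight_node, ← fo_add]
    have e : h.weight + (1 + f.weight) = 1 + (h.weight + f.weight) := by omega
    rw [e]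
    refine add_mem (Bplus_mem_weightEq a ?_) (Bplus_mem_weightEq a hf)
    rw [← Forest.weight_add]
    exact fo_mem_weightEq _

theorem weightMul_mem_weightEq (c : ℕ → ℝ) {n : ℕ} {x : HCK B} (hx : x ∈ weightEq B n) :
    weightMul c x ∈ weightEq B n := by
  refine map_mem_of_supported (fun f hf => ?_) hx
  rw [weightMul_fo]
  exact Submodule.smul_mem _ _ (fo_mem_supported hf)

theorem growth_mem_weightEq {m n : ℕ} {h y : HCK B} (hh : h ∈ weightEq B m)
    (hy : y ∈ weightEq B n) : growth h y ∈ weightEq B (m + n) := by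
  rw [growth_eq_graft]
  refine map_mem_of_supported (φ := graft.flip _) (fun f hf => ?_) hh
  refine map_mem_of_supported (φ := graft (fo f)) (fun g hg => ?_) (weightMul_mem_weightEq _ hy)
  simp only [Set.mem_ofPred_eq] at hf hg
  rw [← hf, ← hg]
  exact graft_fo_mem_weightEq f g

/-! ## The coproduct of a grafting -/

/-- The operator `x ⊗ y ↦ z₍₁₎ x ⊗ graft z₍₂₎ y`. -/
noncomputable def mulGraft : HCK B ⊗[ℝ] HCK B →ₗ[ℝ] HCK B ⊗[ℝ] HCK B →ₗ[ℝ] HCK B ⊗[ℝ] HCK B :=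
  TensorProduct.lift
    ((TensorProduct.mapBilinear (RingHom.id ℝ) (HCK B) (HCK B) (HCK B) (HCK B)).compl₁₂
      (LinearMap.mul ℝ (HCK B)) graft)

theorem mulGraft_tmul (u v x y : HCK B) :
    mulGraft (u ⊗ₜ v) (x ⊗ₜ y) = (u * x) ⊗ₜ[ℝ] graft v y := by
  simp [mulGraft]

theorem tensor_bilinear_ext {M : Type*} [AddCommGroup M] [Module ℝ M]
    {φ ψ : HCK B ⊗[ℝ] HCK B →ₗ[ℝ] HCK B ⊗[ℝ] HCK B →ₗ[ℝ] M}
    (h : ∀ x y u v, φ (x ⊗ₜ y) (u ⊗ₜ v) = ψ (x ⊗ₜ y) (u ⊗ₜ v)) (z w : HCK B ⊗[ℝ] HCK B) :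
    φ z w = ψ z w := by
  have : φ = ψ := TensorProduct.ext' fun x y => TensorProduct.ext' fun u v => h x y u v
  rw [this]

theorem mulGraft_mul (t z w : HCK B ⊗[ℝ] HCK B) :
    mulGraft t (z * w) = mulGraft t z * w + z * mulGraft t w := by
  induction t using TensorProduct.induction_on with
  | zero => simp
  | add t t' ht ht' =>
    simp only [map_add, LinearMap.add_apply, ht, ht']
    ring
  | tmul p q =>
    refine tensor_bilinear_ext (φ := (LinearMap.mul ℝ (HCK B ⊗[ℝ] HCK B)).compr₂ (mulGraft (p ⊗ₜ q)))
      (ψ := (LinearMap.mul ℝ (HCK B ⊗[ℝ] HCK B)) ∘ₗ (mulGraft (p ⊗ₜ q))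
        + (LinearMap.mul ℝ (HCK B ⊗[ℝ] HCK B)).compl₂ (mulGraft (p ⊗ₜ q))) (fun x y u v => ?_) z w
    simp only [LinearMap.compr₂_apply, LinearMap.mul_apply', LinearMap.add_apply,
      LinearMap.comp_apply, LinearMap.compl₂_apply, Algebra.TensorProduct.tmul_mul_tmul,
      mulGraft_tmul, graft_mul, TensorProduct.tmul_add]
    congr 2 <;> ring

theorem rTensor_graft_mul (h : HCK B) (z w : HCK B ⊗[ℝ] HCK B) :
    LinearMap.rTensor (HCK B) (graft h) (z * w)
      = LinearMap.rTensor (HCK B) (graft h) z * w + z * LinearMap.rTensor (HCK B) (graft h) w := by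
  refine tensor_bilinear_ext
    (φ := (LinearMap.mul ℝ (HCK B ⊗[ℝ] HCK B)).compr₂ (LinearMap.rTensor (HCK B) (graft h)))
    (ψ := (LinearMap.mul ℝ (HCK B ⊗[ℝ] HCK B)) ∘ₗ (LinearMap.rTensor (HCK B) (graft h))
      + (LinearMap.mul ℝ (HCK B ⊗[ℝ] HCK B)).compl₂ (LinearMap.rTensor (HCK B) (graft h)))
    (fun x y u v => ?_) z w
  simp only [LinearMap.compr₂_apply, LinearMap.mul_apply', LinearMap.add_apply,
    LinearMap.comp_apply, LinearMap.compl₂_apply, Algebra.TensorProduct.tmul_mul_tmul,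
    LinearMap.rTensor_tmul, graft_mul, TensorProduct.add_tmul]

theorem mulGraft_tmul_one (z : HCK B ⊗[ℝ] HCK B) (x : HCK B) : mulGraft z (x ⊗ₜ 1) = 0 := by
  induction z using TensorProduct.induction_on with
  | zero => simp
  | tmul u v => rw [mulGraft_tmul, graft_one, TensorProduct.tmul_zero]
  | add z w hz hw => rw [map_add, LinearMap.add_apply, hz, hw, add_zero]

theorem mulGraft_lTensor_Bplus (a : B) (z w : HCK B ⊗[ℝ] HCK B) :
    mulGraft z (LinearMap.lTensor (HCK B) (Bplus a) w)
      = LinearMap.lTensor (HCK B) (Bplus a) (z * w)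
        + LinearMap.lTensor (HCK B) (Bplus a) (mulGraft z w) := by
  refine tensor_bilinear_ext (φ := mulGraft.compl₂ (LinearMap.lTensor (HCK B) (Bplus a)))
    (ψ := (LinearMap.mul ℝ (HCK B ⊗[ℝ] HCK B)).compr₂ (LinearMap.lTensor (HCK B) (Bplus a))
      + mulGraft.compr₂ (LinearMap.lTensor (HCK B) (Bplus a))) (fun x y u v => ?_) z w
  simp only [LinearMap.compr₂_apply, LinearMap.mul_apply', LinearMap.add_apply,
    LinearMap.compl₂_apply, Algebra.TensorProduct.tmul_mul_tmul, LinearMap.lTensor_tmul,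
    mulGraft_tmul, graft_Bplus, TensorProduct.tmul_add]

/-- Let `h` be grafted onto `v` and then cut. Either `v` is pruned and takes the whole of `h` with
it, or `v` stays in the trunk and `h` is itself cut, its pruned part joining the left factor.
Formally, both terms on the right are derivations in `Δy`, so the identity is checked on generators.
-/
theorem coproduct_graft (h y : HCK B) : coproduct (graft h y)
    = LinearMap.rTensor (HCK B) (graft h) (coproduct y) + mulGraft (coproduct h) (coproduct y) := by
  refine LinearMap.congr_fun (f := coproduct ∘ₗ graft h) (g := LinearMap.rTensor (HCK B) (graft h)
    ∘ₗ coproduct + mulGraft (coproduct h) ∘ₗ coproduct) (linearMap_ext_fo fun f => ?_) y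
  simp only [LinearMap.comp_apply, LinearMap.add_apply]
  induction f using Forest.induction with
  | zero =>
    rw [fo_zero, graft_one, coproduct_one, Algebra.TensorProduct.one_def, mulGraft_tmul_one,
      LinearMap.rTensor_tmul, graft_one, map_zero, TensorProduct.zero_tmul, add_zero]
  | add f g hf hg =>
    rw [fo_add, graft_mul, map_add, coproduct_mul, coproduct_mul, coproduct_mul, mulGraft_mul,
      rTensor_graft_mul, hf, hg]
    ring
  | node a f hf =>
    have hc : LinearMap.rTensor (HCK B) (graft h) (LinearMap.lTensor (HCK B) (Bplus a)
        (coproduct (fo f))) = LinearMap.lTensor (HCK B) (Bplus a) (LinearMap.rTensor (HCK B)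
          (graft h) (coproduct (fo f))) :=
      LinearMap.congr_fun ((LinearMap.rTensor_comp_lTensor ..).trans
        (LinearMap.lTensor_comp_rTensor ..).symm) _
    rw [← Bplus_fo, coproduct_Bplus, graft_Bplus, map_add, coproduct_Bplus, coproduct_Bplus, hf,
      map_add, map_add, map_add, mulGraft_tmul_one, mulGraft_lTensor_Bplus, LinearMap.rTensor_tmul,
      graft_Bplus, coproduct_mul, TensorProduct.add_tmul, hc]
    abel

/-- Applied to `z ⊗ 1 + 1 ⊗ z`, the formula `coproduct_graft` has four terms, two of which vanish
because the empty forest has no vertex to graft onto. Thus `· ⊤ p` obeys the same cocycle relation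
as `[·]_a`. -/
theorem coproduct_growth (h : HCK B) {p : HCK B} (hp : p ∈ Prim B) : coproduct (growth h p)
    = growth h p ⊗ₜ 1 + LinearMap.lTensor (HCK B) (growth.flip p) (coproduct h) := by
  have hz := weightMul_mem_Prim (fun n => (n : ℝ)⁻¹) hp
  rw [mem_Prim] at hz
  rw [growth_eq_graft, coproduct_graft, hz, map_add, map_add, mulGraft_tmul_one,
    LinearMap.rTensor_tmul, LinearMap.rTensor_tmul, graft_one, TensorProduct.zero_tmul, add_zero,
    zero_add]
  congr 1
  refine LinearMap.congr_fun (f := mulGraft.flip (1 ⊗ₜ _))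
    (g := LinearMap.lTensor (HCK B) (growth.flip p)) (TensorProduct.ext' fun u v => ?_) _
  rw [LinearMap.flip_apply, mulGraft_tmul, mul_one, LinearMap.lTensor_tmul, LinearMap.flip_apply,
    growth_eq_graft]

end Grading

section Projection

variable {B : Type*}

/-! ## The projection onto the primitive elements -/

/-- The counit of `H_CK`. -/
noncomputable def counit : HCK B →ₗ[ℝ] ℝ := linExt fun f => by
  classical exact if f = 0 then 1 else 0

theorem counit_one : counit (1 : HCK B) = 1 := by
  rw [← fo_zero, counit, linExt_fo, if_pos rfl]

theorem counit_fo {f : Forest B} (h : f ≠ 0) : counit (fo f) = 0 := by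
  rw [counit, linExt_fo, if_neg h]

theorem posPart_apply (y : HCK B) : posPart y = y - counit y • 1 := by
  refine LinearMap.congr_fun (f := posPart) (g := LinearMap.id - counit.smulRight 1)
    (linearMap_ext_fo fun f => ?_) y
  rw [LinearMap.sub_apply, LinearMap.smulRight_apply]
  change fo f - linExt _ (fo f) = fo f - _
  rw [linExt_fo]
  rcases eq_or_ne f 0 with rfl | h
  · rw [if_pos rfl, fo_zero, counit_one, one_smul]
  · rw [if_neg h, counit_fo h, zero_smul]

theorem posPart_one : posPart (1 : HCK B) = 0 := by
  rw [posPart_apply, counit_one, one_smul, sub_self]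

theorem posPart_fo {f : Forest B} (h : f ≠ 0) : posPart (fo f) = fo f := by
  rw [posPart_apply, counit_fo h, zero_smul, sub_zero]

theorem posPart_of_mem {y : HCK B} (hy : y ∈ HCKPos B) : posPart y = y :=
  eqOn_supported (φ := posPart) (ψ := LinearMap.id) (fun _ hf => posPart_fo hf) hy

theorem posPart_mem (y : HCK B) : posPart y ∈ HCKPos B := by
  refine map_mem_of_supported (s := Set.univ) (fun f _ => ?_)
    (AddMonoidAlgebra.mem_supported.2 (Set.subset_univ _))
  rcases eq_or_ne f 0 with rfl | h
  · rw [fo_zero, posPart_one]; exact zero_mem _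
  · rw [posPart_fo h]; exact fo_mem_supported h

theorem weightEq_le_HCKPos {n : ℕ} (hn : n ≠ 0) : weightEq B n ≤ HCKPos B := by
  refine AddMonoidAlgebra.supported_mono fun f hf => ?_
  rintro rfl
  exact hn hf.symm

theorem one_graft_fo (f : Forest B) : graft 1 (fo f) = (f.weight : ℝ) • fo f := by
  induction f using Forest.induction with
  | zero => rw [fo_zero, graft_one, Forest.weight_zero, Nat.cast_zero, zero_smul]
  | add f g hf hg =>
    rw [fo_add, graft_mul, hf, hg, Forest.weight_add, Nat.cast_add, add_smul, smul_mul_assoc,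
      mul_smul_comm]
  | node a f hf =>
    rw [← Bplus_fo, graft_Bplus, hf, one_mul, map_smul, Forest.weight_singleton,
      RTree.weight_node, Nat.cast_add, add_smul, Nat.cast_one, one_smul]

/-- Grafting the empty forest changes nothing, so the average over the vertices is the identity,
except on the empty forest, which has no vertices. -/
theorem one_growth (y : HCK B) : growth 1 y = posPart y := by
  refine LinearMap.congr_fun (f := growth 1) (linearMap_ext_fo fun f => ?_) y
  rw [growth_eq_graft, weightMul_fo, map_smul, one_graft_fo]
  rcases eq_or_ne f 0 with rfl | h
  · rw [fo_zero, posPart_one]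
    simp
  · rw [posPart_fo h, smul_smul, inv_mul_cancel₀, one_smul]
    exact Nat.cast_ne_zero.2 (mt Forest.weight_eq_zero.1 h)

theorem growth_one (h : HCK B) : growth h 1 = 0 := by
  rw [growth_eq_graft, ← fo_zero, weightMul_fo, map_smul, fo_zero, graft_one, smul_zero]

theorem growth_mem_HCKPos (h y : HCK B) : growth h y ∈ HCKPos B := by
  refine map_mem_of_supported (s := Set.univ) (φ := growth.flip y) (fun f _ => ?_)
    (AddMonoidAlgebra.mem_supported.2 (Set.subset_univ _))
  refine map_mem_of_supported (s := Set.univ) (φ := growth (fo f)) (fun g _ => ?_)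
    (AddMonoidAlgebra.mem_supported.2 (Set.subset_univ _))
  rcases eq_or_ne g 0 with rfl | hg
  · rw [fo_zero, growth_one]; exact zero_mem _
  · refine weightEq_le_HCKPos ?_ (growth_mem_weightEq (fo_mem_weightEq f) (fo_mem_weightEq g))
    have := mt Forest.weight_eq_zero.1 hg
    omega

theorem reducedCoproduct_apply (y : HCK B) :
    reducedCoproduct y = coproduct y - y ⊗ₜ 1 - 1 ⊗ₜ y := rfl

theorem coproduct_eq_add_reducedCoproduct (y : HCK B) :
    coproduct y = y ⊗ₜ 1 + 1 ⊗ₜ y + reducedCoproduct y := by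
  rw [reducedCoproduct_apply]; abel

theorem reducedCoproduct_fo_mem {f : Forest B} (hf : f ≠ 0) :
    reducedCoproduct (fo f) ∈ tensorPosWeightEq B f.weight := coproduct_fo_sub_mem f hf

theorem eqOn_tensorPosWeightEq {M : Type*} [AddCommMonoid M] [Module ℝ M] {n : ℕ}
    {φ ψ : HCK B ⊗[ℝ] HCK B →ₗ[ℝ] M}
    (h : ∀ f g : Forest B, f ≠ 0 → g ≠ 0 → f.weight < n → g.weight < n → f.weight + g.weight = n →
      φ (fo f ⊗ₜ fo g) = ψ (fo f ⊗ₜ fo g))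
    {z : HCK B ⊗[ℝ] HCK B} (hz : z ∈ tensorPosWeightEq B n) : φ z = ψ z := by
  have : tensorPosWeightEq B n ≤ LinearMap.eqLocus φ ψ := by
    refine Submodule.span_le.2 ?_
    rintro _ ⟨f, g, hf, hg, e, rfl⟩
    have h1 := mt Forest.weight_eq_zero.1 hf
    have h2 := mt Forest.weight_eq_zero.1 hg
    exact h f g hf hg (by omega) (by omega) e
  exact this hz

theorem piIter_one (n : ℕ) : piIter n (1 : HCK B) = 0 := by
  induction n with
  | zero => rfl
  | succ n ih =>
    rw [piIter, LinearMap.sub_apply, posPart_one, LinearMap.comp_apply, reducedCoproduct_apply,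
      coproduct_one, Algebra.TensorProduct.one_def, sub_self, map_sub, TensorProduct.lift.tmul,
      LinearMap.compl₂_apply, ih, map_zero, map_zero, sub_self, sub_self]

/-- The right factors of the reduced coproduct have strictly smaller weight, so the iteration is
stationary from step `|f|` on. -/
theorem piIter_fo (n : ℕ) (f : Forest B) (h : f.weight ≤ n) : piIter n (fo f) = piCK (fo f) := by
  rw [piCK, linExt_fo]
  induction hw : f.weight using Nat.strong_induction_on generalizing n f with
  | _ w ih =>
    rcases eq_or_ne f 0 with rfl | hf
    · rw [fo_zero, piIter_one, piIter_one]
    · have h0 := mt Forest.weight_eq_zero.1 hf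
      obtain ⟨n, rfl⟩ : ∃ k, n = k + 1 := ⟨n - 1, by omega⟩
      obtain ⟨w, rfl⟩ : ∃ k, w = k + 1 := ⟨w - 1, by omega⟩
      rw [piIter, piIter, LinearMap.sub_apply, LinearMap.sub_apply, LinearMap.comp_apply,
        LinearMap.comp_apply]
      congr 1
      refine eqOn_tensorPosWeightEq (fun g k _ _ _ hk _ => ?_) (reducedCoproduct_fo_mem hf)
      rw [TensorProduct.lift.tmul, TensorProduct.lift.tmul, LinearMap.compl₂_apply,
        LinearMap.compl₂_apply, ih _ (by omega) n k (by omega) rfl,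
        ih _ (by omega) w k (by omega) rfl]

theorem piCK_one : piCK (1 : HCK B) = 0 := by
  rw [← fo_zero, piCK, linExt_fo, fo_zero, piIter_one]

/-- The map `x ⊗ y ↦ x ⊤ π(y)`. -/
noncomputable def growthPi : HCK B ⊗[ℝ] HCK B →ₗ[ℝ] HCK B :=
  TensorProduct.lift (growth.compl₂ piCK)

theorem growthPi_tmul (x y : HCK B) : growthPi (x ⊗ₜ y) = growth x (piCK y) := rfl

theorem piCK_fo {f : Forest B} (hf : f ≠ 0) :
    piCK (fo f) = fo f - growthPi (reducedCoproduct (fo f)) := by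
  rw [← piIter_fo (f.weight + 1) f (by omega), piIter, LinearMap.sub_apply, posPart_fo hf,
    LinearMap.comp_apply]
  congr 1
  refine eqOn_tensorPosWeightEq (fun g k _ _ _ hk _ => ?_) (reducedCoproduct_fo_mem hf)
  rw [TensorProduct.lift.tmul, LinearMap.compl₂_apply, piIter_fo _ k hk.le, growthPi_tmul]

theorem piCK_fo_mem_weightEq (f : Forest B) : piCK (fo f) ∈ weightEq B f.weight := by
  induction hw : f.weight using Nat.strong_induction_on generalizing f with
  | _ w ih =>
    rcases eq_or_ne f 0 with rfl | hf
    · rw [fo_zero, piCK_one]; exact zero_mem _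
    · rw [piCK_fo hf]
      refine sub_mem (hw ▸ fo_mem_weightEq f) ?_
      have : tensorPosWeightEq B w ≤ (weightEq B w).comap growthPi := by
        refine Submodule.span_le.2 ?_
        rintro _ ⟨g, k, hg, hk, e, rfl⟩
        have h1 := mt Forest.weight_eq_zero.1 hg
        rw [SetLike.mem_coe, Submodule.mem_comap, growthPi_tmul, ← e]
        exact growth_mem_weightEq (fo_mem_weightEq g) (ih _ (by omega) k rfl)
      exact this (hw ▸ reducedCoproduct_fo_mem hf)

theorem piCK_mem_HCKPos (y : HCK B) : piCK y ∈ HCKPos B := by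
  refine map_mem_of_supported (s := Set.univ) (fun f _ => ?_)
    (AddMonoidAlgebra.mem_supported.2 (Set.subset_univ _))
  rcases eq_or_ne f 0 with rfl | h
  · rw [fo_zero, piCK_one]; exact zero_mem _
  · exact weightEq_le_HCKPos (mt Forest.weight_eq_zero.1 h) (piCK_fo_mem_weightEq f)

/-- The recursion for `π` read backwards: `1 ⊗ f` contributes `π(f)`, the reduced coproduct
contributes `f - π(f)`, and `f ⊗ 1` nothing. -/
theorem growthPi_coproduct (y : HCK B) : growthPi (coproduct y) = posPart y := by
  refine LinearMap.congr_fun (f := growthPi ∘ₗ coproduct) (linearMap_ext_fo fun f => ?_) y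
  rw [LinearMap.comp_apply]
  rcases eq_or_ne f 0 with rfl | hf
  · rw [fo_zero, coproduct_one, Algebra.TensorProduct.one_def, growthPi_tmul, piCK_one, map_zero,
      posPart_one]
  · rw [coproduct_eq_add_reducedCoproduct, map_add, map_add, growthPi_tmul, growthPi_tmul, piCK_one,
      map_zero, one_growth, posPart_of_mem (piCK_mem_HCKPos _), posPart_fo hf, piCK_fo hf]
    abel

theorem lTensor_counit_coproduct {M : Type*} [AddCommGroup M] [Module ℝ M] (m : M) (y : HCK B) :
    LinearMap.lTensor (HCK B) (counit.smulRight m) (coproduct y) = y ⊗ₜ m := by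
  refine LinearMap.congr_fun (f := LinearMap.lTensor (HCK B) (counit.smulRight m) ∘ₗ coproduct)
    (g := (TensorProduct.mk ℝ (HCK B) M).flip m) (linearMap_ext_fo fun f => ?_) y
  rw [LinearMap.comp_apply, LinearMap.flip_apply, TensorProduct.mk_apply]
  rcases eq_or_ne f 0 with rfl | hf
  · rw [fo_zero, coproduct_one, Algebra.TensorProduct.one_def, LinearMap.lTensor_tmul,
      LinearMap.smulRight_apply, counit_one, one_smul]
  · have h0 : LinearMap.lTensor (HCK B) (counit.smulRight m) (reducedCoproduct (fo f)) = 0 := by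
      refine eqOn_tensorPosWeightEq (ψ := 0) (fun g k _ hk _ _ _ => ?_) (reducedCoproduct_fo_mem hf)
      rw [LinearMap.lTensor_tmul, LinearMap.smulRight_apply, counit_fo hk, zero_smul,
        TensorProduct.tmul_zero, LinearMap.zero_apply]
    rw [coproduct_eq_add_reducedCoproduct, map_add, map_add, h0, LinearMap.lTensor_tmul,
      LinearMap.lTensor_tmul, LinearMap.smulRight_apply, LinearMap.smulRight_apply, counit_one,
      counit_fo hf, zero_smul, one_smul, TensorProduct.tmul_zero, add_zero, add_zero]

theorem lTensor_posPart_coproduct (y : HCK B) :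
    LinearMap.lTensor (HCK B) posPart (coproduct y) = coproduct y - y ⊗ₜ 1 := by
  have : (posPart : HCK B →ₗ[ℝ] HCK B) = LinearMap.id - counit.smulRight 1 :=
    LinearMap.ext fun x => by simp [posPart_apply]
  rw [this, LinearMap.lTensor_sub, LinearMap.sub_apply, lTensor_counit_coproduct,
    LinearMap.lTensor_id, LinearMap.id_apply]

theorem lTensor_growthPi_assoc_tmul (x y : HCK B) (hy : piCK y ∈ Prim B) :
    LinearMap.lTensor (HCK B) growthPi (TensorProduct.assoc ℝ _ _ _
      (LinearMap.rTensor (HCK B) coproduct (x ⊗ₜ y)))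
      = coproduct (growth x (piCK y)) - growth x (piCK y) ⊗ₜ 1 := by
  rw [coproduct_growth x hy, add_sub_cancel_left, LinearMap.rTensor_tmul]
  induction coproduct x using TensorProduct.induction_on with
  | zero => simp
  | tmul u v => simp [growthPi_tmul]
  | add z w hz hw => rw [TensorProduct.add_tmul, map_add, map_add, map_add, hz, hw]

/-- Evaluate `x ⊗ y ↦ x₍₁₎ ⊗ (x₍₂₎ ⊤ π(y))` on `Δf` in two ways. By coassociativity and
`growthPi_coproduct` the value is `Δf - f ⊗ 1`. Term by term, `f ⊗ 1` gives `0`, `1 ⊗ f` gives `1 ⊗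
π(f)`, and the reduced coproduct gives `Δ(f - π(f)) - (f - π(f)) ⊗ 1` by the cocycle identity and
induction. Comparison yields primitivity. -/
theorem piCK_fo_mem_Prim (f : Forest B) : piCK (fo f) ∈ Prim B := by
  induction hw : f.weight using Nat.strong_induction_on generalizing f with
  | _ w ih =>
    rcases eq_or_ne f 0 with rfl | hf
    · rw [fo_zero, piCK_one]; exact zero_mem _
    have h1 : LinearMap.lTensor (HCK B) growthPi (TensorProduct.assoc ℝ _ _ _
        (LinearMap.rTensor (HCK B) coproduct (coproduct (fo f))))
        = coproduct (fo f) - fo f ⊗ₜ 1 := by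
      rw [coproduct_assoc, ← lTensor_posPart_coproduct, ← LinearMap.comp_apply,
        ← LinearMap.lTensor_comp]
      congr 2
      exact LinearMap.ext growthPi_coproduct
    have h2 : LinearMap.lTensor (HCK B) growthPi (TensorProduct.assoc ℝ _ _ _
        (LinearMap.rTensor (HCK B) coproduct (reducedCoproduct (fo f))))
        = coproduct (growthPi (reducedCoproduct (fo f)))
          - growthPi (reducedCoproduct (fo f)) ⊗ₜ 1 := by
      refine eqOn_tensorPosWeightEq
        (φ := LinearMap.lTensor (HCK B) growthPi ∘ₗ (TensorProduct.assoc ℝ _ _ _).toLinearMap ∘ₗ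
          LinearMap.rTensor (HCK B) coproduct)
        (ψ := coproduct ∘ₗ growthPi - (TensorProduct.mk ℝ (HCK B) (HCK B)).flip 1 ∘ₗ growthPi)
        (fun g k _ _ _ hk _ => ?_) (reducedCoproduct_fo_mem hf)
      exact lTensor_growthPi_assoc_tmul _ _ (ih _ (hw ▸ hk) k rfl)
    have h3 : LinearMap.lTensor (HCK B) growthPi (TensorProduct.assoc ℝ _ _ _
        (LinearMap.rTensor (HCK B) coproduct (fo f ⊗ₜ 1))) = 0 := by
      rw [lTensor_growthPi_assoc_tmul _ _ (by rw [piCK_one]; exact zero_mem _), piCK_one, map_zero,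
        map_zero, TensorProduct.zero_tmul, sub_self]
    have h4 : LinearMap.lTensor (HCK B) growthPi (TensorProduct.assoc ℝ _ _ _
        (LinearMap.rTensor (HCK B) coproduct (1 ⊗ₜ fo f))) = 1 ⊗ₜ piCK (fo f) := by
      rw [LinearMap.rTensor_tmul, coproduct_one, Algebra.TensorProduct.one_def,
        TensorProduct.assoc_tmul, LinearMap.lTensor_tmul, growthPi_tmul, one_growth,
        posPart_of_mem (piCK_mem_HCKPos _)]
    have h5 : growthPi (reducedCoproduct (fo f)) = fo f - piCK (fo f) := by
      rw [piCK_fo hf]; abel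
    nth_rw 1 [coproduct_eq_add_reducedCoproduct] at h1
    rw [map_add, map_add, map_add, map_add, map_add, map_add, h2, h3, h4, h5, zero_add, map_sub,
      TensorProduct.sub_tmul] at h1
    rw [mem_Prim]
    linear_combination -h1

theorem piCK_mem_Prim (y : HCK B) : piCK y ∈ Prim B :=
  map_mem_of_supported (s := Set.univ) (fun f _ => piCK_fo_mem_Prim f)
    (AddMonoidAlgebra.mem_supported.2 (Set.subset_univ _))

/-- The cocycle identity at `h = 1` shows that the positive part of `p` is primitive. The rest `c ·
1` is then primitive too, and `Δ1 = 1 ⊗ 1` forces `c = 2c`. -/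
theorem Prim_le_HCKPos : Prim B ≤ HCKPos B := by
  intro p hp
  have h1 : posPart p ∈ Prim B := by
    have := coproduct_growth 1 hp
    rw [one_growth, coproduct_one, Algebra.TensorProduct.one_def, LinearMap.lTensor_tmul,
      LinearMap.flip_apply, one_growth] at this
    exact mem_Prim.2 this
  have h2 := sub_mem hp h1
  rw [posPart_apply, sub_sub_cancel] at h2
  have h3 := mem_Prim.1 h2
  rw [map_smul, coproduct_one, Algebra.TensorProduct.one_def, TensorProduct.tmul_smul,
    TensorProduct.smul_tmul', left_eq_add] at h3
  have h4 := congrArg (LinearMap.mul' ℝ (HCK B)) h3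
  rw [LinearMap.mul'_apply, mul_one, map_zero, smul_eq_zero] at h4
  have h5 : posPart p = p := by
    rw [posPart_apply, h4.resolve_right one_ne_zero, zero_smul, sub_zero]
  rw [← h5]
  exact posPart_mem p

theorem piCK_of_mem_Prim {p : HCK B} (hp : p ∈ Prim B) : piCK p = p := by
  have h := growthPi_coproduct p
  rwa [mem_Prim.1 hp, map_add, growthPi_tmul, growthPi_tmul, piCK_one, map_zero, zero_add,
    one_growth, posPart_of_mem (Prim_le_HCKPos hp), posPart_of_mem (piCK_mem_HCKPos _)] at h

/-- Evaluate `growthPi_coproduct` at `f ⊤ p` for `f ≠ 0`. The term `f ⊗ p` of `Δ(f ⊤ p)` already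
produces `f ⊤ p`, and the reduced coproduct of `f` contributes `0` by induction, so the one
remaining term `π(f ⊤ p)` must vanish. -/
theorem piCK_growth_prim (h : HCK B) {p : HCK B} (hp : p ∈ Prim B) :
    piCK (growth h p) = counit h • p := by
  refine LinearMap.congr_fun (f := piCK ∘ₗ growth.flip p) (g := counit.smulRight p)
    (linearMap_ext_fo fun f => ?_) h
  rw [LinearMap.comp_apply, LinearMap.flip_apply, LinearMap.smulRight_apply]
  induction hw : f.weight using Nat.strong_induction_on generalizing f with
  | _ w ih =>
    have h1 : growth 1 p = p := by rw [one_growth, posPart_of_mem (Prim_le_HCKPos hp)]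
    rcases eq_or_ne f 0 with rfl | hf
    · rw [fo_zero, counit_one, one_smul, h1, piCK_of_mem_Prim hp]
    rw [counit_fo hf, zero_smul]
    have h2 := growthPi_coproduct (growth (fo f) p)
    have h3 : growthPi (LinearMap.lTensor (HCK B) (growth.flip p) (reducedCoproduct (fo f)))
        = 0 := by
      refine eqOn_tensorPosWeightEq (φ := growthPi ∘ₗ LinearMap.lTensor (HCK B) (growth.flip p))
        (ψ := 0) (fun g k _ hk0 _ hk _ => ?_) (reducedCoproduct_fo_mem hf)
      rw [LinearMap.comp_apply, LinearMap.lTensor_tmul, growthPi_tmul, LinearMap.flip_apply,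
        ih _ (hw ▸ hk) k rfl, counit_fo hk0, zero_smul, map_zero, LinearMap.zero_apply]
    rw [coproduct_growth _ hp, coproduct_eq_add_reducedCoproduct (fo f), map_add, map_add, map_add,
      map_add, map_add, h3, growthPi_tmul, piCK_one, map_zero, LinearMap.lTensor_tmul,
      LinearMap.lTensor_tmul, growthPi_tmul, growthPi_tmul, LinearMap.flip_apply,
      LinearMap.flip_apply, h1, piCK_of_mem_Prim hp, one_growth,
      posPart_of_mem (growth_mem_HCKPos _ _), posPart_of_mem (piCK_mem_HCKPos _)] at h2
    simpa using h2

/-- By the cocycle identity the left side is `h₍₁₎ ⊗ π(h₍₂₎ ⊤ p) = h₍₁₎ ⊗ ε(h₍₂₎) p`, and the counit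
axiom finishes. Both the formula for `PiHat` and the duality `pair_growth_star` come from here. -/
theorem lTensor_piCK_coproduct_growth (h : HCK B) {p : HCK B} (hp : p ∈ Prim B) :
    LinearMap.lTensor (HCK B) piCK (coproduct (growth h p)) = h ⊗ₜ p := by
  rw [coproduct_growth h hp, map_add, LinearMap.lTensor_tmul, piCK_one, TensorProduct.tmul_zero,
    zero_add, ← LinearMap.comp_apply, ← LinearMap.lTensor_comp, ← lTensor_counit_coproduct]
  congr 2
  exact LinearMap.ext fun x => piCK_growth_prim x hp

theorem range_piCK : LinearMap.range (piCK (B := B)) = Prim B := by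
  refine le_antisymm ?_ fun p hp => ⟨p, piCK_of_mem_Prim hp⟩
  rintro _ ⟨y, rfl⟩
  exact piCK_mem_Prim y

theorem piCK_growth_of_mem_HCKPos {h : HCK B} (hh : h ∈ HCKPos B) {p : HCK B} (hp : p ∈ Prim B) :
    piCK (growth h p) = 0 := by
  have : counit h = 0 := eqOn_supported (φ := counit) (ψ := 0) (fun f hf => counit_fo hf) hh
  rw [piCK_growth_prim h hp, this, zero_smul]

/-- The inverse `y ↦ y₍₁₎ ⊗ π(y₍₂₎)` of `growthPrim`. -/
noncomputable def growthPrimInv (B : Type*) : HCK B →ₗ[ℝ] HCK B ⊗[ℝ] Prim B :=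
  LinearMap.lTensor (HCK B) (piCK.codRestrict (Prim B) piCK_mem_Prim) ∘ₗ coproduct

theorem growthPrim_tmul (h : HCK B) (p : Prim B) : growthPrim B (h ⊗ₜ p) = growth h p := rfl

theorem growthPrimInv_growthPrim (z : HCK B ⊗[ℝ] Prim B) :
    growthPrimInv B (growthPrim B z) = z := by
  induction z using TensorProduct.induction_on with
  | zero => simp
  | add z w hz hw => rw [map_add, map_add, hz, hw]
  | tmul h p =>
    rw [growthPrim_tmul, growthPrimInv, LinearMap.comp_apply, coproduct_growth h p.2, map_add,
      LinearMap.lTensor_tmul, ← LinearMap.comp_apply, ← LinearMap.lTensor_comp]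
    have h1 : piCK.codRestrict (Prim B) piCK_mem_Prim 1 = 0 := Subtype.ext piCK_one
    rw [h1, TensorProduct.tmul_zero, zero_add, ← lTensor_counit_coproduct]
    congr 2
    exact LinearMap.ext fun x => Subtype.ext (piCK_growth_prim x p.2)

theorem growthPrim_growthPrimInv (y : HCK B) : growthPrim B (growthPrimInv B y) = posPart y := by
  rw [← growthPi_coproduct, growthPrimInv, LinearMap.comp_apply, ← LinearMap.comp_apply]
  congr 1
  exact TensorProduct.ext' fun x y => rfl

theorem growthPrim_injective : Function.Injective (growthPrim B) :=
  Function.LeftInverse.injective growthPrimInv_growthPrim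

theorem range_growthPrim : LinearMap.range (growthPrim B) = HCKPos B := by
  refine le_antisymm ?_ fun y hy =>
    ⟨growthPrimInv B y, by rw [growthPrim_growthPrimInv, posPart_of_mem hy]⟩
  rintro _ ⟨z, rfl⟩
  induction z using TensorProduct.induction_on with
  | zero => simp
  | tmul h p => exact growth_mem_HCKPos _ _
  | add z w hz hw => rw [map_add]; exact add_mem hz hw

/-! ### The coordinate maps `PiHat` on products `h ⊤ p`. -/

theorem PiHat_eq (f : Forest B) (y : HCK B) : PiHat f y = TensorProduct.lift
    ((LinearMap.lsmul ℝ (HCK B)).flip.compl₁₂ (growth.flip (piCK (fo f))) (pair.flip (fo f)))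
      (LinearMap.lTensor (HCK B) piCK (coproduct y)) := by
  rw [PiHat, LinearMap.comp_apply]
  induction coproduct y using TensorProduct.induction_on with
  | zero => simp only [map_zero]
  | add z w hz hw => simp only [map_add, hz, hw]
  | tmul u v => simp only [TensorProduct.lift.tmul, LinearMap.compl₁₂_apply, LinearMap.comp_apply,
      LinearMap.lTensor_tmul]

theorem PiHat_growth (f : Forest B) (h : HCK B) {p : HCK B} (hp : p ∈ Prim B) :
    PiHat f (growth h p) = pair p (fo f) • growth h (piCK (fo f)) := by
  rw [PiHat_eq, lTensor_piCK_coproduct_growth h hp]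
  simp only [TensorProduct.lift.tmul, LinearMap.compl₁₂_apply, LinearMap.flip_apply,
    LinearMap.lsmul_apply]

theorem PiHat_one (f : Forest B) : PiHat f 1 = 0 := by
  rw [PiHat_eq, coproduct_one, Algebra.TensorProduct.one_def, LinearMap.lTensor_tmul, piCK_one,
    TensorProduct.tmul_zero, map_zero]

end Projection

section Pairing

variable {B : Type*}

/-! ## The pairing -/

theorem RTree.symm_node (a : B) (f : Forest B) : (RTree.node a f).symm = f.symm := by
  rw [RTree.symm, RTree.recurse_eq, RTree.children_node, Multiset.map_mk_fst, Multiset.map_mk_snd]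
  rfl

theorem Forest.symm_pos (f : Forest B) : 0 < f.symm := by
  have h : ∀ t ∈ f, 0 < t.symm := by
    induction f using Forest.induction with
    | zero => simp
    | add f g hf hg =>
      intro t ht
      rcases Multiset.mem_add.1 ht with h | h
      · exact hf t h
      · exact hg t h
    | node a f hf =>
      intro t ht
      rw [Multiset.mem_singleton.1 ht, RTree.symm_node, Forest.symm]
      refine Nat.mul_pos (Finset.prod_pos fun _ _ => Nat.factorial_pos _)
        (Nat.pos_of_ne_zero (Multiset.prod_ne_zero fun h0 => ?_))
      obtain ⟨t, ht, h0⟩ := Multiset.mem_map.1 h0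
      exact (hf t ht).ne' h0
  rw [Forest.symm]
  refine Nat.mul_pos (Finset.prod_pos fun _ _ => Nat.factorial_pos _)
    (Nat.pos_of_ne_zero (Multiset.prod_ne_zero fun h0 => ?_))
  obtain ⟨t, ht, h0⟩ := Multiset.mem_map.1 h0
  exact (h t ht).ne' h0

theorem Forest.symm_ne_zero (f : Forest B) : (f.symm : ℝ) ≠ 0 := Nat.cast_ne_zero.2 f.symm_pos.ne'

theorem pair_fo_self (f : Forest B) : pair (fo f) (fo f) = f.symm := by
  rw [pair, linExt_fo, linExt_fo, if_pos rfl]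

theorem pair_fo_of_ne {f g : Forest B} (h : f ≠ g) : pair (fo f) (fo g) = 0 := by
  rw [pair, linExt_fo, linExt_fo, if_neg h]

theorem pair_comm (x y : AddMonoidAlgebra ℝ (Forest B)) : pair x y = pair y x := by
  refine bilinear_ext_fo (φ := pair) (ψ := pair.flip) (fun f g => ?_) x y
  rw [LinearMap.flip_apply]
  rcases eq_or_ne f g with rfl | h
  · rfl
  · rw [pair_fo_of_ne h, pair_fo_of_ne h.symm]

theorem pair_fo_eq_zero_of_mem {s : Set (Forest B)} {x : HCK B}
    (hx : x ∈ AddMonoidAlgebra.supported ℝ ℝ s) {f : Forest B} (hf : f ∉ s) :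
    pair x (fo f) = 0 := by
  have h : ∀ g ∈ s, pair.flip (fo f) (fo g) = (0 : HCK B →ₗ[ℝ] ℝ) (fo g) := fun g hg => by
    rw [LinearMap.flip_apply, LinearMap.zero_apply, pair_fo_of_ne]
    rintro rfl
    exact hf hg
  have := eqOn_supported h hx
  rwa [LinearMap.flip_apply, LinearMap.zero_apply] at this

/-- The forests `ς(f)⁻¹ f` form the basis dual to the forests; this resolution of the identity
underlies all the expansions below. -/
theorem sum_pair_smul {S : Finset (Forest B)} {x : HCK B}
    (hx : x ∈ AddMonoidAlgebra.supported ℝ ℝ (S : Set (Forest B))) :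
    ∑ f ∈ S, ((f.symm : ℝ)⁻¹ * pair x (fo f)) • fo f = x := by
  have := eqOn_supported (φ := ∑ f ∈ S, ((f.symm : ℝ)⁻¹ • pair.flip (fo f)).smulRight (fo f))
    (ψ := LinearMap.id) (fun g hg => ?_) hx
  · simpa using this
  · simp only [LinearMap.sum_apply, LinearMap.smulRight_apply, LinearMap.smul_apply,
      LinearMap.flip_apply, LinearMap.id_apply, smul_eq_mul]
    rw [Finset.sum_eq_single_of_mem g hg fun f _ hf => by
      rw [pair_fo_of_ne hf.symm, mul_zero, zero_smul], pair_fo_self,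
      inv_mul_cancel₀ g.symm_ne_zero, one_smul]

theorem eq_zero_of_pair_eq_zero {s : Set (Forest B)} {x : HCK B}
    (hx : x ∈ AddMonoidAlgebra.supported ℝ ℝ s) (h : ∀ f ∈ s, pair x (fo f) = 0) : x = 0 := by
  have := sum_pair_smul (S := x.coeff.support) (x := x)
    (AddMonoidAlgebra.mem_supported.2 (subset_refl _))
  rw [← this]
  refine Finset.sum_eq_zero fun f hf => ?_
  rw [h f (AddMonoidAlgebra.mem_supported.1 hx hf), mul_zero, zero_smul]

theorem pairTensor_tmul (h k : HGL B) (x y : HCK B) :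
    pairTensor h k (x ⊗ₜ y) = pair x h * pair y k := rfl

theorem pairTensor_eq_zero {f g : Forest B} {n : ℕ} (h : f.weight + g.weight ≠ n)
    {z : HCK B ⊗[ℝ] HCK B} (hz : z ∈ tensorWeightEq B n) : pairTensor (fo f) (fo g) z = 0 := by
  have : tensorWeightEq B n ≤ LinearMap.ker (pairTensor (fo f) (fo g)) := by
    refine Submodule.span_le.2 ?_
    rintro _ ⟨f', g', e, rfl⟩
    rw [SetLike.mem_coe, LinearMap.mem_ker, pairTensor_tmul]
    by_cases hf : f' = f
    · rw [pair_fo_of_ne (f := g'), mul_zero]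
      rintro rfl
      exact h (hf ▸ e)
    · rw [pair_fo_of_ne hf, zero_mul]
  exact this hz

theorem ext_pair {x y : HGL B} (h : ∀ z, pair z x = pair z y) : x = y := by
  rw [← sub_eq_zero]
  refine eq_zero_of_pair_eq_zero (s := Set.univ)
    (AddMonoidAlgebra.mem_supported.2 (Set.subset_univ _)) fun f _ => ?_
  rw [pair_comm, map_sub, h, sub_self]

/-! ## Truncations -/

theorem truncLE_fo_of_le {n : ℕ} {f : Forest B} (h : f.weight ≤ n) :
    (truncLE n (fo f) : HGL B) = fo f := by
  rw [truncLE, linExt_fo, dif_pos h]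

theorem truncLE_fo_of_lt {n : ℕ} {f : Forest B} (h : n < f.weight) : truncLE n (fo f) = 0 := by
  rw [truncLE, linExt_fo, dif_neg h.not_ge]

theorem truncLE_coe {n : ℕ} (x : weightLE B n) : truncLE n (x : HGL B) = x :=
  Subtype.ext (eqOn_supported (φ := (weightLE B n).subtype ∘ₗ truncLE n) (ψ := LinearMap.id)
    (fun _ hf => truncLE_fo_of_le hf) x.2)

theorem pair_truncLE {n : ℕ} {y : HCK B} (hy : y ∈ weightLE B n) (x : HGL B) :
    pair y (truncLE n x : HGL B) = pair y x := by
  refine eqOn_supported (φ := pair.flip (truncLE n x : HGL B)) (ψ := pair.flip x) (fun f hf => ?_) hy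
  refine LinearMap.congr_fun (f := pair (fo f) ∘ₗ (weightLE B n).subtype ∘ₗ truncLE n)
    (linearMap_ext_fo fun g => ?_) x
  rw [LinearMap.comp_apply, LinearMap.comp_apply, Submodule.subtype_apply]
  rcases le_or_gt g.weight n with hg | hg
  · rw [truncLE_fo_of_le hg]
  · rw [truncLE_fo_of_lt hg, Submodule.coe_zero, map_zero, pair_fo_of_ne]
    rintro rfl
    exact hg.not_ge hf

theorem weightEq_le_weightLE {m n : ℕ} (h : m ≤ n) : weightEq B m ≤ weightLE B n :=
  AddMonoidAlgebra.supported_mono fun f (hf : f.weight = m) => show f.weight ≤ n by omega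

theorem weightLE_mono {m n : ℕ} (h : m ≤ n) : weightLE B m ≤ weightLE B n :=
  AddMonoidAlgebra.supported_mono fun f (hf : f.weight ≤ m) => show f.weight ≤ n by omega

theorem piCK_mem_weightLE {n : ℕ} {x : HCK B} (hx : x ∈ weightLE B n) : piCK x ∈ weightLE B n :=
  map_mem_of_supported (fun f (hf : f.weight ≤ n) =>
    weightEq_le_weightLE hf (piCK_fo_mem_weightEq f)) hx

/-! ## Adjoints -/

variable [Finite B]

/-- `starGL` records dual coefficients in weight `|f| + |g|` only; no other weight occurs because
the coproduct preserves it. -/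
theorem pair_starGL (y : HCK B) (h k : HGL B) :
    pair y (starGL h k) = pairTensor h k (coproduct y) := by
  suffices H : ∀ e f g : Forest B,
      pair (fo e) (starGL (fo f) (fo g)) = pairTensor (fo f) (fo g) (coproduct (fo e)) by
    have h1 : ∀ f g : Forest B, pair y (starGL (fo f) (fo g))
        = pairTensor (fo f) (fo g) (coproduct y) := fun f g =>
      LinearMap.congr_fun (f := pair.flip (starGL (fo f) (fo g)))
        (g := pairTensor (fo f) (fo g) ∘ₗ coproduct) (linearMap_ext_fo fun e => H e f g) y
    refine bilinear_ext_fo (φ := starGL.compr₂ (pair y))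
      (ψ := LinearMap.mk₂ ℝ (fun h k => pairTensor h k (coproduct y)) ?_ ?_ ?_ ?_) h1 h k
    all_goals
      intros
      simp only [pairTensor, map_add, map_smul, TensorProduct.map_add_left,
        TensorProduct.map_add_right, TensorProduct.map_smul_left, TensorProduct.map_smul_right,
        LinearMap.comp_apply, LinearMap.add_apply, LinearMap.smul_apply]
  intro e f g
  rw [starGL, linExt_fo, linExt_fo, map_sum]
  by_cases he : f.weight + g.weight = e.weight
  · rw [Finset.sum_eq_single_of_mem e (by simp [he]) fun e' _ h' => by
      rw [map_smul, pair_fo_of_ne h'.symm, smul_zero], map_smul, pair_fo_self, smul_eq_mul,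
      div_mul_cancel₀ _ e.symm_ne_zero]
  · rw [pairTensor_eq_zero he (coproduct_fo_mem e)]
    refine Finset.sum_eq_zero fun e' h' => ?_
    rw [map_smul, pair_fo_of_ne, smul_zero]
    rintro rfl
    exact he (Forest.mem_ofWeight.1 h').symm

theorem pair_piStar (y : HCK B) (h : HGL B) : pair y (piStar h) = pair (piCK y) h := by
  refine bilinear_ext_fo (φ := pair.compl₂ piStar) (ψ := pair ∘ₗ piCK) (fun f g => ?_) y h
  rw [LinearMap.compl₂_apply, LinearMap.comp_apply, piStar, linExt_fo, map_sum]
  by_cases he : f.weight = g.weight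
  · rw [Finset.sum_eq_single_of_mem f (by simp [he]) fun e' _ h' => by
      rw [map_smul, pair_fo_of_ne h'.symm, smul_zero], map_smul, pair_fo_self, smul_eq_mul,
      div_mul_cancel₀ _ f.symm_ne_zero]
  · rw [pair_fo_eq_zero_of_mem (piCK_fo_mem_weightEq f) (fun h => he h.symm)]
    refine Finset.sum_eq_zero fun e' h' => ?_
    rw [map_smul, pair_fo_of_ne, smul_zero]
    rintro rfl
    exact he (Forest.mem_ofWeight.1 h')

theorem piStar_fo_mem (f : Forest B) : piStar (fo f) ∈ weightEq B f.weight := by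
  rw [piStar, linExt_fo]
  exact sum_mem fun e he => Submodule.smul_mem _ _ (fo_mem_supported (Forest.mem_ofWeight.1 he))

theorem piStar_piStar (y : HGL B) : piStar (piStar y) = piStar y :=
  ext_pair fun z => by
    rw [pair_piStar, pair_piStar, pair_piStar, piCK_of_mem_Prim (piCK_mem_Prim z)]

/-- Moving `⋆` and `π*` across the pairing produces `(id ⊗ π) Δ(h ⊤ p) = h ⊗ p`. -/
theorem pair_growth_star {p : HCK B} (hp : p ∈ Prim B) (h : HCK B) (x y : HGL B) :
    pair (growth h p) (starGL x (piStar y)) = pair h x * pair p y := by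
  rw [pair_starGL, pairTensor, LinearMap.comp_apply]
  have : TensorProduct.map (pair.flip x) (pair.flip (piStar y))
      = TensorProduct.map (pair.flip x) (pair.flip y) ∘ₗ LinearMap.lTensor (HCK B) piCK := by
    rw [LinearMap.map_comp_lTensor]
    congr 1
    exact LinearMap.ext fun z => pair_piStar z y
  rw [this, LinearMap.comp_apply, lTensor_piCK_coproduct_growth h hp]
  rfl

theorem piStar_mem_weightLE {n : ℕ} {x : HGL B} (hx : x ∈ weightLE B n) :
    piStar x ∈ weightLE B n :=
  map_mem_of_supported (fun f (hf : f.weight ≤ n) =>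
    weightEq_le_weightLE hf (piStar_fo_mem f)) hx

/-- `π` followed by the truncation at weight `n`. -/
noncomputable def truncPi (B : Type*) [Finite B] (n : ℕ) : HCK B →ₗ[ℝ] PrimLE B n :=
  (piCK ∘ₗ (weightLE B n).subtype ∘ₗ truncLE n).codRestrict (PrimLE B n) fun x =>
    ⟨piCK_mem_Prim _, piCK_mem_weightLE (truncLE n x).2⟩

/-- `π*` followed by the truncation at weight `n`. -/
noncomputable def truncPiStar (B : Type*) [Finite B] (n : ℕ) : HGL B →ₗ[ℝ] QLE B n :=
  (piStar ∘ₗ (weightLE B n).subtype ∘ₗ truncLE n).codRestrict (QLE B n) fun x => by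
    rw [LinearMap.comp_apply]
    exact Submodule.mem_inf.2
      ⟨LinearMap.mem_range_self piStar _, piStar_mem_weightLE (truncLE n x).2⟩

theorem coe_truncPi (n : ℕ) (x : HCK B) : (truncPi B n x : HCK B) = piCK (truncLE n x : HCK B) := rfl

theorem coe_truncPiStar (n : ℕ) (x : HGL B) :
    (truncPiStar B n x : HGL B) = piStar (truncLE n x : HGL B) := rfl

theorem truncPiStar_coe {n : ℕ} (q : QLE B n) : truncPiStar B n q = q := by
  refine Subtype.ext ?_
  have h := truncLE_coe (⟨q, q.2.2⟩ : weightLE B n)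
  rw [coe_truncPiStar, h]
  obtain ⟨x, hx⟩ := q.2.1
  rw [← hx, piStar_piStar]

theorem pair_truncPiStar {n : ℕ} (p : PrimLE B n) (y : HGL B) :
    pair (p : HCK B) (truncPiStar B n y : HGL B) = pair (p : HCK B) y := by
  rw [coe_truncPiStar, pair_piStar, piCK_of_mem_Prim p.2.1, pair_truncLE p.2.2]

end Pairing

/-! ## The identification of `𝓛(H_GL, 𝓛(𝒬, W))` with `H_CK ⊗ 𝒫 ⊗ W` -/

section Perfect

/-- In finite dimension a pairing that is non-degenerate on both sides is perfect, so `V` is the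
dual of `K`, and `K* ⊗ M → 𝓛(K, M)` is bijective for every `M`. -/
theorem bijective_lift_smulRight {V K M : Type*} [AddCommGroup V] [Module ℝ V] [AddCommGroup K]
    [Module ℝ K] [AddCommGroup M] [Module ℝ M] [FiniteDimensional ℝ V] [FiniteDimensional ℝ K]
    (b : V →ₗ[ℝ] K →ₗ[ℝ] ℝ) (h1 : Function.Injective b) (h2 : Function.Injective b.flip) :
    Function.Bijective (TensorProduct.lift (LinearMap.smulRightₗ ∘ₗ b) : V ⊗[ℝ] M →ₗ[ℝ] K →ₗ[ℝ] M)
    := by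
  have hb := (LinearMap.IsPerfPair.of_injective h1 h2).bijective_left
  have e : (TensorProduct.lift (LinearMap.smulRightₗ ∘ₗ b) : V ⊗[ℝ] M →ₗ[ℝ] K →ₗ[ℝ] M)
      = dualTensorHom ℝ K M ∘ₗ ((LinearEquiv.ofBijective b hb).rTensor M).toLinearMap :=
    TensorProduct.ext' fun x y => rfl
  rw [e, LinearMap.coe_comp]
  exact dualTensorHom_bijective.comp (LinearEquiv.bijective _)

variable {B : Type*} {W : Type*} [NormedAddCommGroup W] [NormedSpace ℝ W]

theorem topTensor_tmul {N : ℕ} (h : weightLE B (N - 1)) (p : PrimLE B N) (w : W) :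
    topTensor B W N (h ⊗ₜ (p ⊗ₜ w)) = growth (h : HCK B) (p : HCK B) ⊗ₜ w := rfl

theorem pairW_tmul (y : HCK B) (w : W) (x : HGL B) : pairW (y ⊗ₜ w) x = pair y x • w := rfl

variable [Finite B]

theorem coe_ofWeightLE (n : ℕ) :
    (Forest.ofWeightLE B n : Set (Forest B)) = {f | f.weight ≤ n} := by
  ext f; simp

instance finiteDimensional_weightLE (n : ℕ) : FiniteDimensional ℝ (weightLE B n) := by
  rw [weightLE, supported_eq_span_fo, ← coe_ofWeightLE]
  exact FiniteDimensional.span_of_finite ℝ ((Finset.finite_toSet _).image _)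

instance finiteDimensional_PrimLE (n : ℕ) : FiniteDimensional ℝ (PrimLE B n) :=
  Submodule.finiteDimensional_of_le (inf_le_right : PrimLE B n ≤ weightLE B n)

instance finiteDimensional_QLE (n : ℕ) : FiniteDimensional ℝ (QLE B n) :=
  Submodule.finiteDimensional_of_le (inf_le_right : QLE B n ≤ weightLE B n)

theorem pairingIdent_tmul {N : ℕ} (h : weightLE B (N - 1)) (p : PrimLE B N) (w : W)
    (k : weightLE B (N - 1)) (q : QLE B N) : pairingIdent B W N (h ⊗ₜ (p ⊗ₜ w)) k q
      = (pair (h : HCK B) (k : HGL B) * pair (p : HCK B) (q : HGL B)) • w := by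
  rw [mul_smul]
  rfl

/-- The point is that `𝒫` and `𝒬` are in duality, also after truncation: `π` fixes `𝒫`, so `⟨p,
π*(f)⟩ = ⟨p, f⟩`, and `π*` fixes `𝒬`, so `⟨π(f), q⟩ = ⟨f, q⟩`. In both cases all pairings with
forests are recovered. -/
theorem pairingIdent_bijective (N : ℕ) : Function.Bijective (pairingIdent B W N) := by
  have h1 : Function.Injective (pair.domRestrict₁₂ (weightLE B (N - 1)) (weightLE B (N - 1))) := by
    rw [← LinearMap.ker_eq_bot, LinearMap.ker_eq_bot']
    intro x hx
    refine Subtype.ext (eq_zero_of_pair_eq_zero x.2 fun f hf => ?_)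
    exact LinearMap.congr_fun hx (⟨fo f, fo_mem_supported hf⟩ : weightLE B (N - 1))
  have h1' : Function.Injective
      (pair.domRestrict₁₂ (weightLE B (N - 1)) (weightLE B (N - 1))).flip := by
    rw [← LinearMap.ker_eq_bot, LinearMap.ker_eq_bot']
    intro x hx
    refine Subtype.ext (eq_zero_of_pair_eq_zero x.2 fun f hf => ?_)
    rw [pair_comm]
    exact LinearMap.congr_fun hx (⟨fo f, fo_mem_supported hf⟩ : weightLE B (N - 1))
  have h2 : Function.Injective (pair.domRestrict₁₂ (PrimLE B N) (QLE B N)) := by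
    rw [← LinearMap.ker_eq_bot, LinearMap.ker_eq_bot']
    intro p hp
    refine Subtype.ext (eq_zero_of_pair_eq_zero p.2.2 fun f hf => ?_)
    rw [← pair_truncPiStar]
    exact LinearMap.congr_fun hp (truncPiStar B N (fo f))
  have h2' : Function.Injective (pair.domRestrict₁₂ (PrimLE B N) (QLE B N)).flip := by
    rw [← LinearMap.ker_eq_bot, LinearMap.ker_eq_bot']
    intro q hq
    refine Subtype.ext (eq_zero_of_pair_eq_zero q.2.2 fun f hf => ?_)
    have h := LinearMap.congr_fun hq (truncPi B N (fo f))
    have e : pair (truncPi B N (fo f) : HCK B) (q : HGL B) = 0 := h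
    rw [coe_truncPi, truncLE_fo_of_le hf, ← pair_piStar] at e
    obtain ⟨x, hx⟩ := q.2.1
    rwa [← hx, piStar_piStar, hx, pair_comm] at e
  have hE := bijective_lift_smulRight (M := W) _ h2 h2'
  have e : pairingIdent B W N = TensorProduct.lift
      (LinearMap.smulRightₗ ∘ₗ pair.domRestrict₁₂ (weightLE B (N - 1)) (weightLE B (N - 1))) ∘ₗ
      ((LinearEquiv.ofBijective _ hE).lTensor (weightLE B (N - 1))).toLinearMap :=
    TensorProduct.ext' fun x y => rfl
  rw [e, LinearMap.coe_comp]
  exact (bijective_lift_smulRight _ h1 h1').comp (LinearEquiv.bijective _)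

theorem toCK_pairingIdent {N : ℕ} (τ : weightLE B (N - 1) ⊗[ℝ] (PrimLE B N ⊗[ℝ] W)) :
    toCK (pairingIdent B W N τ) = topTensor B W N τ := by
  rw [toCK, Function.leftInverse_invFun (pairingIdent_bijective N).1]

/-- Linear identities about elements of `𝓛(H_GL, 𝓛(𝒬, W))` can be checked on rank one elements. -/
theorem toCK_induction {N : ℕ} {M : Type*} [AddCommGroup M] [Module ℝ M]
    {φ : HCK B ⊗[ℝ] W →ₗ[ℝ] M} {ψ : (weightLE B (N - 1) →ₗ[ℝ] QLE B N →ₗ[ℝ] W) →ₗ[ℝ] M}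
    (h : ∀ (h : weightLE B (N - 1)) (p : PrimLE B N) (w : W),
      φ (growth (h : HCK B) (p : HCK B) ⊗ₜ w) = ψ (pairingIdent B W N (h ⊗ₜ (p ⊗ₜ w))))
    (A : weightLE B (N - 1) →ₗ[ℝ] QLE B N →ₗ[ℝ] W) : φ (toCK A) = ψ A := by
  obtain ⟨τ, rfl⟩ := (pairingIdent_bijective N).2 A
  rw [toCK_pairingIdent]
  refine LinearMap.congr_fun (f := φ ∘ₗ topTensor B W N) (g := ψ ∘ₗ pairingIdent B W N) ?_ τ
  refine TensorProduct.ext (LinearMap.ext fun x => TensorProduct.ext' fun p w => h x p w)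

theorem toCK_smul {N : ℕ} (c : ℝ) (A : weightLE B (N - 1) →ₗ[ℝ] QLE B N →ₗ[ℝ] W) :
    toCK (c • A) = c • toCK A := by
  obtain ⟨τ, rfl⟩ := (pairingIdent_bijective N).2 A
  rw [← map_smul, toCK_pairingIdent, toCK_pairingIdent, map_smul]

/-- Evaluation of an element of `𝓛(H_GL, 𝓛(𝒬, W))`. -/
noncomputable def evalAt {N : ℕ} (k : weightLE B (N - 1)) (q : QLE B N) :
    (weightLE B (N - 1) →ₗ[ℝ] QLE B N →ₗ[ℝ] W) →ₗ[ℝ] W :=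
  LinearMap.applyₗ q ∘ₗ LinearMap.applyₗ k

theorem evalAt_apply {N : ℕ} (k : weightLE B (N - 1)) (q : QLE B N)
    (A : weightLE B (N - 1) →ₗ[ℝ] QLE B N →ₗ[ℝ] W) : evalAt k q A = A k q := rfl

/-- On rank one elements this is `pair_growth_star`; the truncations may be inserted because the
factors `h` and `p` have bounded weight. Leaving `x` and `y` arbitrary allows its use for every
forest in the Davie sum. -/
theorem pairW_toCK_star_piStar {N : ℕ} (A : weightLE B (N - 1) →ₗ[ℝ] QLE B N →ₗ[ℝ] W)
    (x y : HGL B) : pairW (toCK A) (starGL x (piStar y))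
      = A (truncLE (N - 1) x) (truncPiStar B N y) := by
  refine toCK_induction (φ := pairW.flip (starGL x (piStar y)))
    (ψ := evalAt (truncLE (N - 1) x) (truncPiStar B N y)) (fun h p w => ?_) A
  rw [LinearMap.flip_apply, pairW_tmul, pair_growth_star p.2.1, evalAt_apply, pairingIdent_tmul,
    pair_truncLE h.2, pair_truncPiStar]

theorem pairW_toCK_star {N : ℕ} (A : weightLE B (N - 1) →ₗ[ℝ] QLE B N →ₗ[ℝ] W)
    (k : weightLE B (N - 1)) (q : QLE B N) :
    pairW (toCK A) (starGL (k : HGL B) (q : HGL B)) = A k q := by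
  have h : piStar (q : HGL B) = q := by
    obtain ⟨x, hx⟩ := q.2.1
    rw [← hx, piStar_piStar]
  rw [← h, pairW_toCK_star_piStar, truncLE_coe, truncPiStar_coe]

theorem sum_pair_truncLE {n m : ℕ} (hmn : m ≤ n) (k : HGL B) (hk : k ∈ weightLE B m) :
    ∑ g ∈ Forest.ofWeightLE B n, ((g.symm : ℝ)⁻¹ * pair k (fo g)) • truncLE m (fo g)
      = truncLE m k := by
  simp_rw [← map_smul]
  rw [← map_sum, sum_pair_smul]
  rw [coe_ofWeightLE]
  exact weightLE_mono hmn hk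

/-- Expand the factor `h` in forests. The summands with `|g| > N - 1` vanish, so the cut-off `n` is
free: `N - 1` suits the algebra, `N` the local expansion. -/
theorem rTensor_PiHat_toCK {N n : ℕ} (hn : N - 1 ≤ n)
    (A : weightLE B (N - 1) →ₗ[ℝ] QLE B N →ₗ[ℝ] W) (f : Forest B) :
    LinearMap.rTensor W (PiHat f) (toCK A) = ∑ g ∈ Forest.ofWeightLE B n,
      (g.symm : ℝ)⁻¹ • (growth (fo g) (piCK (fo f)) ⊗ₜ
        A (truncLE (N - 1) (fo g)) (truncPiStar B N (fo f))) := by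
  have := toCK_induction (φ := LinearMap.rTensor W (PiHat f))
    (ψ := ∑ g ∈ Forest.ofWeightLE B n, (g.symm : ℝ)⁻¹ •
      (TensorProduct.mk ℝ (HCK B) W (growth (fo g) (piCK (fo f))) ∘ₗ
        evalAt (truncLE (N - 1) (fo g)) (truncPiStar B N (fo f)))) (fun h p w => ?_) A
  · simpa [evalAt_apply] using this
  · rw [LinearMap.rTensor_tmul, PiHat_growth f _ p.2.1]
    simp only [LinearMap.sum_apply, LinearMap.smul_apply, LinearMap.comp_apply, evalAt_apply,
      TensorProduct.mk_apply, pairingIdent_tmul, pair_truncPiStar, pair_truncLE h.2]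
    nth_rw 1 [← sum_pair_smul (S := Forest.ofWeightLE B n) (x := (h : HCK B))
      (by rw [coe_ofWeightLE]; exact weightLE_mono hn h.2)]
    rw [map_sum, LinearMap.sum_apply, Finset.smul_sum, TensorProduct.sum_tmul]
    refine Finset.sum_congr rfl fun g _ => ?_
    rw [map_smul, LinearMap.smul_apply, TensorProduct.tmul_smul, TensorProduct.smul_tmul',
      TensorProduct.smul_tmul', smul_smul, smul_smul]
    congr 2
    ring

/-- This shows `PiHat f` acting through a fixed linear map on the values `A k`, which is why
controlled paths stay controlled. -/
theorem applyCK_PiHat {N : ℕ} (A : weightLE B (N - 1) →ₗ[ℝ] QLE B N →ₗ[ℝ] W) (f : Forest B)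
    (k : weightLE B (N - 1)) (q : QLE B N) : applyCK (PiHat f) A k q
      = pair (piCK (fo f)) (q : HGL B) • A k (truncPiStar B N (fo f)) := by
  have hq : piStar (q : HGL B) = q := by
    obtain ⟨x, hx⟩ := q.2.1
    rw [← hx, piStar_piStar]
  change pairW (LinearMap.rTensor W (PiHat f) (toCK A)) (starGL (k : HGL B) (q : HGL B)) = _
  rw [rTensor_PiHat_toCK le_rfl, map_sum, LinearMap.sum_apply]
  nth_rw 2 [← truncLE_coe k]
  rw [← sum_pair_truncLE le_rfl _ k.2, map_sum, LinearMap.sum_apply, Finset.smul_sum]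
  refine Finset.sum_congr rfl fun g _ => ?_
  rw [map_smul, LinearMap.smul_apply, pairW_tmul]
  nth_rw 1 [← hq]
  rw [pair_growth_star (piCK_mem_Prim _), map_smul, LinearMap.smul_apply, smul_smul, smul_smul,
    pair_comm (fo g)]
  congr 1
  ring

/-- The maps `ofCK` and `toCK` need to be inverse only on the image of `topTensor`, so one exhibits
a preimage `τ` of the transformed element whose factors all respect the weight bounds. -/
theorem toCK_applyCK_PiHat {N : ℕ} (A : weightLE B (N - 1) →ₗ[ℝ] QLE B N →ₗ[ℝ] W)
    (f : Forest B) : toCK (applyCK (PiHat f) A) = LinearMap.rTensor W (PiHat f) (toCK A) := by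
  -- Truncating `π(f)` is harmless: when `|f| > N`, the truncated `π*(f)` in the other factor is
  -- already `0`.
  have h0 : ∀ g : weightLE B (N - 1), piCK (fo f) ⊗ₜ[ℝ] A g (truncPiStar B N (fo f))
      = (truncPi B N (fo f) : HCK B) ⊗ₜ[ℝ] A g (truncPiStar B N (fo f)) := by
    intro g
    rcases le_or_gt f.weight N with hf | hf
    · rw [coe_truncPi, truncLE_fo_of_le hf]
    · have : truncPiStar B N (fo f) = 0 := Subtype.ext (by
        rw [coe_truncPiStar, truncLE_fo_of_lt hf]; simp)
      rw [this, map_zero, TensorProduct.tmul_zero, TensorProduct.tmul_zero]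
  set τ : weightLE B (N - 1) ⊗[ℝ] (PrimLE B N ⊗[ℝ] W) := ∑ g ∈ Forest.ofWeightLE B (N - 1),
    (g.symm : ℝ)⁻¹ • (truncLE (N - 1) (fo g) ⊗ₜ (truncPi B N (fo f) ⊗ₜ
      A (truncLE (N - 1) (fo g)) (truncPiStar B N (fo f)))) with hτ
  have h1 : topTensor B W N τ = LinearMap.rTensor W (PiHat f) (toCK A) := by
    rw [rTensor_PiHat_toCK le_rfl, hτ, map_sum]
    refine Finset.sum_congr rfl fun g hg => ?_
    rw [map_smul, topTensor_tmul, truncLE_fo_of_le (Forest.mem_ofWeightLE.1 hg)]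
    congr 1
    have := congrArg (LinearMap.rTensor W (growth (fo g)))
      (h0 (truncLE (N - 1) (fo g)))
    rw [LinearMap.rTensor_tmul, LinearMap.rTensor_tmul] at this
    exact this.symm
  have h2 : applyCK (PiHat f) A = pairingIdent B W N τ := by
    refine LinearMap.ext fun k => LinearMap.ext fun q => ?_
    rw [← pairW_toCK_star (pairingIdent B W N τ), toCK_pairingIdent, h1]
    rfl
  rw [h2, toCK_pairingIdent, h1]

/-- Comes from `p = ∑ ς(f)⁻¹ ⟨p, f⟩ π(f)`, where weights up to `N` suffice because `p` lies in the
truncation of `𝒫`. -/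
theorem sum_rTensor_PiHat_toCK {N : ℕ} (A : weightLE B (N - 1) →ₗ[ℝ] QLE B N →ₗ[ℝ] W) :
    ∑ f ∈ Forest.ofWeightLE B N, (f.symm : ℝ)⁻¹ • LinearMap.rTensor W (PiHat f) (toCK A)
      = toCK A := by
  obtain ⟨τ, rfl⟩ := (pairingIdent_bijective N).2 A
  rw [toCK_pairingIdent]
  have : (∑ f ∈ Forest.ofWeightLE B N, (f.symm : ℝ)⁻¹ • LinearMap.rTensor W (PiHat f)) ∘ₗ
      topTensor B W N = topTensor B W N := by
    refine TensorProduct.ext (LinearMap.ext fun h => TensorProduct.ext' fun p w => ?_)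
    change (∑ f ∈ Forest.ofWeightLE B N, (f.symm : ℝ)⁻¹ • LinearMap.rTensor W (PiHat f))
      (topTensor B W N (h ⊗ₜ (p ⊗ₜ w))) = topTensor B W N (h ⊗ₜ (p ⊗ₜ w))
    have hp : growth (h : HCK B) (p : HCK B) = ∑ f ∈ Forest.ofWeightLE B N,
        ((f.symm : ℝ)⁻¹ * pair (p : HCK B) (fo f)) • growth (h : HCK B) (piCK (fo f)) := by
      simp_rw [← map_smul]
      rw [← map_sum, ← map_sum, sum_pair_smul (by rw [coe_ofWeightLE]; exact p.2.2),
        piCK_of_mem_Prim p.2.1]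
    rw [topTensor_tmul, LinearMap.sum_apply]
    nth_rw 2 [hp]
    rw [TensorProduct.sum_tmul]
    refine Finset.sum_congr rfl fun f _ => ?_
    rw [LinearMap.smul_apply, LinearMap.rTensor_tmul, PiHat_growth f _ p.2.1, mul_smul,
      TensorProduct.smul_tmul']
  have h := LinearMap.congr_fun this τ
  rw [LinearMap.comp_apply, LinearMap.sum_apply] at h
  exact h

end Perfect

/-! ## Sums over labellings -/

section Labellings

variable {B : Type*}

theorem prod_factorial_count [DecidableEq (RTree B)] (f : Forest B) {S : Finset (RTree B)}
    (h : f.toFinset ⊆ S) :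
    ∏ t ∈ f.toFinset, (f.count t).factorial = ∏ t ∈ S, (f.count t).factorial :=
  Finset.prod_subset h fun t _ ht => by
    rw [Multiset.count_eq_zero_of_notMem (by simpa using ht), Nat.factorial_zero]

open scoped Classical in
-- Adding one more copy of `t` turns the factor `m!` for its multiplicity into `(m + 1)!`.
theorem Forest.symm_cons (t : RTree B) (f : Forest B) :
    Forest.symm (t ::ₘ f) = (f.count t + 1) * t.symm * f.symm := by
  rw [Forest.symm, Forest.symm, prod_factorial_count (S := insert t f.toFinset) f
    (Finset.subset_insert _ _), Multiset.toFinset_cons, Multiset.map_cons, Multiset.prod_cons]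
  have : ∀ x ∈ insert t f.toFinset, (Multiset.count x (t ::ₘ f)).factorial
      = (if t = x then f.count t + 1 else 1) * (f.count x).factorial := by
    intro x _
    rcases eq_or_ne t x with rfl | h
    · rw [if_pos rfl, Multiset.count_cons_self, Nat.factorial_succ]
    · rw [if_neg h, Multiset.count_cons_of_ne h.symm, one_mul]
  rw [Finset.prod_congr rfl this, Finset.prod_mul_distrib, Finset.prod_ite_eq,
    if_pos (Finset.mem_insert_self _ _)]
  ring

/-- The unlabelled tree underlying a labelled tree. -/
noncomputable def RTree.forget : RTree B → RTree Unit :=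
  RTree.recurse fun _ m => RTree.node () (m.map Prod.snd)

theorem RTree.forget_node (a : B) (f : Forest B) :
    (RTree.node a f).forget = RTree.node () (f.map RTree.forget) := by
  rw [RTree.forget, RTree.recurse_eq, RTree.children_node, Multiset.map_mk_snd]

theorem Forest.weight_forget (f : Forest B) : Forest.weight (f.map RTree.forget) = f.weight := by
  induction f using Forest.induction with
  | zero => rfl
  | add f g hf hg => rw [Multiset.map_add, Forest.weight_add, Forest.weight_add, hf, hg]
  | node a f hf =>
    rw [Multiset.map_singleton, RTree.forget_node, Forest.weight_singleton,
      Forest.weight_singleton, RTree.weight_node, RTree.weight_node, hf]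

theorem RTree.node_injective (a : B) : Function.Injective (RTree.node a) := fun f g h => by
  rw [← RTree.children_node a f, h, RTree.children_node]

open scoped Classical in
theorem count_map_eq_sum {α β : Type*} (φ : α → β) (f : Multiset α) {S : Finset α}
    (h : f.toFinset ⊆ S) (b : β) :
    (f.map φ).count b = ∑ s ∈ S, if φ s = b then f.count s else 0 := by
  have h1 : (f.map φ).count b = (f.map fun s => if φ s = b then 1 else 0).sum := by
    clear h
    induction f using Multiset.induction_on with
    | empty => simp
    | cons s f ih =>
      rw [Multiset.map_cons, Multiset.count_cons, ih, Multiset.map_cons, Multiset.sum_cons,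
        add_comm]
      simp only [eq_comm]
  rw [h1, Finset.sum_multiset_map_count]
  refine (Finset.sum_subset h fun s _ hs => ?_).trans (Finset.sum_congr rfl fun s _ => ?_)
  · rw [Multiset.count_eq_zero_of_notMem (by simpa using hs), zero_smul]
  · split_ifs <;> simp

/-! ### Multiplicities of labelled forests among labellings. -/

variable [Fintype B]

theorem RTree.labellings_node (u : Unit) (g : Forest Unit) :
    (RTree.node u g).labellings B = (Finset.univ : Finset B).val.bind fun a =>
      (g.labellings B).map (RTree.node a) := by
  rw [RTree.labellings, RTree.recurse_eq, RTree.children_node, Multiset.map_mk_snd]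
  rfl

theorem Forest.labellings_cons (t : RTree Unit) (g : Forest Unit) :
    Forest.labellings B (t ::ₘ g) = (t.labellings B).bind fun s =>
      (g.labellings B).map (Multiset.cons s) := by
  rw [Forest.labellings, Multiset.map_cons, Multiset.sections_cons]
  rfl

open scoped Classical in
-- The root of `s` determines the root label, so one term of the union over labels survives, and
-- `symm` does not see the root.
theorem count_labellings_node {g : Forest Unit}
    (hg : ∀ f : Forest B, (g.labellings B).count f * f.symm
      = if f.map RTree.forget = g then g.symm else 0) (u : Unit) (s : RTree B) :
    ((RTree.node u g).labellings B).count s * s.symm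
      = if s.forget = RTree.node u g then (RTree.node u g).symm else 0 := by
  rw [← s.node_root_children, RTree.labellings_node, Multiset.count_bind]
  set a := s.root
  set f := s.children
  have h1 : (Multiset.map (fun b => Multiset.count (RTree.node a f)
      (Multiset.map (RTree.node b) (g.labellings B))) (Finset.univ : Finset B).val).sum
      = (g.labellings B).count f := by
    change ∑ b : B, _ = _
    rw [Finset.sum_eq_single a, Multiset.count_map_eq_count' _ _ (RTree.node_injective a)]
    · intro b _ hb
      refine Multiset.count_eq_zero_of_notMem fun h => ?_
      obtain ⟨k, -, hk⟩ := Multiset.mem_map.1 h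
      have := congrArg RTree.root hk
      rw [RTree.root_node, RTree.root_node] at this
      exact hb this
    · exact fun h => absurd (Finset.mem_univ _) h
  rw [h1, RTree.symm_node, hg, RTree.forget_node, RTree.symm_node]
  simp only [(RTree.node_injective _).eq_iff]

open scoped Classical in
-- If `s` is the tree of `f` that labels `t`, then `ς(f) = m ς(s) ς(f ∖ s)` with `m` the
-- multiplicity of `s`, and the last two factors are absorbed by the hypotheses for `t` and for `g`.
-- Summing `m` over all `s` above `t` gives the multiplicity of `t` in the underlying forest, the
-- extra factor of `ς(t g)`.
theorem count_labellings_of_forall {g : Forest Unit}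
    (hg : ∀ t ∈ g, ∀ s : RTree B, (t.labellings B).count s * s.symm
      = if s.forget = t then t.symm else 0) (f : Forest B) :
    (g.labellings B).count f * f.symm = if f.map RTree.forget = g then g.symm else 0 := by
  induction g using Multiset.induction_on generalizing f with
  | empty =>
    have : Forest.labellings B 0 = {0} := rfl
    rw [this, Multiset.count_singleton]
    simp only [Multiset.map_eq_zero]
    split_ifs with h
    · subst h; rfl
    · rw [zero_mul]
  | cons t g ih =>
    have ht := hg t (Multiset.mem_cons_self t g)
    replace ih := ih fun s hs => hg s (Multiset.mem_cons_of_mem hs)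
    set L := t.labellings B
    set S := L.toFinset ∪ f.toFinset
    have h1 : (Forest.labellings B (t ::ₘ g)).count f = ∑ s ∈ S, L.count s *
        (if s ∈ f then (Forest.labellings B g).count (f.erase s) else 0) := by
      rw [Forest.labellings_cons, Multiset.count_bind, Finset.sum_multiset_map_count]
      refine (Finset.sum_subset Finset.subset_union_left fun s _ hs => ?_).trans
        (Finset.sum_congr rfl fun s _ => ?_)
      · rw [Multiset.count_eq_zero_of_notMem (by simpa using hs), zero_smul]
      · rw [smul_eq_mul]
        congr 1
        split_ifs with h
        · nth_rw 1 [← Multiset.cons_erase h]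
          exact Multiset.count_map_eq_count' _ _ (fun x y hxy => (Multiset.cons_inj_right s).1 hxy) _
        · refine Multiset.count_eq_zero_of_notMem fun h' => ?_
          obtain ⟨k, -, hk⟩ := Multiset.mem_map.1 h'
          exact h (hk ▸ Multiset.mem_cons_self s k)
    have h2 : ∀ s ∈ S, L.count s * (if s ∈ f then (Forest.labellings B g).count (f.erase s) else 0)
        * f.symm = (if s.forget = t then f.count s else 0) *
          (if f.map RTree.forget = t ::ₘ g then t.symm * Forest.symm g else 0) := by
      intro s _
      by_cases hs : s ∈ f
      · have e1 : f.symm = f.count s * s.symm * Forest.symm (f.erase s) := by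
          nth_rw 1 [← Multiset.cons_erase hs]
          rw [Forest.symm_cons, Multiset.count_erase_self,
            Nat.sub_add_cancel (Multiset.count_pos.2 hs)]
        have e2 : L.count s * (Forest.labellings B g).count (f.erase s) * f.symm = f.count s *
            (L.count s * s.symm) * ((Forest.labellings B g).count (f.erase s)
              * Forest.symm (f.erase s)) := by rw [e1]; ring
        rw [if_pos hs, e2, ht, ih]
        by_cases hst : s.forget = t
        · have e3 : (f.erase s).map RTree.forget = g ↔ f.map RTree.forget = t ::ₘ g := by
            nth_rw 2 [← Multiset.cons_erase hs]
            rw [Multiset.map_cons, hst, Multiset.cons_inj_right]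
          simp only [e3, if_pos hst]
          split_ifs <;> ring
        · rw [if_neg hst, if_neg hst]
          ring
      · rw [if_neg hs, Multiset.count_eq_zero_of_notMem hs]
        simp
    rw [h1, Finset.sum_mul, Finset.sum_congr rfl h2, ← Finset.sum_mul,
      ← count_map_eq_sum RTree.forget f Finset.subset_union_right t]
    split_ifs with h
    · rw [h, Multiset.count_cons_self, Forest.symm_cons]
      ring
    · rw [mul_zero]

open scoped Classical in
-- Orbit counting: the automorphisms of `g` act on its labellings, those that yield `f` form one
-- orbit, and its stabiliser has order `ς(f)`. The proof replaces this action by structural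
-- induction.
theorem count_labellings (g : Forest Unit) (f : Forest B) :
    (g.labellings B).count f * f.symm = if f.map RTree.forget = g then g.symm else 0 := by
  refine count_labellings_of_forall ?_ f
  induction g using Forest.induction with
  | zero => simp
  | add f g hf hg =>
    intro t ht
    rcases Multiset.mem_add.1 ht with h | h
    · exact hf t h
    · exact hg t h
  | node u g hg =>
    intro t ht
    rw [Multiset.mem_singleton.1 ht]
    exact count_labellings_node (count_labellings_of_forall hg) u

/-- Each labelled `f` appears only under its own underlying `g`, with total coefficient `ς(g)⁻¹ ·
ς(g)/ς(f)`. -/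
theorem labelSum_eq {M : Type*} [AddCommGroup M] [Module ℝ M] (N : ℕ) (F : Forest B → M) :
    labelSum B N F = ∑ f ∈ Forest.ofWeightLE B N, (f.symm : ℝ)⁻¹ • F f := by
  classical
  have h1 : ∀ g ∈ Forest.ofWeightLE Unit N, (g.symm : ℝ)⁻¹ • ((g.labellings B).map F).sum
      = ∑ f ∈ Forest.ofWeightLE B N,
        (if f.map RTree.forget = g then (f.symm : ℝ)⁻¹ else 0) • F f := by
    intro g hg
    have h2 : ((g.labellings B).map F).sum
        = ∑ f ∈ Forest.ofWeightLE B N, ((g.labellings B).count f : ℝ) • F f := by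
      rw [Finset.sum_multiset_map_count]
      refine (Finset.sum_congr rfl fun f _ => (Nat.cast_smul_eq_nsmul ℝ _ _).symm).trans ?_
      refine Finset.sum_subset (fun f hf => ?_) fun f _ hf => ?_
      · have h3 := count_labellings g f
        have h4 : (g.labellings B).count f ≠ 0 := by
          rw [Multiset.count_ne_zero]; simpa using hf
        split_ifs at h3 with h
        · rw [Forest.mem_ofWeightLE, ← Forest.weight_forget, h]
          exact Forest.mem_ofWeightLE.1 hg
        · exact absurd h3 (Nat.mul_ne_zero h4 f.symm_pos.ne')
      · rw [Multiset.count_eq_zero_of_notMem (by simpa using hf), Nat.cast_zero, zero_smul]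
    rw [h2, Finset.smul_sum]
    refine Finset.sum_congr rfl fun f _ => ?_
    rw [smul_smul]
    congr 1
    have h3 : ((g.labellings B).count f : ℝ) * f.symm
        = if f.map RTree.forget = g then (g.symm : ℝ) else 0 := by
      exact_mod_cast congrArg (Nat.cast (R := ℝ)) (count_labellings g f)
    rw [inv_mul_eq_iff_eq_mul₀ g.symm_ne_zero, ← mul_left_inj' f.symm_ne_zero, h3]
    split_ifs
    · rw [mul_assoc, inv_mul_cancel₀ f.symm_ne_zero, mul_one]
    · ring
  rw [labelSum, Finset.sum_congr rfl h1, Finset.sum_comm]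
  refine Finset.sum_congr rfl fun f hf => ?_
  rw [← Finset.sum_smul, Finset.sum_ite_eq, if_pos]
  rw [Forest.mem_ofWeightLE, Forest.weight_forget]
  exact Forest.mem_ofWeightLE.1 hf

end Labellings

/-! ## The sewing lemma -/

section Sewing

open Filter Topology

variable {W : Type*} [NormedAddCommGroup W] {T : ℝ} {ω : ℝ → ℝ → ℝ}

theorem IsControl.mono_left (hω : IsControl T ω) {s u t : ℝ} (hs : 0 ≤ s) (hsu : s ≤ u)
    (hut : u ≤ t) (ht : t ≤ T) : ω s u ≤ ω s t := by
  have := hω.superadd s u t hs hsu hut ht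
  have := hω.nonneg u t (hs.trans hsu) hut ht
  linarith

theorem IsControl.mono_right (hω : IsControl T ω) {s u t : ℝ} (hs : 0 ≤ s) (hsu : s ≤ u)
    (hut : u ≤ t) (ht : t ≤ T) : ω u t ≤ ω s t := by
  have := hω.superadd s u t hs hsu hut ht
  have := hω.nonneg s u hs hsu (hut.trans ht)
  linarith

/-- Uniform continuity on the compact simplex, comparing `(a, b)` with the diagonal point `(a, a)`.
-/
theorem IsControl.exists_delta (hω : IsControl T ω) {η : ℝ} (hη : 0 < η) :
    ∃ δ > 0, ∀ a b, 0 ≤ a → a ≤ b → b ≤ T → b - a < δ → ω a b < η := by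
  set K : Set (ℝ × ℝ) := {z | 0 ≤ z.1 ∧ z.1 ≤ z.2 ∧ z.2 ≤ T} with hK
  have hKc : IsCompact K := by
    refine (isCompact_Icc (a := ((0 : ℝ), (0 : ℝ))) (b := (T, T))).of_isClosed_subset ?_ ?_
    · exact (isClosed_le continuous_const continuous_fst).inter
        ((isClosed_le continuous_fst continuous_snd).inter
          (isClosed_le continuous_snd continuous_const))
    · rintro ⟨a, b⟩ ⟨h1, h2, h3⟩
      exact ⟨⟨h1, h1.trans h2⟩, ⟨h2.trans h3, h3⟩⟩
  have hu := hKc.uniformContinuousOn_of_continuous hω.continuousOn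
  rw [Metric.uniformContinuousOn_iff] at hu
  obtain ⟨δ, hδ, h⟩ := hu η hη
  refine ⟨δ, hδ, fun a b ha hab hb hd => ?_⟩
  have h1 := h (a, b) ⟨ha, hab, hb⟩ (a, a) ⟨ha, le_refl a, hab.trans hb⟩ (by
    rw [Prod.dist_eq, dist_self, Real.dist_eq, abs_of_nonneg (sub_nonneg.2 hab)]
    exact max_lt hδ hd)
  simp only [hω.diag a ha (hab.trans hb), Real.dist_eq, sub_zero] at h1
  exact (le_abs_self _).trans_lt h1

/-- A two-parameter family `Ξ` is almost additive. -/
def AlmostAdditive (T C θ : ℝ) (ω : ℝ → ℝ → ℝ) (Ξ : ℝ → ℝ → W) : Prop :=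
  ∀ s u t, 0 ≤ s → s ≤ u → u ≤ t → t ≤ T → ‖Ξ s t - Ξ s u - Ξ u t‖ ≤ C * ω s t ^ θ

/-! ### Almost additive families, their Riemann sums and limits. -/

variable {C θ : ℝ} {Ξ : ℝ → ℝ → W}

theorem AlmostAdditive.diag (hω : IsControl T ω) (hθ : 0 < θ) (h : AlmostAdditive T C θ ω Ξ)
    {t : ℝ} (h0 : 0 ≤ t) (hT : t ≤ T) : Ξ t t = 0 := by
  have := h t t t h0 le_rfl le_rfl hT
  rw [hω.diag t h0 hT, Real.zero_rpow hθ.ne', mul_zero, sub_self, zero_sub, norm_neg] at this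
  exact norm_le_zero_iff.1 this

/-- Induction on the number of points, splitting where the control is halved: if `u k` is the last
point with `ω(u i, u k)` at most half the total, superadditivity makes `ω(u (k+1), u j)` at most
half as well. The constant does not depend on the partition. -/
theorem AlmostAdditive.exists_bound (hω : IsControl T ω) (hθ : 1 < θ) (hC : 0 ≤ C)
    (h : AlmostAdditive T C θ ω Ξ) : ∃ K, 0 ≤ K ∧ ∀ u : ℕ → ℝ, Monotone u → 0 ≤ u 0 →
      ∀ i j, i ≤ j → u j ≤ T →
        ‖Ξ (u i) (u j) - ∑ k ∈ Finset.Ico i j, Ξ (u k) (u (k + 1))‖ ≤ K * ω (u i) (u j) ^ θ := by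
  have h2 : (2 : ℝ) * (1 / 2) ^ θ < 1 := by
    have : (1 / 2 : ℝ) ^ θ < (1 / 2) ^ (1 : ℝ) :=
      Real.rpow_lt_rpow_of_exponent_gt (by norm_num) (by norm_num) hθ
    rw [Real.rpow_one] at this
    linarith
  -- Two halves, each scaled by `2^{-θ}`; `r < 1` because `θ > 1`.
  set r := (2 : ℝ) * (1 / 2) ^ θ with hr
  -- The fixed point of `K = 2C + K r`: two defects from splitting off `u k` and `u (k+1)`, and one
  -- error bound on each half.
  set K := 2 * C / (1 - r) with hK
  have hK0 : 0 ≤ K := div_nonneg (by linarith) (by linarith)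
  have hKr : 2 * C + K * r = K := by
    rw [hK]
    have : (1 - r) ≠ 0 := by linarith
    field_simp
    ring
  refine ⟨K, hK0, fun u hu hu0 => ?_⟩
  intro i j hij
  induction hn : j - i using Nat.strong_induction_on generalizing i j with
  | _ n ih =>
    intro hj
    have hi0 : ∀ i, 0 ≤ u i := fun i => hu0.trans (hu (Nat.zero_le i))
    have hle : ∀ i ≤ j, u i ≤ T := fun i hi => (hu hi).trans hj
    rcases hij.eq_or_lt with rfl | hlt
    · rw [Finset.Ico_self, Finset.sum_empty, sub_zero, h.diag hω (by linarith) (hi0 i) hj, norm_zero]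
      exact mul_nonneg hK0 (Real.rpow_nonneg (hω.nonneg _ _ (hi0 i) le_rfl hj) _)
    have hω0 : 0 ≤ ω (u i) (u j) := hω.nonneg _ _ (hi0 i) (hu hij) hj
    set P : ℕ → Prop := fun k => i ≤ k ∧ ω (u i) (u k) ≤ ω (u i) (u j) / 2 with hP
    classical
    have hPi : P i := ⟨le_rfl, by
      rw [hω.diag _ (hi0 i) (hle i hij)]
      linarith⟩
    -- Searching only up to `j - 1` guarantees `k + 1 ≤ j`, so both remaining index ranges are
    -- shorter.
    set k := Nat.findGreatest P (j - 1) with hk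
    obtain ⟨hik, hk1⟩ : P k := Nat.findGreatest_spec (m := i) (by omega) hPi
    have hkj : k ≤ j - 1 := Nat.findGreatest_le _
    have hk2 : ω (u (k + 1)) (u j) ≤ ω (u i) (u j) / 2 := by
      rcases Nat.eq_or_lt_of_le (show k + 1 ≤ j by omega) with he | hl
      · rw [he, hω.diag _ (hi0 j) hj]
        linarith
      · have hn := Nat.findGreatest_is_greatest (P := P) (n := j - 1) (k := k + 1)
          (Nat.lt_succ_self k) (by omega)
        have h3 : ω (u i) (u j) / 2 < ω (u i) (u (k + 1)) := by
          by_contra hcon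
          exact hn ⟨by omega, not_lt.1 hcon⟩
        have := hω.superadd (u i) (u (k + 1)) (u j) (hi0 i) (hu (by omega)) (hu (by omega)) hj
        linarith
    have e1 := ih (k - i) (by omega) i k hik rfl (hle k (by omega))
    have e2 := ih (j - (k + 1)) (by omega) (k + 1) j (by omega) rfl hj
    have e3 := h (u i) (u k) (u j) (hi0 i) (hu hik) (hu (by omega)) hj
    have e4 := h (u k) (u (k + 1)) (u j) (hi0 k) (hu (by omega)) (hu (by omega)) hj
    have e5 : C * ω (u k) (u j) ^ θ ≤ C * ω (u i) (u j) ^ θ := by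
      refine mul_le_mul_of_nonneg_left (Real.rpow_le_rpow (hω.nonneg _ _ (hi0 k) (hu (by omega)) hj)
        (hω.mono_right (hi0 i) (hu hik) (hu (by omega)) hj) (by linarith)) hC
    have hhalf : ∀ x, 0 ≤ x → x ≤ ω (u i) (u j) / 2 →
        K * x ^ θ ≤ K * ((1 / 2) ^ θ * ω (u i) (u j) ^ θ) := by
      intro x hx hx'
      rw [← Real.mul_rpow (by norm_num) hω0]
      refine mul_le_mul_of_nonneg_left (Real.rpow_le_rpow hx (by linarith) (by linarith)) hK0
    have e6 := hhalf _ (hω.nonneg _ _ (hi0 i) (hu hik) (hle k (by omega))) hk1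
    have e7 := hhalf _ (hω.nonneg _ _ (hi0 (k + 1)) (hu (show k + 1 ≤ j by omega)) hj) hk2
    have hsum : ∑ l ∈ Finset.Ico i j, Ξ (u l) (u (l + 1))
        = ∑ l ∈ Finset.Ico i k, Ξ (u l) (u (l + 1)) + Ξ (u k) (u (k + 1))
          + ∑ l ∈ Finset.Ico (k + 1) j, Ξ (u l) (u (l + 1)) := by
      rw [← Finset.sum_Ico_consecutive _ (show i ≤ k + 1 by omega) (show k + 1 ≤ j by omega),
        Finset.sum_Ico_succ_top hik]
    have hdec : Ξ (u i) (u j) - ∑ l ∈ Finset.Ico i j, Ξ (u l) (u (l + 1))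
        = (Ξ (u i) (u j) - Ξ (u i) (u k) - Ξ (u k) (u j))
          + (Ξ (u k) (u j) - Ξ (u k) (u (k + 1)) - Ξ (u (k + 1)) (u j))
          + (Ξ (u i) (u k) - ∑ l ∈ Finset.Ico i k, Ξ (u l) (u (l + 1)))
          + (Ξ (u (k + 1)) (u j) - ∑ l ∈ Finset.Ico (k + 1) j, Ξ (u l) (u (l + 1))) := by
      rw [hsum]; abel
    rw [hdec]
    refine (norm_add_le _ _).trans ((add_le_add_left (norm_add_le _ _) _).trans
      ((add_le_add_left (add_le_add_left (norm_add_le _ _) _) _).trans ?_))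
    have hfin : K * ω (u i) (u j) ^ θ = 2 * (C * ω (u i) (u j) ^ θ)
        + 2 * (K * ((1 / 2) ^ θ * ω (u i) (u j) ^ θ)) := by
      nth_rw 1 [← hKr]
      rw [hr]
      ring
    linarith

theorem IsControl.sum_le (hω : IsControl T ω) {u : ℕ → ℝ} (hu : Monotone u) (hu0 : 0 ≤ u 0) (n : ℕ)
    (hn : u n ≤ T) : ∑ i ∈ Finset.range n, ω (u i) (u (i + 1)) ≤ ω (u 0) (u n) := by
  induction n with
  | zero => rw [Finset.sum_range_zero, hω.diag _ hu0 hn]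
  | succ n ih =>
    rw [Finset.sum_range_succ]
    have h1 := ih ((hu (Nat.le_succ n)).trans hn)
    have h2 := hω.superadd (u 0) (u n) (u (n + 1)) hu0 (hu (Nat.zero_le n)) (hu (Nat.le_succ n)) hn
    linarith

theorem IsControl.sum_rpow_le (hω : IsControl T ω) (hθ : 1 < θ) {u : ℕ → ℝ} (hu : Monotone u)
    (hu0 : 0 ≤ u 0) (n : ℕ) (hn : u n ≤ T) {η : ℝ} (hη : 0 ≤ η)
    (h : ∀ i < n, ω (u i) (u (i + 1)) ≤ η) :
    ∑ i ∈ Finset.range n, ω (u i) (u (i + 1)) ^ θ ≤ η ^ (θ - 1) * ω (u 0) (u n) := by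
  refine le_trans (Finset.sum_le_sum fun i hi => ?_)
    ((Finset.mul_sum _ _ _).symm.le.trans (mul_le_mul_of_nonneg_left (hω.sum_le hu hu0 n hn)
      (Real.rpow_nonneg hη (θ - 1))))
  have hi' := Finset.mem_range.1 hi
  have h0 : 0 ≤ ω (u i) (u (i + 1)) := hω.nonneg _ _ (hu0.trans (hu (Nat.zero_le i)))
    (hu (Nat.le_succ i)) ((hu (by omega)).trans hn)
  have e : ω (u i) (u (i + 1)) ^ θ = ω (u i) (u (i + 1)) ^ (θ - 1) * ω (u i) (u (i + 1)) := by
    rw [← Real.rpow_add_one' h0 (by linarith)]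
    congr 1
    ring
  rw [e]
  exact mul_le_mul_of_nonneg_right (Real.rpow_le_rpow h0 (h i hi') (by linarith)) h0

/-- The point of `[s,t]` nearest to `x`. -/
noncomputable def clamp (s t x : ℝ) : ℝ := max s (min t x)

theorem clamp_mono (s t : ℝ) : Monotone (clamp s t) := fun _ _ h =>
  max_le_max le_rfl (min_le_min le_rfl h)

theorem le_clamp (s t x : ℝ) : s ≤ clamp s t x := le_max_left _ _

theorem clamp_le {s t : ℝ} (h : s ≤ t) (x : ℝ) : clamp s t x ≤ t := max_le h (min_le_left _ _)

theorem clamp_of_le {s t x : ℝ} (h : x ≤ s) : clamp s t x = s :=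
  max_eq_left ((min_le_right _ _).trans h)

theorem clamp_of_ge {s t x : ℝ} (hst : s ≤ t) (h : t ≤ x) : clamp s t x = t := by
  rw [clamp, min_eq_left h, max_eq_right hst]

theorem clamp_left {s u t x : ℝ} (hut : u ≤ t) (h : x ≤ u) : clamp s t x = clamp s u x := by
  rw [clamp, clamp, min_eq_right (h.trans hut), min_eq_right h]

theorem clamp_right {s u t x : ℝ} (hsu : s ≤ u) (hut : u ≤ t) (h : u ≤ x) :
    clamp s t x = clamp u t x := by
  rw [clamp, clamp, max_eq_right (le_min hut h), max_eq_right (hsu.trans (le_min hut h))]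

theorem clamp_sub_le (s t : ℝ) {x y : ℝ} (h : x ≤ y) : clamp s t y - clamp s t x ≤ y - x := by
  have h1 : clamp s t y ≤ clamp s t x + (y - x) := by
    refine max_le ?_ ?_
    · have := le_clamp s t x
      linarith
    · have h2 : min t x ≤ clamp s t x := le_max_right _ _
      have h3 : min t y ≤ min t x + (y - x) := by
        rw [← min_add_add_right]
        exact le_min ((min_le_left _ _).trans (by linarith)) ((min_le_right _ _).trans (by linarith))
      linarith
  linarith

/-- If `u` is not between `a` and `b`, one of the two clamped pieces collapses to `u` and the other
equals the full piece, so nothing is left; otherwise a single additivity defect remains. -/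
theorem AlmostAdditive.norm_clamp_le (hω : IsControl T ω) (hθ : 0 < θ) (hC : 0 ≤ C)
    (h : AlmostAdditive T C θ ω Ξ) {s u t a b : ℝ} (hs : 0 ≤ s) (hsu : s ≤ u) (hut : u ≤ t)
    (ht : t ≤ T) (hab : a ≤ b) :
    ‖Ξ (clamp s t a) (clamp s t b) - Ξ (clamp s u a) (clamp s u b)
      - Ξ (clamp u t a) (clamp u t b)‖ ≤ C * ω (clamp s t a) (clamp s t b) ^ θ := by
  have hnn : 0 ≤ C * ω (clamp s t a) (clamp s t b) ^ θ :=
    mul_nonneg hC (Real.rpow_nonneg (hω.nonneg _ _ (hs.trans (le_clamp _ _ _)) (clamp_mono s t hab)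
      ((clamp_le (hsu.trans hut) _).trans ht)) _)
  have hdiag := h.diag hω hθ (hs.trans hsu) (hut.trans ht)
  rcases le_total b u with hb | hb
  · rw [clamp_left hut hb, clamp_left hut (hab.trans hb), clamp_of_le (hab.trans hb),
      clamp_of_le hb, hdiag, sub_self, sub_zero, norm_zero]
    rwa [clamp_left hut hb, clamp_left hut (hab.trans hb)] at hnn
  rcases le_total u a with ha | ha
  · rw [clamp_right hsu hut ha, clamp_right hsu hut hb, clamp_of_ge hsu ha, clamp_of_ge hsu hb,
      hdiag, sub_zero, sub_self, norm_zero]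
    rwa [clamp_right hsu hut ha, clamp_right hsu hut hb] at hnn
  · rw [clamp_left hut ha, clamp_right hsu hut hb, clamp_of_ge hsu hb, clamp_of_le ha]
    exact h _ _ _ (hs.trans (le_clamp _ _ _)) (clamp_le hsu _) (le_clamp _ _ _)
      ((clamp_le hut _).trans ht)

/-- Riemann sums over regular grids of `[0,T]`, clamped to `[s,t]`, stay in a fixed ball by
`exists_bound` and become additive as the mesh shrinks. One non-principal ultrafilter gives limits
for all `(s,t)` at once, by compactness of balls, so additivity survives without a Cauchy argument.
-/
theorem AlmostAdditive.exists_additive [NormedSpace ℝ W] [FiniteDimensional ℝ W]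
    (hω : IsControl T ω) (hT : 0 ≤ T) (hθ : 1 < θ) (hC : 0 ≤ C) (h : AlmostAdditive T C θ ω Ξ) :
    ∃ (I : ℝ → ℝ → W) (K : ℝ), 0 ≤ K ∧
      (∀ s u t, 0 ≤ s → s ≤ u → u ≤ t → t ≤ T → I s t = I s u + I u t) ∧
      (∀ s t, 0 ≤ s → s ≤ t → t ≤ T → ‖I s t - Ξ s t‖ ≤ K * ω s t ^ θ) := by
  have := FiniteDimensional.proper ℝ W
  obtain ⟨K, hK, hb⟩ := h.exists_bound hω hθ hC
  set g : ℕ → ℕ → ℝ := fun n k => k * (T / (n + 1)) with hg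
  have hstep : ∀ n : ℕ, 0 ≤ T / ((n : ℝ) + 1) := fun n => div_nonneg hT (by positivity)
  have hgm : ∀ n, Monotone (g n) := fun n a b hab =>
    mul_le_mul_of_nonneg_right (Nat.cast_le.2 hab) (hstep n)
  have hg0 : ∀ n, g n 0 = 0 := fun n => by simp [hg]
  have hgT : ∀ n, g n (n + 1) = T := fun n => by
    have : (n : ℝ) + 1 ≠ 0 := by positivity
    simp only [hg, Nat.cast_add, Nat.cast_one]
    field_simp
  set S : ℕ → ℝ → ℝ → W := fun n s t => ∑ k ∈ Finset.range (n + 1),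
    Ξ (clamp s t (g n k)) (clamp s t (g n (k + 1))) with hS
  have hSb : ∀ n s t, 0 ≤ s → s ≤ t → t ≤ T → ‖S n s t - Ξ s t‖ ≤ K * ω s t ^ θ := by
    intro n s t hs hst ht
    have h1 := hb (fun k => clamp s t (g n k)) ((clamp_mono s t).comp (hgm n))
      (hs.trans (le_clamp _ _ _)) 0 (n + 1) (Nat.zero_le _) ((clamp_le hst _).trans ht)
    simp only [hg0, hgT, clamp_of_le hs, clamp_of_ge hst ht] at h1
    rwa [norm_sub_rev, ← Finset.range_eq_Ico] at h1
  have hSa : ∀ s u t, 0 ≤ s → s ≤ u → u ≤ t → t ≤ T →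
      Tendsto (fun n => S n s t - S n s u - S n u t) atTop (𝓝 0) := by
    intro s u t hs hsu hut ht
    rw [Metric.tendsto_atTop]
    intro ε hε
    have hωst := hω.nonneg s t hs (hsu.trans hut) ht
    -- When `ω ≤ η` on every cell, the sum of the `ω^θ` is at most `η^(θ-1) ω(s,t)`. So `η` is
    -- chosen first, and then a mesh that enforces it.
    have hcont : Tendsto (fun η : ℝ => C * (η ^ (θ - 1) * ω s t)) (𝓝[>] 0) (𝓝 0) := by
      have h1 : Tendsto (fun η : ℝ => η ^ (θ - 1)) (𝓝 0) (𝓝 ((0 : ℝ) ^ (θ - 1))) :=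
        (Real.continuousAt_rpow_const _ _ (Or.inr (by linarith))).tendsto
      rw [Real.zero_rpow (by linarith)] at h1
      have h2 := ((h1.mul_const (ω s t)).const_mul C).mono_left (nhdsWithin_le_nhds (s := Set.Ioi 0))
      simpa using h2
    obtain ⟨η, hη1, hη⟩ := ((hcont.eventually (gt_mem_nhds hε)).and self_mem_nhdsWithin).exists
    obtain ⟨δ, hδ, hδη⟩ := hω.exists_delta (show (0 : ℝ) < η from hη)
    have hlim : Tendsto (fun n : ℕ => T / ((n : ℝ) + 1)) atTop (𝓝 0) :=
      (tendsto_const_nhds (x := T)).div_atTop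
        (tendsto_atTop_add_const_right _ _ tendsto_natCast_atTop_atTop)
    obtain ⟨n₀, hn₀⟩ := (hlim.eventually (gt_mem_nhds hδ)).exists_forall_of_atTop
    refine ⟨n₀, fun n hn => ?_⟩
    rw [dist_zero_right]
    have hst := hsu.trans hut
    have e : S n s t - S n s u - S n u t = ∑ k ∈ Finset.range (n + 1),
        (Ξ (clamp s t (g n k)) (clamp s t (g n (k + 1)))
          - Ξ (clamp s u (g n k)) (clamp s u (g n (k + 1)))
          - Ξ (clamp u t (g n k)) (clamp u t (g n (k + 1)))) := by
      simp only [hS, Finset.sum_sub_distrib]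
    have hmono : Monotone fun k => clamp s t (g n k) := (clamp_mono s t).comp (hgm n)
    rw [e]
    calc _ ≤ ∑ k ∈ Finset.range (n + 1),
          C * ω (clamp s t (g n k)) (clamp s t (g n (k + 1))) ^ θ :=
          norm_sum_le_of_le _ fun k _ =>
            h.norm_clamp_le hω (by linarith) hC hs hsu hut ht (hgm n (Nat.le_succ k))
      _ ≤ C * (η ^ (θ - 1) * ω s t) := by
          rw [← Finset.mul_sum]
          refine mul_le_mul_of_nonneg_left ?_ hC
          have := hω.sum_rpow_le hθ hmono (hs.trans (le_clamp _ _ _)) (n + 1)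
            ((clamp_le hst _).trans ht) (le_of_lt hη) (fun k _ => ?_)
          · simpa only [hg0, hgT, clamp_of_le hs, clamp_of_ge hst ht] using this
          · refine (hδη _ _ (hs.trans (le_clamp _ _ _)) (hmono (Nat.le_succ k))
              ((clamp_le hst _).trans ht) ?_).le
            refine (clamp_sub_le s t (hgm n (Nat.le_succ k))).trans_lt ?_
            have : g n (k + 1) - g n k = T / ((n : ℝ) + 1) := by
              simp only [hg]; push_cast; ring
            rw [this]
            exact hn₀ n hn
      _ < ε := hη1
  have hex : ∀ s t, ∃ x : W, 0 ≤ s → s ≤ t → t ≤ T →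
      x ∈ Metric.closedBall (Ξ s t) (K * ω s t ^ θ) ∧
      Tendsto (fun n => S n s t) (hyperfilter ℕ : Filter ℕ) (𝓝 x) := by
    intro s t
    by_cases hc : 0 ≤ s ∧ s ≤ t ∧ t ≤ T
    · obtain ⟨x, hx, hx'⟩ := (isCompact_closedBall (Ξ s t) (K * ω s t ^ θ)).ultrafilter_le_nhds
        ((hyperfilter ℕ).map fun n => S n s t) (by
          rw [Ultrafilter.coe_map]
          refine tendsto_principal.2 (Filter.Eventually.of_forall fun n => ?_)
          rw [mem_closedBall_iff_norm]
          exact hSb n s t hc.1 hc.2.1 hc.2.2)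
      exact ⟨x, fun _ _ _ => ⟨hx, hx'⟩⟩
    · exact ⟨0, fun h1 h2 h3 => absurd ⟨h1, h2, h3⟩ hc⟩
  choose I hI using hex
  refine ⟨I, K, hK, fun s u t hs hsu hut ht => ?_, fun s t hs hst ht => ?_⟩
  · have h1 := (((hI s t hs (hsu.trans hut) ht).2.sub (hI s u hs hsu (hut.trans ht)).2).sub
      (hI u t (hs.trans hsu) hut ht).2)
    have h2 := (hSa s u t hs hsu hut ht).mono_left (Nat.hyperfilter_le_atTop)
    have h3 := tendsto_nhds_unique h1 h2
    rw [sub_sub, sub_eq_zero] at h3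
    exact h3
  · exact mem_closedBall_iff_norm.1 (hI s t hs hst ht).1

/-- The additive `I` telescopes along any partition, so the error is a sum of local errors of order
`ω^θ`, which tends to `0` with the mesh. -/
theorem AlmostAdditive.exists_partitionLimit [NormedSpace ℝ W] [FiniteDimensional ℝ W]
    (hω : IsControl T ω) (hT : 0 ≤ T) (hθ : 1 < θ) (hC : 0 ≤ C) (h : AlmostAdditive T C θ ω Ξ) :
    ∃ (I : ℝ → ℝ → W) (K : ℝ), ∀ s t, 0 ≤ s → s ≤ t → t ≤ T →
      HasPartitionLimit Ξ s t (I s t) ∧ ‖I s t - Ξ s t‖ ≤ K * ω s t ^ θ := by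
  obtain ⟨I, K, hK, hadd, hbd⟩ := h.exists_additive hω hT hθ hC
  refine ⟨I, K, fun s t hs hst ht => ⟨fun ε hε => ?_, hbd s t hs hst ht⟩⟩
  have hcont : Tendsto (fun η : ℝ => K * (η ^ (θ - 1) * ω s t)) (𝓝[>] 0) (𝓝 0) := by
    have h1 : Tendsto (fun η : ℝ => η ^ (θ - 1)) (𝓝 0) (𝓝 ((0 : ℝ) ^ (θ - 1))) :=
      (Real.continuousAt_rpow_const _ _ (Or.inr (by linarith))).tendsto
    rw [Real.zero_rpow (by linarith)] at h1
    have h2 := ((h1.mul_const (ω s t)).const_mul K).mono_left (nhdsWithin_le_nhds (s := Set.Ioi 0))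
    simpa using h2
  obtain ⟨η, hη1, hη⟩ := ((hcont.eventually (gt_mem_nhds hε)).and self_mem_nhdsWithin).exists
  obtain ⟨δ, hδ, hδη⟩ := hω.exists_delta (show (0 : ℝ) < η from hη)
  refine ⟨δ, hδ, fun n u hu hu0 hun hmesh => ?_⟩
  have hi0 : ∀ i, 0 ≤ u i := fun i => (hu0 ▸ hs : 0 ≤ u 0).trans (hu (Nat.zero_le i))
  have hiT : ∀ i ≤ n, u i ≤ T := fun i hi => (hu hi).trans (hun ▸ ht)
  have htel : ∀ m ≤ n, I s (u m) = ∑ i ∈ Finset.range m, I (u i) (u (i + 1)) := by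
    intro m
    induction m with
    | zero =>
      intro _
      have := hadd s s s hs le_rfl le_rfl (hst.trans ht)
      rw [hu0, Finset.sum_range_zero]
      simpa using this
    | succ m ih =>
      intro hm
      rw [Finset.sum_range_succ, ← ih (by omega), ← hu0]
      exact hadd _ _ _ (hi0 0) (hu (Nat.zero_le m)) (hu (Nat.le_succ m)) (hiT _ hm)
  have hI := htel n le_rfl
  rw [hun] at hI
  rw [hI, ← Finset.sum_sub_distrib]
  calc _ ≤ ∑ i ∈ Finset.range n, K * ω (u i) (u (i + 1)) ^ θ :=
        norm_sum_le_of_le _ fun i hi => by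
          rw [norm_sub_rev]
          have := Finset.mem_range.1 hi
          exact hbd _ _ (hi0 i) (hu (Nat.le_succ i)) (hiT _ (by omega))
    _ ≤ K * (η ^ (θ - 1) * ω s t) := by
        rw [← Finset.mul_sum]
        refine mul_le_mul_of_nonneg_left ?_ hK
        have := hω.sum_rpow_le hθ hu (hi0 0) n (hiT n le_rfl) (le_of_lt hη) (fun i hi =>
          (hδη _ _ (hi0 i) (hu (Nat.le_succ i)) (hiT _ (by omega)) (hmesh i hi)).le)
        rwa [hu0, hun] at this
    _ < ε := hη1

theorem HasPartitionLimit.unique {s t : ℝ} (hst : s ≤ t) {I J : W}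
    (hI : HasPartitionLimit Ξ s t I) (hJ : HasPartitionLimit Ξ s t J) : I = J := by
  refine eq_of_forall_dist_le fun ε hε => ?_
  obtain ⟨δ, hδ, h1⟩ := hI (ε / 2) (by linarith)
  obtain ⟨δ', hδ', h2⟩ := hJ (ε / 2) (by linarith)
  obtain ⟨n, hn⟩ := exists_nat_gt ((t - s) / min δ δ')
  have hm : 0 < min δ δ' := lt_min hδ hδ'
  have hn0 : (0 : ℝ) < n := lt_of_le_of_lt (div_nonneg (by linarith) hm.le) hn
  have hn0' : 0 < n := Nat.cast_pos.1 hn0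
  set u : ℕ → ℝ := fun k => s + (min k n : ℕ) * ((t - s) / n) with hu
  have hst' : 0 ≤ (t - s) / n := div_nonneg (by linarith) hn0.le
  have hum : Monotone u := fun a b hab => by
    have : ((min a n : ℕ) : ℝ) ≤ (min b n : ℕ) := Nat.cast_le.2 (min_le_min_right n hab)
    have := mul_le_mul_of_nonneg_right this hst'
    simp only [hu]
    linarith
  have hu0 : u 0 = s := by simp [hu]
  have hun : u n = t := by
    simp only [hu, min_self]
    field_simp
    ring
  have hmesh : ∀ i < n, u (i + 1) - u i < min δ δ' := by
    intro i hi
    simp only [hu, min_eq_left (Nat.succ_le_of_lt hi), min_eq_left hi.le]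
    push_cast
    have : (t - s) / n < min δ δ' := by
      rw [div_lt_iff₀ hm] at hn
      rw [div_lt_iff₀ hn0]
      linarith
    linarith
  have e1 := h1 n u hum hu0 hun fun i hi => (hmesh i hi).trans_le (min_le_left _ _)
  have e2 := h2 n u hum hu0 hun fun i hi => (hmesh i hi).trans_le (min_le_right _ _)
  rw [← dist_eq_norm] at e1 e2
  have := dist_triangle_left I J (∑ i ∈ Finset.range n, Ξ (u i) (u (i + 1)))
  linarith

theorem HasPartitionLimit.sum [NormedSpace ℝ W] {ι : Type*} (A : Finset ι) (c : ι → ℝ)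
    {Θ : ι → ℝ → ℝ → W} {s t : ℝ} {I : ι → W} (h : ∀ i ∈ A, HasPartitionLimit (Θ i) s t (I i)) :
    HasPartitionLimit (fun u v => ∑ i ∈ A, c i • Θ i u v) s t (∑ i ∈ A, c i • I i) := by
  classical
  induction A using Finset.induction_on with
  | empty =>
    intro ε hε
    exact ⟨1, one_pos, fun n u _ _ _ _ => by simpa using hε⟩
  | insert a A ha ih =>
    intro ε hε
    -- The added `1` keeps the divisor positive when `c a = 0`.
    have hc : 0 < |c a| + 1 := by positivity
    obtain ⟨δ, hδ, h1⟩ := ih (fun i hi => h i (Finset.mem_insert_of_mem hi)) (ε / 2) (by linarith)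
    obtain ⟨δ', hδ', h2⟩ := h a (Finset.mem_insert_self a A) (ε / 2 / (|c a| + 1))
      (div_pos (by linarith) hc)
    refine ⟨min δ δ', lt_min hδ hδ', fun n u hu hu0 hun hmesh => ?_⟩
    have e1 := h1 n u hu hu0 hun fun i hi => (hmesh i hi).trans_le (min_le_left _ _)
    have e2 := h2 n u hu hu0 hun fun i hi => (hmesh i hi).trans_le (min_le_right _ _)
    have e3 : ‖c a • (∑ i ∈ Finset.range n, Θ a (u i) (u (i + 1)) - I a)‖ < ε / 2 := by
      rw [norm_smul, Real.norm_eq_abs]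
      rw [lt_div_iff₀ hc] at e2
      have := norm_nonneg (∑ i ∈ Finset.range n, Θ a (u i) (u (i + 1)) - I a)
      nlinarith
    simp only [Finset.sum_insert ha, Finset.sum_add_distrib]
    rw [← Finset.smul_sum, add_sub_add_comm, ← smul_sub]
    exact (norm_add_le _ _).trans_lt (by linarith)

end Sewing

/-! ## Estimates for branched rough paths -/

section Estimates

theorem IsControl.rpow_le (ρ : ℝ) (hρ : 1 ≤ ρ) {T : ℝ} {ω : ℝ → ℝ → ℝ} (hω : IsControl T ω)
    {m n : ℕ} (hmn : n ≤ m) {s t : ℝ} (hs : 0 ≤ s) (hst : s ≤ t) (ht : t ≤ T) :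
    ω s t ^ ((m : ℝ) / ρ) ≤ ω 0 T ^ (((m - n : ℕ) : ℝ) / ρ) * ω s t ^ ((n : ℝ) / ρ) := by
  have h0 := hω.nonneg s t hs hst ht
  have hle : ω s t ≤ ω 0 T := (hω.mono_right le_rfl hs hst ht).trans
    (hω.mono_left le_rfl (hs.trans hst) ht le_rfl)
  have e : (m : ℝ) / ρ = ((m - n : ℕ) : ℝ) / ρ + (n : ℝ) / ρ := by
    rw [Nat.cast_sub hmn]; ring
  rw [e, Real.rpow_add_of_nonneg h0 (by positivity) (by positivity)]
  exact mul_le_mul_of_nonneg_right (Real.rpow_le_rpow h0 hle (by positivity))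
    (Real.rpow_nonneg h0 _)

/-- `F_{s,t} = O(ω(s,t)^{m/ρ})`, for `F` with values in a normed space. -/
def IsNormBigO (ρ T : ℝ) (ω : ℝ → ℝ → ℝ) (m : ℕ) {W : Type*} [NormedAddCommGroup W]
    (F : ℝ → ℝ → W) : Prop :=
  ∃ C, 0 ≤ C ∧ ∀ s t, 0 ≤ s → s ≤ t → t ≤ T → ‖F s t‖ ≤ C * ω s t ^ ((m : ℝ) / ρ)

variable {ρ T : ℝ} {ω : ℝ → ℝ → ℝ} {W : Type*} [NormedAddCommGroup W]

theorem IsNormBigO.mono (hρ : 1 ≤ ρ) (hω : IsControl T ω) {m n : ℕ} (hmn : n ≤ m)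
    {F : ℝ → ℝ → W} (h : IsNormBigO ρ T ω m F) : IsNormBigO ρ T ω n F := by
  obtain ⟨C, hC, h⟩ := h
  by_cases hT : 0 ≤ T
  · refine ⟨C * ω 0 T ^ (((m - n : ℕ) : ℝ) / ρ), mul_nonneg hC
      (Real.rpow_nonneg (hω.nonneg 0 T le_rfl hT le_rfl) _), fun s t hs hst ht => ?_⟩
    refine (h s t hs hst ht).trans ?_
    rw [mul_assoc]
    exact mul_le_mul_of_nonneg_left (hω.rpow_le ρ hρ hmn hs hst ht) hC
  · exact ⟨0, le_rfl, fun s t hs hst ht => absurd (hs.trans (hst.trans ht)) hT⟩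

theorem IsNormBigO.add {m : ℕ} {F G : ℝ → ℝ → W} (hF : IsNormBigO ρ T ω m F)
    (hG : IsNormBigO ρ T ω m G) : IsNormBigO ρ T ω m fun s t => F s t + G s t := by
  obtain ⟨C, hC, hF⟩ := hF
  obtain ⟨D, hD, hG⟩ := hG
  refine ⟨C + D, add_nonneg hC hD, fun s t hs hst ht => ?_⟩
  rw [add_mul]
  exact (norm_add_le _ _).trans (add_le_add (hF s t hs hst ht) (hG s t hs hst ht))

theorem IsNormBigO.sum {m : ℕ} {ι : Type*} (A : Finset ι)
    {F : ι → ℝ → ℝ → W} (hF : ∀ i ∈ A, IsNormBigO ρ T ω m (F i)) :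
    IsNormBigO ρ T ω m fun s t => ∑ i ∈ A, F i s t := by
  classical
  induction A using Finset.induction_on with
  | empty => exact ⟨0, le_rfl, fun s t _ _ _ => by simp⟩
  | insert a A ha ih =>
    simp only [Finset.sum_insert ha]
    exact (hF a (Finset.mem_insert_self a A)).add
      (ih fun i hi => hF i (Finset.mem_insert_of_mem hi))

variable [NormedSpace ℝ W]

theorem IsNormBigO.smul {m : ℕ} {c : ℝ → ℝ → ℝ} {F : ℝ → ℝ → W} (hc : IsNormBigO ρ T ω m c)
    {M : ℝ} (hM : ∀ s t, 0 ≤ s → s ≤ t → t ≤ T → ‖F s t‖ ≤ M) :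
    IsNormBigO ρ T ω m fun s t => c s t • F s t := by
  obtain ⟨C, hC, hc⟩ := hc
  refine ⟨C * max M 0, mul_nonneg hC (le_max_right _ _), fun s t hs hst ht => ?_⟩
  rw [norm_smul, mul_right_comm]
  exact mul_le_mul (hc s t hs hst ht) ((hM s t hs hst ht).trans (le_max_left _ _)) (norm_nonneg _)
    ((norm_nonneg _).trans (hc s t hs hst ht))

theorem IsNormBigO.const_smul {m : ℕ} (c : ℝ) {F : ℝ → ℝ → W} (hF : IsNormBigO ρ T ω m F) :
    IsNormBigO ρ T ω m fun s t => c • F s t := by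
  obtain ⟨C, hC, hF⟩ := hF
  refine ⟨|c| * C, by positivity, fun s t hs hst ht => ?_⟩
  rw [norm_smul, mul_assoc, Real.norm_eq_abs]
  exact mul_le_mul_of_nonneg_left (hF s t hs hst ht) (abs_nonneg c)

/-- Finitely many coordinate functionals control the norm; this lets the functional-wise estimates
of the definitions enter the sewing lemma. -/
theorem isNormBigO_iff [FiniteDimensional ℝ W] (hω : IsControl T ω) {m : ℕ} {F : ℝ → ℝ → W} :
    IsNormBigO ρ T ω m F ↔ IsOmegaBigO ρ T ω m F := by
  constructor
  · rintro ⟨C, hC, h⟩ φ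
    refine ⟨‖φ.toContinuousLinearMap‖ * C, fun s t hs hst ht => ?_⟩
    rw [mul_assoc]
    exact (φ.toContinuousLinearMap.le_opNorm (F s t)).trans
      (mul_le_mul_of_nonneg_left (h s t hs hst ht) (norm_nonneg _))
  · intro h
    set b := Module.finBasis ℝ W
    have h1 : ∀ i, IsNormBigO ρ T ω m fun s t => b.coord i (F s t) • b i := by
      intro i
      obtain ⟨C, hC⟩ := h (b.coord i)
      refine IsNormBigO.smul (M := ‖b i‖) ⟨max C 0, le_max_right _ _, fun s t hs hst ht => ?_⟩
        fun _ _ _ _ _ => le_rfl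
      exact (hC s t hs hst ht).trans (mul_le_mul_of_nonneg_right (le_max_left _ _)
        (Real.rpow_nonneg (hω.nonneg s t hs hst ht) _))
    have h2 := IsNormBigO.sum Finset.univ fun i _ => h1 i
    have e : (fun s t => ∑ i, b.coord i (F s t) • b i) = F := by
      funext s t
      exact b.sum_repr (F s t)
    rwa [e] at h2

/-! ### Contractions of the coproduct and orders of pairings with `X`. -/

variable {B : Type*}

/-- The contraction `x ⊗ z ↦ ⟨z, k⟩ x`. -/
noncomputable def contractSnd (k : HGL B) : HCK B ⊗[ℝ] HCK B →ₗ[ℝ] HCK B :=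
  (TensorProduct.rid ℝ (HCK B)).toLinearMap ∘ₗ LinearMap.lTensor (HCK B) (pair.flip k)

theorem contractSnd_tmul (k : HGL B) (x z : HCK B) :
    contractSnd k (x ⊗ₜ z) = pair z k • x := by
  simp [contractSnd]

theorem pair_contractSnd (k x : HGL B) (z : HCK B ⊗[ℝ] HCK B) :
    pair (contractSnd k z) x = pairTensor x k z := by
  induction z using TensorProduct.induction_on with
  | zero => simp
  | tmul u v =>
    rw [contractSnd_tmul, pairTensor_tmul, map_smul, LinearMap.smul_apply, smul_eq_mul, mul_comm]
  | add z w hz hw => rw [map_add, map_add, LinearMap.add_apply, map_add, hz, hw]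

theorem contractSnd_mem {n : ℕ} {k : Forest B} {z : HCK B ⊗[ℝ] HCK B}
    (hz : z ∈ tensorWeightEq B n) : contractSnd (fo k) z ∈ weightEq B (n - k.weight) := by
  have : tensorWeightEq B n ≤ (weightEq B (n - k.weight)).comap (contractSnd (fo k)) := by
    refine Submodule.span_le.2 ?_
    rintro _ ⟨f, g, e, rfl⟩
    rw [SetLike.mem_coe, Submodule.mem_comap, contractSnd_tmul]
    by_cases h : g = k
    · subst h
      refine Submodule.smul_mem _ _ ?_
      rw [← e, Nat.add_sub_cancel]
      exact fo_mem_weightEq f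
    · rw [pair_fo_of_ne h, zero_smul]
      exact zero_mem _
  exact this hz

theorem pair_eq_zero_of_lt {m n : ℕ} (h : n < m) {y : HCK B} (hy : y ∈ weightEq B m) {x : HGL B}
    (hx : x ∈ weightLE B n) : pair y x = 0 :=
  eqOn_supported (φ := pair.flip x) (ψ := 0) (fun f hf => by
    rw [LinearMap.flip_apply, pair_comm, pair_fo_eq_zero_of_mem hx, LinearMap.zero_apply]
    intro hf'
    have h1 : f.weight = m := hf
    have h2 : f.weight ≤ n := hf'
    omega) hy

variable [Finite B] {X : ℝ → ℝ → weightLE B ⌊ρ⌋₊}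

theorem IsControlledPath.map {U U' : Type*} [AddCommGroup U] [Module ℝ U] [AddCommGroup U']
    [Module ℝ U'] (L : U →ₗ[ℝ] U') {H : ℝ → weightLE B (⌊ρ⌋₊ - 1) →ₗ[ℝ] U}
    (hH : IsControlledPath ρ T ω X H) : IsControlledPath ρ T ω X fun r => L ∘ₗ H r where
  regular h φ := by
    obtain ⟨C, hC⟩ := hH.regular h (φ ∘ₗ L)
    refine ⟨C, fun s t hs hst ht => ?_⟩
    simpa using hC s t hs hst ht
  controlled n hn h hh φ := by
    obtain ⟨C, hC⟩ := hH.controlled n hn h hh (φ ∘ₗ L)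
    refine ⟨C, fun s t hs hst ht => ?_⟩
    simpa using hC s t hs hst ht

theorem coe_ofWeight (n : ℕ) : (Forest.ofWeight B n : Set (Forest B)) = {f | f.weight = n} := by
  ext f; simp

theorem IsBranchedRoughPath.isNormBigO_pair (hω : IsControl T ω) (hX : IsBranchedRoughPath ρ T ω X)
    {n : ℕ} (hn : n ≤ ⌊ρ⌋₊) {y : HCK B} (hy : y ∈ weightEq B n) :
    IsNormBigO ρ T ω n fun s t => pair y (X s t : HGL B) := by
  have e : ∀ s t, pair y (X s t : HGL B) = ∑ f ∈ Forest.ofWeight B n,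
      ((f.symm : ℝ)⁻¹ * pair y (fo f)) • pair (fo f) (X s t : HGL B) := by
    intro s t
    nth_rw 1 [← sum_pair_smul (S := Forest.ofWeight B n) (x := y)
      (by rw [coe_ofWeight]; exact hy)]
    simp only [map_sum, map_smul, LinearMap.sum_apply, LinearMap.smul_apply]
  simp only [e]
  refine IsNormBigO.sum _ fun f hf => IsNormBigO.const_smul _ ?_
  have hf' := Forest.mem_ofWeight.1 hf
  rw [isNormBigO_iff hω, ← hf']
  exact hX.regular f (hf'.trans_le hn)

/-- Contracting the right factor of `Δg` with `k` leaves weight `|g| - |k|`. If `|k| > |g|` the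
contraction is `0` and the truncated subtraction claims order `0` only. -/
theorem IsBranchedRoughPath.isNormBigO_pair_star (hω : IsControl T ω)
    (hX : IsBranchedRoughPath ρ T ω X) (k : Forest B) {g : Forest B} (hg : g.weight ≤ ⌊ρ⌋₊) :
    IsNormBigO ρ T ω (g.weight - k.weight)
      fun s t => pair (fo g) (starGL (X s t : HGL B) (fo k)) := by
  simp only [pair_starGL, ← pair_contractSnd]
  exact hX.isNormBigO_pair hω (by omega) (contractSnd_mem (coproduct_fo_mem g))

/-- Insert the resolution of the identity by forests in the right tensor factor; weights up to `m`
suffice, as factors of `Δg` weigh at most `|g|`. -/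
theorem pairTensor_lTensor_growth {m : ℕ} (x y : HGL B) (p : HCK B) {g : Forest B}
    (hg : g.weight ≤ m) :
    pairTensor x y (LinearMap.lTensor (HCK B) (growth.flip p) (coproduct (fo g)))
      = ∑ k ∈ Forest.ofWeightLE B m, (k.symm : ℝ)⁻¹ * pair (growth (fo k) p) y
          * pair (fo g) (starGL x (fo k)) := by
  simp only [pair_starGL]
  have h := coproduct_fo_mem g
  have : tensorWeightEq B g.weight ≤ LinearMap.eqLocus
      (pairTensor x y ∘ₗ LinearMap.lTensor (HCK B) (growth.flip p))
      (∑ k ∈ Forest.ofWeightLE B m, ((k.symm : ℝ)⁻¹ * pair (growth (fo k) p) y) •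
        pairTensor x (fo k)) := by
    refine Submodule.span_le.2 ?_
    rintro _ ⟨f, l, e, rfl⟩
    rw [SetLike.mem_coe, LinearMap.mem_eqLocus, LinearMap.comp_apply, LinearMap.lTensor_tmul,
      LinearMap.sum_apply, pairTensor_tmul, LinearMap.flip_apply]
    rw [Finset.sum_eq_single_of_mem l (by rw [Forest.mem_ofWeightLE]; omega) fun k _ hk => by
      rw [LinearMap.smul_apply, pairTensor_tmul, pair_fo_of_ne hk.symm, mul_zero, smul_zero],
      LinearMap.smul_apply, pairTensor_tmul, pair_fo_self, smul_eq_mul]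
    have := l.symm_ne_zero
    field_simp
  have h2 := this h
  rw [LinearMap.mem_eqLocus, LinearMap.comp_apply, LinearMap.sum_apply] at h2
  simpa using h2

/-- The local expansion `∑_g ς(g)⁻¹ ⟨g ⊤ p, X_{s,t}⟩ ⟨A_s, g⟩`. -/
noncomputable def localExpansion {N : ℕ} (X : ℝ → ℝ → weightLE B N)
    (A : ℝ → weightLE B (N - 1) →ₗ[ℝ] W) (p : HCK B) (s t : ℝ) : W :=
  ∑ g ∈ Forest.ofWeightLE B N, (g.symm : ℝ)⁻¹ •
    (pair (growth (fo g) p) (X s t : HGL B) • A s (truncLE (N - 1) (fo g)))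

/-- If `|g| + b > N`, the element `g ⊤ p` is too heavy to pair with the truncated `X`. -/
theorem localExpansion_eq {N : ℕ} (X : ℝ → ℝ → weightLE B N)
    (A : ℝ → weightLE B (N - 1) →ₗ[ℝ] W) {p : HCK B} {b : ℕ} (hp : p ∈ weightEq B b)
    (s t : ℝ) : localExpansion X A p s t = ∑ g ∈ Forest.ofWeightLE B (N - b), (g.symm : ℝ)⁻¹ •
      (pair (growth (fo g) p) (X s t : HGL B) • A s (truncLE (N - 1) (fo g))) := by
  rw [localExpansion]
  refine (Finset.sum_subset (fun g hg => ?_) fun g _ hg => ?_).symm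
  · rw [Forest.mem_ofWeightLE] at hg ⊢; omega
  · rw [Forest.mem_ofWeightLE] at hg
    rw [pair_eq_zero_of_lt (by omega) (growth_mem_weightEq (fo_mem_weightEq g) hp) (X s t).2,
      zero_smul, smul_zero]

/-- The part of weight at most `m` of an element of `H_GL`, as an element of weight at most `n`. -/
noncomputable def lowerPart (B : Type*) [Finite B] (m n : ℕ) : HGL B →ₗ[ℝ] weightLE B n :=
  truncLE n ∘ₗ (weightLE B m).subtype ∘ₗ truncLE m

theorem lowerPart_apply (m n : ℕ) (x : HGL B) : lowerPart B m n x
    = ∑ g ∈ Forest.ofWeightLE B m, ((g.symm : ℝ)⁻¹ * pair (fo g) x) • truncLE n (fo g) := by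
  simp_rw [← map_smul]
  rw [← map_sum, lowerPart, LinearMap.comp_apply, LinearMap.comp_apply, Submodule.subtype_apply]
  congr 1
  rw [← sum_pair_smul (S := Forest.ofWeightLE B m) (x := (truncLE m x : HGL B))
    (by rw [coe_ofWeightLE]; exact (truncLE m x).2)]
  refine Finset.sum_congr rfl fun g hg => ?_
  rw [pair_comm, pair_truncLE (fo_mem_supported (Forest.mem_ofWeightLE.1 hg))]

theorem lowerPart_self (n : ℕ) (x : HGL B) : lowerPart B n n x = truncLE n x := truncLE_coe _

/-! ### Almost additivity of the local expansion. -/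

variable {A : ℝ → weightLE B (⌊ρ⌋₊ - 1) →ₗ[ℝ] W}

/-- Chen's relation and the cocycle identity split `⟨g ⊤ p, X_{s,t}⟩` into `⟨g ⊤ p, X_{s,u}⟩` and
products `⟨g, X_{s,u} ⋆ k⟩ ⟨k ⊤ p, X_{u,t}⟩`. Resumming the latter over `g` evaluates `A s` at the
part of `X_{s,u} ⋆ k` of weight at most `N - b`; against `A u` at `k` only a controlled remainder is
left. -/
theorem localExpansion_sub (hX : IsBranchedRoughPath ρ T ω X) {p : HCK B} (hp : p ∈ Prim B)
    {b : ℕ} (hpb : p ∈ weightEq B b) (hb : b ≤ ⌊ρ⌋₊) {s u t : ℝ} (hs : 0 ≤ s) (hsu : s ≤ u)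
    (hut : u ≤ t) (ht : t ≤ T) :
    localExpansion X A p s t - localExpansion X A p s u - localExpansion X A p u t
      = -∑ k ∈ Forest.ofWeightLE B (⌊ρ⌋₊ - b), (k.symm : ℝ)⁻¹ •
        (pair (growth (fo k) p) (X u t : HGL B) • (A u (truncLE (⌊ρ⌋₊ - 1) (fo k))
          - A s (lowerPart B (⌊ρ⌋₊ - b) (⌊ρ⌋₊ - 1) (starGL (X s u : HGL B) (fo k))))) := by
  set m := ⌊ρ⌋₊ - b with hm
  have h1 : ∀ g ∈ Forest.ofWeightLE B m, pair (growth (fo g) p) (X s t : HGL B)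
      = pair (growth (fo g) p) (X s u : HGL B) + ∑ k ∈ Forest.ofWeightLE B m,
        (k.symm : ℝ)⁻¹ * pair (growth (fo k) p) (X u t : HGL B)
          * pair (fo g) (starGL (X s u : HGL B) (fo k)) := by
    intro g hg
    have hg' := Forest.mem_ofWeightLE.1 hg
    have h1u : pair 1 (X u t : HGL B) = 1 := hX.unit u t (hs.trans hsu) hut ht
    -- As `|g| + b ≤ N`, the truncation in Chen's relation is invisible to `g ⊤ p`.
    rw [hX.chen s u t hs hsu hut ht, pair_truncLE (weightEq_le_weightLE (by omega)
      (growth_mem_weightEq (fo_mem_weightEq g) hpb)), pair_starGL, coproduct_growth _ hp, map_add,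
      pairTensor_tmul, h1u, mul_one, pairTensor_lTensor_growth _ _ p hg']
  have h2 : ∑ k ∈ Forest.ofWeightLE B m, (k.symm : ℝ)⁻¹ •
      (pair (growth (fo k) p) (X u t : HGL B) •
        A s (lowerPart B m (⌊ρ⌋₊ - 1) (starGL (X s u : HGL B) (fo k))))
      = ∑ g ∈ Forest.ofWeightLE B m, (g.symm : ℝ)⁻¹ • ((∑ k ∈ Forest.ofWeightLE B m,
        (k.symm : ℝ)⁻¹ * pair (growth (fo k) p) (X u t : HGL B)
          * pair (fo g) (starGL (X s u : HGL B) (fo k))) • A s (truncLE (⌊ρ⌋₊ - 1) (fo g))) := by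
    simp only [lowerPart_apply, map_sum, map_smul, Finset.smul_sum, Finset.sum_smul]
    rw [Finset.sum_comm]
    refine Finset.sum_congr rfl fun g _ => Finset.sum_congr rfl fun k _ => ?_
    simp only [smul_smul]
    congr 1
    ring
  rw [localExpansion_eq X A hpb, localExpansion_eq X A hpb, localExpansion_eq X A hpb]
  simp only [smul_sub, Finset.sum_sub_distrib]
  rw [h2, Finset.sum_congr rfl fun g hg => by rw [h1 g hg, add_smul, smul_add],
    Finset.sum_add_distrib]
  abel

variable [FiniteDimensional ℝ W]

theorem IsControlledPath.bounded (hρ : 1 ≤ ρ) (hω : IsControl T ω)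
    (hA : IsControlledPath ρ T ω X A) (h : weightLE B (⌊ρ⌋₊ - 1)) :
    ∃ M, ∀ t, 0 ≤ t → t ≤ T → ‖A t h‖ ≤ M := by
  obtain ⟨C, hC, hb⟩ := ((isNormBigO_iff hω).2 (hA.regular h)).mono hρ hω (Nat.zero_le 1)
  refine ⟨‖A 0 h‖ + C, fun t h0 ht => ?_⟩
  have h1 := hb 0 t le_rfl h0 ht
  rw [Nat.cast_zero, zero_div, Real.rpow_zero, mul_one] at h1
  have h2 := norm_add_le (A 0 h) (A t h - A 0 h)
  rw [add_sub_cancel] at h2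
  linarith

/-- Controlledness gives order `N - |k|`, which is enough. The discarded forests `g` have weight at
least `m + 1`, and each costs `⟨g, X ⋆ k⟩`, of order `|g| - |k|`. -/
theorem IsControlledPath.isNormBigO_lowerPart (hρ : 1 ≤ ρ) (hω : IsControl T ω)
    (hX : IsBranchedRoughPath ρ T ω X) (hA : IsControlledPath ρ T ω X A) {m : ℕ}
    (hm : m ≤ ⌊ρ⌋₊ - 1) {k : Forest B} (hk : k.weight ≤ m) :
    IsNormBigO ρ T ω (m + 1 - k.weight) fun s t => A t (truncLE (⌊ρ⌋₊ - 1) (fo k))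
      - A s (lowerPart B m (⌊ρ⌋₊ - 1) (starGL (X s t : HGL B) (fo k))) := by
  classical
  have hN : 1 ≤ ⌊ρ⌋₊ := Nat.le_floor (by simpa using hρ)
  have hsub : Forest.ofWeightLE B m ⊆ Forest.ofWeightLE B (⌊ρ⌋₊ - 1) := fun g hg => by
    rw [Forest.mem_ofWeightLE] at hg ⊢; omega
  have hk' : (truncLE (⌊ρ⌋₊ - 1) (fo k) : HGL B) = fo k := truncLE_fo_of_le (hk.trans hm)
  have e : ∀ s t, A t (truncLE (⌊ρ⌋₊ - 1) (fo k))
      - A s (lowerPart B m (⌊ρ⌋₊ - 1) (starGL (X s t : HGL B) (fo k)))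
      = (A t (truncLE (⌊ρ⌋₊ - 1) (fo k)) - A s (truncLE (⌊ρ⌋₊ - 1)
          (starGL (X s t : HGL B) (truncLE (⌊ρ⌋₊ - 1) (fo k) : HGL B))))
        + ∑ g ∈ Forest.ofWeightLE B (⌊ρ⌋₊ - 1) \ Forest.ofWeightLE B m,
          (g.symm : ℝ)⁻¹ • (pair (fo g) (starGL (X s t : HGL B) (fo k)) •
            A s (truncLE (⌊ρ⌋₊ - 1) (fo g))) := by
    intro s t
    rw [hk', ← lowerPart_self (⌊ρ⌋₊ - 1) (starGL _ _), lowerPart_apply, lowerPart_apply, ← Finset.sum_sdiff hsub]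
    simp only [map_add, map_sum, map_smul, smul_smul]
    abel
  simp only [e]
  refine IsNormBigO.add ?_ (IsNormBigO.sum _ fun g hg => IsNormBigO.const_smul _ ?_)
  · refine IsNormBigO.mono hρ hω (m := ⌊ρ⌋₊ - k.weight) (by omega) ((isNormBigO_iff hω).2 ?_)
    refine hA.controlled k.weight (by omega) (truncLE (⌊ρ⌋₊ - 1) (fo k)) ?_
    rw [hk']
    exact fo_mem_weightEq k
  · rw [Finset.mem_sdiff, Forest.mem_ofWeightLE, Forest.mem_ofWeightLE] at hg
    obtain ⟨M, hM⟩ := hA.bounded hρ hω (truncLE (⌊ρ⌋₊ - 1) (fo g))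
    refine IsNormBigO.smul (M := M) ?_ fun s t hs hst ht => hM s hs (hst.trans ht)
    exact (hX.isNormBigO_pair_star hω k (by omega)).mono hρ hω (by omega)

/-- The orders `|k| + b` on `[u,t]` and `N - b + 1 - |k|` on `[s,u]` add up to `N + 1` for every
`k`. -/
theorem localExpansion_almostAdditive (hρ : 1 ≤ ρ) (hω : IsControl T ω)
    (hX : IsBranchedRoughPath ρ T ω X) (hA : IsControlledPath ρ T ω X A) {p : HCK B}
    (hp : p ∈ Prim B) {b : ℕ} (hpb : p ∈ weightEq B b) (hb0 : 1 ≤ b) (hb : b ≤ ⌊ρ⌋₊) :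
    ∃ C, 0 ≤ C ∧ AlmostAdditive T C (((⌊ρ⌋₊ + 1 : ℕ) : ℝ) / ρ) ω (localExpansion X A p) := by
  set m := ⌊ρ⌋₊ - b with hm
  have h1 : ∀ k ∈ Forest.ofWeightLE B m, ∃ C, 0 ≤ C ∧ ∀ s u t, 0 ≤ s → s ≤ u → u ≤ t → t ≤ T →
      ‖(k.symm : ℝ)⁻¹ • (pair (growth (fo k) p) (X u t : HGL B) •
        (A u (truncLE (⌊ρ⌋₊ - 1) (fo k))
          - A s (lowerPart B m (⌊ρ⌋₊ - 1) (starGL (X s u : HGL B) (fo k)))))‖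
        ≤ C * ω s t ^ (((⌊ρ⌋₊ + 1 : ℕ) : ℝ) / ρ) := by
    intro k hk
    have hk' := Forest.mem_ofWeightLE.1 hk
    obtain ⟨C, hC, h1⟩ := hX.isNormBigO_pair hω (n := k.weight + b) (by omega)
      (growth_mem_weightEq (fo_mem_weightEq k) hpb)
    -- Here `b ≥ 1` is essential: it puts `m = N - b` within the weights up to `N - 1` on which `A`
    -- lives.
    obtain ⟨D, hD, h2⟩ := hA.isNormBigO_lowerPart hρ hω hX (m := m) (by omega) hk'
    refine ⟨(k.symm : ℝ)⁻¹ * (C * D), by positivity, fun s u t hs hsu hut ht => ?_⟩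
    have hst := hω.nonneg s t hs (hsu.trans hut) ht
    have e1 := (h1 u t (hs.trans hsu) hut ht).trans (mul_le_mul_of_nonneg_left
      (Real.rpow_le_rpow (hω.nonneg u t (hs.trans hsu) hut ht) (hω.mono_right hs hsu hut ht)
        (by positivity)) hC)
    have e2 := (h2 s u hs hsu (hut.trans ht)).trans (mul_le_mul_of_nonneg_left
      (Real.rpow_le_rpow (hω.nonneg s u hs hsu (hut.trans ht)) (hω.mono_left hs hsu hut ht)
        (by positivity)) hD)
    have e3 : ω s t ^ (((⌊ρ⌋₊ + 1 : ℕ) : ℝ) / ρ) = ω s t ^ (((k.weight + b : ℕ) : ℝ) / ρ)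
        * ω s t ^ (((m + 1 - k.weight : ℕ) : ℝ) / ρ) := by
      rw [← Real.rpow_add_of_nonneg hst (by positivity) (by positivity), ← add_div, ← Nat.cast_add]
      congr 3
      omega
    rw [norm_smul, norm_smul, Real.norm_of_nonneg (by positivity), mul_assoc]
    refine mul_le_mul_of_nonneg_left ((mul_le_mul e1 e2 (norm_nonneg _)
      ((norm_nonneg _).trans e1)).trans_eq ?_) (by positivity)
    rw [e3]
    ring
  choose! C hC h using h1
  refine ⟨∑ k ∈ Forest.ofWeightLE B m, C k, Finset.sum_nonneg hC, fun s u t hs hsu hut ht => ?_⟩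
  rw [localExpansion_sub hX hp hpb hb hs hsu hut ht, norm_neg, Finset.sum_mul]
  exact norm_sum_le_of_le _ fun k hk => h k hk s u t hs hsu hut ht

end Estimates

/-! ## The coordinate decomposition of the rough integral -/

section Decomposition

variable {B : Type*}

theorem PiHat_eq_zero_of_lt {n : ℕ} (h : HCK B) {p : HCK B} (hp : p ∈ Prim B)
    (hpn : p ∈ weightLE B n) {f : Forest B} (hf : n < f.weight) : PiHat f (growth h p) = 0 := by
  rw [PiHat_growth f h hp, pair_fo_eq_zero_of_mem hpn hf.not_ge, zero_smul]

theorem growth_eq_sum_PiHat [Finite B] {n : ℕ} (h : HCK B) {p : HCK B} (hp : p ∈ Prim B)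
    (hpn : p ∈ weightLE B n) :
    ∑ f ∈ Forest.ofWeightLE B n, (f.symm : ℝ)⁻¹ • PiHat f (growth h p) = growth h p := by
  have h1 := congrArg (fun x => growth h (piCK x)) (sum_pair_smul (S := Forest.ofWeightLE B n)
    (x := p) (by rwa [coe_ofWeightLE]))
  simp only [map_sum, map_smul, piCK_of_mem_Prim hp] at h1
  rw [← h1]
  refine Finset.sum_congr rfl fun f _ => ?_
  -- The backward rewrite also expanded `h ⊤ p` inside the summands; `h1` folds it back.
  rw [h1, PiHat_growth f h hp, smul_smul]

theorem exists_mem_weightLE (x : HCK B) : ∃ n, x ∈ weightLE B n := by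
  have : x ∈ Submodule.span ℝ (Set.range (fo (B := B))) := by
    have := supported_eq_span_fo (B := B) Set.univ
    rw [← Set.image_univ, ← this]
    exact AddMonoidAlgebra.mem_supported.2 (Set.subset_univ _)
  induction this using Submodule.span_induction with
  | mem x hx =>
    obtain ⟨f, rfl⟩ := hx
    exact ⟨f.weight, fo_mem_supported (show f.weight ≤ f.weight from le_rfl)⟩
  | zero => exact ⟨0, zero_mem _⟩
  | add x y _ _ hx hy =>
    obtain ⟨m, hm⟩ := hx
    obtain ⟨n, hn⟩ := hy
    exact ⟨max m n, add_mem (weightLE_mono (le_max_left _ _) hm)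
      (weightLE_mono (le_max_right _ _) hn)⟩
  | smul c x _ hx =>
    obtain ⟨n, hn⟩ := hx
    exact ⟨n, Submodule.smul_mem _ c hn⟩

/-- Claimed for all `m` beyond a threshold, so that thresholds can be merged when tensors are added.
-/
theorem exists_sum_PiHat [Finite B] {y : HCK B} (hy : y ∈ HCKPos B) :
    ∃ n, ∀ m, n ≤ m → (∀ f : Forest B, m < f.weight → PiHat f y = 0) ∧
      ∑ f ∈ Forest.ofWeightLE B m, (f.symm : ℝ)⁻¹ • PiHat f y = y := by
  rw [← range_growthPrim] at hy
  obtain ⟨z, rfl⟩ := hy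
  induction z using TensorProduct.induction_on with
  | zero => exact ⟨0, fun m _ => by simp⟩
  | tmul h p =>
    obtain ⟨n, hn⟩ := exists_mem_weightLE (p : HCK B)
    exact ⟨n, fun m hm => ⟨fun f hf => PiHat_eq_zero_of_lt h p.2 (weightLE_mono hm hn) hf,
      growth_eq_sum_PiHat h p.2 (weightLE_mono hm hn)⟩⟩
  | add z w hz hw =>
    obtain ⟨m, hm⟩ := hz
    obtain ⟨n, hn⟩ := hw
    refine ⟨max m n, fun k hk => ?_⟩
    obtain ⟨h1, h2⟩ := hm k ((le_max_left _ _).trans hk)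
    obtain ⟨h3, h4⟩ := hn k ((le_max_right _ _).trans hk)
    refine ⟨fun f hf => by rw [map_add, map_add, h1 f hf, h3 f hf, add_zero], ?_⟩
    simp only [map_add, smul_add, Finset.sum_add_distrib]
    rw [h2, h4]

theorem finite_PiHat_ne_zero [Finite B] {y : HCK B} (hy : y ∈ HCKPos B) :
    {f : Forest B | PiHat f y ≠ 0}.Finite := by
  obtain ⟨n, hn⟩ := exists_sum_PiHat hy
  refine (Forest.ofWeightLE B n).finite_toSet.subset fun f hf => ?_
  rw [Finset.mem_coe, Forest.mem_ofWeightLE]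
  by_contra! h
  exact hf ((hn n le_rfl).1 f h)

theorem finsum_PiHat [Finite B] {y : HCK B} (hy : y ∈ HCKPos B) :
    ∑ᶠ f : Forest B, (pair (fo f) (fo f))⁻¹ • PiHat f y = y := by
  obtain ⟨n, hn⟩ := exists_sum_PiHat hy
  obtain ⟨h1, h2⟩ := hn n le_rfl
  rw [finsum_eq_sum_of_support_subset (s := Forest.ofWeightLE B n)]
  · simpa only [pair_fo_self] using h2
  · intro f hf
    rw [Finset.mem_coe, Forest.mem_ofWeightLE]
    by_contra! h
    exact hf (by simp only [h1 f h, smul_zero])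

theorem finsum_PiProj [Finite B] {y : HCK B} (hy : y ∈ HCKPos B)
    (h : ∀ f : Forest B, pair (piCK (fo f)) (fo f) = 0 → PiHat f y = 0) :
    ∑ᶠ f : Forest B, (pair (piCK (fo f)) (fo f) / pair (fo f) (fo f)) • PiProj f y = y := by
  rw [← finsum_PiHat hy]
  refine finsum_congr fun f => ?_
  -- This undoes the expansion of `y` inside the summand caused by the preceding backward rewrite.
  rw [finsum_PiHat hy, PiProj, LinearMap.smul_apply, smul_smul]
  rcases eq_or_ne (pair (piCK (fo f)) (fo f)) 0 with h0 | h0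
  · rw [h f h0, smul_zero, smul_zero]
  · congr 1
    field_simp

theorem PiProj_growth (f : Forest B) (h : HCK B) {p : HCK B} (hp : p ∈ Prim B) :
    PiProj f (growth h p)
      = (pair p (fo f) / pair (piCK (fo f)) (fo f)) • growth h (piCK (fo f)) := by
  rw [PiProj, LinearMap.smul_apply, PiHat_growth f h hp, smul_smul, div_eq_inv_mul]

theorem PiProj_growth_piCK {f : Forest B} (hf : pair (piCK (fo f)) (fo f) ≠ 0) (h : HCK B) :
    PiProj f (growth h (piCK (fo f))) = growth h (piCK (fo f)) := by
  rw [PiProj_growth f h (piCK_mem_Prim _), div_self hf, one_smul]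

/-- `PiHat f` kills `1`, so only the positive part of `y` matters, and that is a sum of elements `h
⊤ p`. -/
theorem PiProj_mem_range (f : Forest B) (y : HCK B) :
    PiProj f y ∈ LinearMap.range (growth.flip (piCK (fo f))) := by
  have h1 : PiProj f y = PiProj f (posPart y) := by
    rw [posPart_apply, map_sub, map_smul, PiProj, LinearMap.smul_apply _ _ (1 : HCK B), PiHat_one,
      smul_zero, smul_zero, sub_zero]
  rw [h1, ← growthPrim_growthPrimInv]
  induction growthPrimInv B y using TensorProduct.induction_on with
  | zero => rw [map_zero, map_zero]; exact zero_mem _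
  | tmul h p =>
    rw [growthPrim_tmul, PiProj_growth f h p.2]
    exact Submodule.smul_mem _ _ ⟨h, rfl⟩
  | add z w hz hw => rw [map_add, map_add]; exact add_mem hz hw

theorem PiProj_comp_self {f : Forest B} (hf : pair (piCK (fo f)) (fo f) ≠ 0) :
    PiProj f ∘ₗ PiProj f = PiProj f := by
  refine LinearMap.ext fun y => ?_
  obtain ⟨h, e⟩ := PiProj_mem_range f y
  rw [LinearMap.comp_apply, ← e, LinearMap.flip_apply, PiProj_growth_piCK hf]

theorem range_PiProj {f : Forest B} (hf : pair (piCK (fo f)) (fo f) ≠ 0) :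
    LinearMap.range (PiProj f) = LinearMap.range (growth.flip (piCK (fo f))) := by
  refine le_antisymm ?_ ?_
  · rintro _ ⟨y, rfl⟩
    exact PiProj_mem_range f y
  · rintro _ ⟨h, rfl⟩
    exact ⟨_, PiProj_growth_piCK hf h⟩

end Decomposition

/-! ## Existence of the rough integrals -/

section Integrals

variable {B : Type*} [Finite B] {W : Type*} [NormedAddCommGroup W] [NormedSpace ℝ W]

theorem roughIntegral_eq {N : ℕ} {X : ℝ → ℝ → weightLE B N}
    {H : ℝ → weightLE B (N - 1) →ₗ[ℝ] QLE B N →ₗ[ℝ] W} {s t : ℝ} (hst : s ≤ t) {I : W}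
    (h : HasPartitionLimit (localApprox X H) s t I) : roughIntegral X H s t = I := by
  have h1 : RoughIntegrable X H s t := ⟨I, h⟩
  rw [roughIntegral, dif_pos h1]
  exact h1.choose_spec.unique hst h

theorem RoughIntegrable.hasPartitionLimit {N : ℕ} {X : ℝ → ℝ → weightLE B N}
    {H : ℝ → weightLE B (N - 1) →ₗ[ℝ] QLE B N →ₗ[ℝ] W} {s t : ℝ} (h : RoughIntegrable X H s t) :
    HasPartitionLimit (localApprox X H) s t (roughIntegral X H s t) := by
  rw [roughIntegral, dif_pos h]
  exact h.choose_spec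

theorem localApprox_PiHat {N : ℕ} (X : ℝ → ℝ → weightLE B N)
    (H : ℝ → weightLE B (N - 1) →ₗ[ℝ] QLE B N →ₗ[ℝ] W) (f : Forest B) :
    localApprox X (fun r => applyCK (PiHat f) (H r))
      = localExpansion X (fun r => LinearMap.applyₗ (truncPiStar B N (fo f)) ∘ₗ H r)
        (piCK (fo f)) := by
  funext s t
  rw [localApprox, toCK_applyCK_PiHat, rTensor_PiHat_toCK (n := N) (Nat.sub_le N 1), map_sum,
    LinearMap.sum_apply, localExpansion]
  refine Finset.sum_congr rfl fun g _ => ?_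
  rw [map_smul, LinearMap.smul_apply, pairW_tmul]
  rfl

theorem localApprox_eq_sum {N : ℕ} (X : ℝ → ℝ → weightLE B N)
    (H : ℝ → weightLE B (N - 1) →ₗ[ℝ] QLE B N →ₗ[ℝ] W) (s t : ℝ) :
    localApprox X H s t = ∑ f ∈ Forest.ofWeightLE B N,
      (f.symm : ℝ)⁻¹ • localApprox X (fun r => applyCK (PiHat f) (H r)) s t := by
  rw [localApprox, ← sum_rTensor_PiHat_toCK (H s), map_sum, LinearMap.sum_apply]
  refine Finset.sum_congr rfl fun f _ => ?_
  rw [map_smul, LinearMap.smul_apply, localApprox, toCK_applyCK_PiHat]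

theorem applyCK_PiProj {N : ℕ} (A : weightLE B (N - 1) →ₗ[ℝ] QLE B N →ₗ[ℝ] W) (f : Forest B) :
    applyCK (PiProj f) A = (pair (piCK (fo f)) (fo f))⁻¹ • applyCK (PiHat f) A := by
  refine LinearMap.ext fun k => LinearMap.ext fun q => ?_
  rw [applyCK, PiProj, LinearMap.rTensor_smul]
  change pairW ((_ : ℝ) • LinearMap.rTensor W (PiHat f) (toCK A)) _ = _
  rw [map_smul]
  rfl

theorem localApprox_PiProj {N : ℕ} (X : ℝ → ℝ → weightLE B N)
    (H : ℝ → weightLE B (N - 1) →ₗ[ℝ] QLE B N →ₗ[ℝ] W) (f : Forest B) (s t : ℝ) :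
    localApprox X (fun r => applyCK (PiProj f) (H r)) s t = (pair (piCK (fo f)) (fo f))⁻¹ •
      localApprox X (fun r => applyCK (PiHat f) (H r)) s t := by
  rw [localApprox, applyCK_PiProj, toCK_smul, map_smul, LinearMap.smul_apply, localApprox]

theorem HasPartitionLimit.const_smul {Ξ : ℝ → ℝ → W} {s t : ℝ} {I : W} (c : ℝ)
    (h : HasPartitionLimit Ξ s t I) : HasPartitionLimit (fun u v => c • Ξ u v) s t (c • I) := by
  simpa using HasPartitionLimit.sum {()} (fun _ => c) (Θ := fun _ => Ξ) (I := fun _ => I)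
    fun _ _ => h

/-! ### Coordinate integrals of a controlled path. -/

variable {ρ T : ℝ} {ω : ℝ → ℝ → ℝ} {X : ℝ → ℝ → weightLE B ⌊ρ⌋₊}
  {H : ℝ → weightLE B (⌊ρ⌋₊ - 1) →ₗ[ℝ] QLE B ⌊ρ⌋₊ →ₗ[ℝ] W}

theorem IsControlledPath.applyCK_PiHat (hH : IsControlledPath ρ T ω X H) (f : Forest B) :
    IsControlledPath ρ T ω X fun r => applyCK (PiHat f) (H r) := by
  have := hH.map ((LinearMap.smulRightₗ
    ((pair (piCK (fo f))) ∘ₗ (QLE B ⌊ρ⌋₊).subtype)) ∘ₗ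
      LinearMap.applyₗ (truncPiStar B ⌊ρ⌋₊ (fo f)))
  refine (congrArg (IsControlledPath ρ T ω X) (funext fun r => LinearMap.ext fun k =>
    LinearMap.ext fun q => ?_)).mp this
  rw [_root_.applyCK_PiHat]
  rfl

theorem IsControlledPath.applyCK_PiProj (hH : IsControlledPath ρ T ω X H) (f : Forest B) :
    IsControlledPath ρ T ω X fun r => applyCK (PiProj f) (H r) := by
  simp only [_root_.applyCK_PiProj]
  exact (hH.applyCK_PiHat f).map ((pair (piCK (fo f)) (fo f))⁻¹ • LinearMap.id)

/-- For `1 ≤ |f| ≤ N` this is the estimate for local expansions with `p = π(f)`. Otherwise the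
expansion is identically `0`, since `π(1) = 0` and `π*(f)` is truncated away when `|f| > N`. -/
theorem localApprox_PiHat_almostAdditive [FiniteDimensional ℝ W] (hρ : 1 ≤ ρ)
    (hω : IsControl T ω) (hX : IsBranchedRoughPath ρ T ω X) (hH : IsControlledPath ρ T ω X H)
    (f : Forest B) : ∃ C, 0 ≤ C ∧ AlmostAdditive T C (((⌊ρ⌋₊ + 1 : ℕ) : ℝ) / ρ) ω
      (localApprox X fun r => applyCK (PiHat f) (H r)) := by
  rw [localApprox_PiHat]
  by_cases hf : 1 ≤ f.weight ∧ f.weight ≤ ⌊ρ⌋₊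
  · exact localExpansion_almostAdditive hρ hω hX (hH.map _) (piCK_mem_Prim _)
      (piCK_fo_mem_weightEq f) hf.1 hf.2
  · refine ⟨0, le_rfl, fun s u t _ _ _ _ => ?_⟩
    have h0 : ∀ s t, localExpansion X (fun r => LinearMap.applyₗ (truncPiStar B ⌊ρ⌋₊ (fo f)) ∘ₗ H r)
        (piCK (fo f)) s t = 0 := by
      intro s t
      refine Finset.sum_eq_zero fun g _ => ?_
      rcases lt_or_ge ⌊ρ⌋₊ f.weight with h | h
      · have : truncPiStar B ⌊ρ⌋₊ (fo f) = 0 := Subtype.ext (by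
          rw [coe_truncPiStar, truncLE_fo_of_lt h]
          simp)
        simp only [this, map_zero, LinearMap.zero_comp, LinearMap.zero_apply, smul_zero]
      · rw [Forest.weight_eq_zero.1 (show f.weight = 0 by omega), fo_zero, piCK_one, map_zero, map_zero, LinearMap.zero_apply, zero_smul, smul_zero]
    rw [h0, h0, h0]
    simp

theorem coordIntegral_spec [FiniteDimensional ℝ W] (hρ : 1 ≤ ρ) (hT : 0 ≤ T)
    (hω : IsControl T ω) (hX : IsBranchedRoughPath ρ T ω X) (hH : IsControlledPath ρ T ω X H)
    (f : Forest B) :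
    (∀ s t, 0 ≤ s → s ≤ t → t ≤ T → RoughIntegrable X (fun r => applyCK (PiHat f) (H r)) s t) ∧
      AlmostEqual ρ T ω (coordIntegral X H f)
        (localApprox X fun r => applyCK (PiHat f) (H r)) := by
  -- The sewing exponent exceeds `1` because `ρ < ⌊ρ⌋ + 1`.
  have hθ : 1 < ((⌊ρ⌋₊ + 1 : ℕ) : ℝ) / ρ := by
    rw [one_lt_div (by linarith)]
    exact_mod_cast Nat.lt_floor_add_one ρ
  obtain ⟨C, hC, h⟩ := localApprox_PiHat_almostAdditive hρ hω hX hH f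
  obtain ⟨I, K, hI⟩ := h.exists_partitionLimit hω hT hθ hC
  refine ⟨fun s t hs hst ht => ⟨I s t, (hI s t hs hst ht).1⟩, fun φ => ?_⟩
  refine ⟨‖φ.toContinuousLinearMap‖ * K, fun s t hs hst ht => ?_⟩
  obtain ⟨h1, h2⟩ := hI s t hs hst ht
  have h3 : coordIntegral X H f s t = I s t := roughIntegral_eq hst h1
  beta_reduce
  rw [h3, mul_assoc]
  exact (φ.toContinuousLinearMap.le_opNorm _).trans
    (mul_le_mul_of_nonneg_left h2 (norm_nonneg _))

theorem AlmostEqual.const_smul {U : Type*} [AddCommGroup U] [Module ℝ U] {F G : ℝ → ℝ → U}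
    (h : AlmostEqual ρ T ω F G) (c : ℝ) :
    AlmostEqual ρ T ω (fun s t => c • F s t) fun s t => c • G s t := by
  intro φ
  obtain ⟨C, hC⟩ := h (c • φ)
  refine ⟨C, fun s t hs hst ht => ?_⟩
  have := hC s t hs hst ht
  rwa [LinearMap.smul_apply, ← map_smul, smul_sub] at this

theorem AlmostEqual.sum {U : Type*} [AddCommGroup U] [Module ℝ U] {ι : Type*} (A : Finset ι)
    {F G : ι → ℝ → ℝ → U} (h : ∀ i ∈ A, AlmostEqual ρ T ω (F i) (G i)) :
    AlmostEqual ρ T ω (fun s t => ∑ i ∈ A, F i s t) fun s t => ∑ i ∈ A, G i s t := by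
  intro φ
  choose! C hC using fun i hi => h i hi φ
  refine ⟨∑ i ∈ A, C i, fun s t hs hst ht => ?_⟩
  beta_reduce
  rw [← Finset.sum_sub_distrib, map_sum, Finset.sum_mul]
  exact (Finset.abs_sum_le_sum_abs _ _).trans
    (Finset.sum_le_sum fun i hi => hC i hi s t hs hst ht)

theorem AlmostEqual.congr {U : Type*} [AddCommGroup U] [Module ℝ U] {F G F' G' : ℝ → ℝ → U}
    (h : AlmostEqual ρ T ω F G)
    (hF : ∀ s t, 0 ≤ s → s ≤ t → t ≤ T → F' s t = F s t)
    (hG : ∀ s t, 0 ≤ s → s ≤ t → t ≤ T → G' s t = G s t) : AlmostEqual ρ T ω F' G' := by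
  intro φ
  obtain ⟨C, hC⟩ := h φ
  refine ⟨C, fun s t hs hst ht => ?_⟩
  beta_reduce
  rw [hF s t hs hst ht, hG s t hs hst ht]
  exact hC s t hs hst ht

theorem labelSum_davieTerm {B : Type*} [Fintype B] {N : ℕ} (X : ℝ → ℝ → weightLE B N)
    (H : ℝ → weightLE B (N - 1) →ₗ[ℝ] QLE B N →ₗ[ℝ] W) (f : Forest B) (s t : ℝ) :
    (labelSum B N fun g => davieTerm X H g f s t)
      = localApprox X (fun r => applyCK (PiHat f) (H r)) s t := by
  rw [labelSum_eq, localApprox_PiHat, localExpansion]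
  refine Finset.sum_congr rfl fun g _ => ?_
  rw [davieTerm, pairW_toCK_star_piStar]
  rfl

end Integrals

theorem mainTheorem5 {B : Type*} [Fintype B]
    {W : Type*} [NormedAddCommGroup W] [NormedSpace ℝ W] [FiniteDimensional ℝ W]
    (ρ T : ℝ) (hρ : 1 ≤ ρ) (hT : 0 ≤ T) (ω : ℝ → ℝ → ℝ) (hω : IsControl T ω)
    (X : ℝ → ℝ → weightLE B ⌊ρ⌋₊) (hX : IsBranchedRoughPath ρ T ω X)
    (H : ℝ → weightLE B (⌊ρ⌋₊ - 1) →ₗ[ℝ] QLE B ⌊ρ⌋₊ →ₗ[ℝ] W)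
    (hH : IsControlledPath ρ T ω X H) :
    -- The objects are well defined: `⊤ : H_CK ⊗ 𝒫 → H_{CK,+}` is bijective, `π` is the projection
    -- onto `𝒫` annihilating `H_{CK,+} ⊤ 𝒫`, `⟨π(f), f⟩ Π_f` is the map `h ⊤ p ↦ ⟨p, f⟩ h ⊤ π(f)`,
    -- and the identifications of `𝓛(H_GL, 𝓛(𝒬, W))` with elements of `H_CK ⊗ W` are legitimate.
    (Function.Injective (growthPrim B) ∧ LinearMap.range (growthPrim B) = HCKPos B ∧
      LinearMap.range (piCK (B := B)) = Prim B ∧ (∀ p ∈ Prim B, piCK p = p) ∧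
      (∀ h ∈ HCKPos B, ∀ p ∈ Prim B, piCK (growth h p) = 0) ∧
      (∀ (f : Forest B) (h : HCK B), ∀ p ∈ Prim B,
        PiHat f (growth h p) = pair p (fo f) • growth h (piCK (fo f))) ∧
      Function.Bijective (pairingIdent B W ⌊ρ⌋₊) ∧
      (∀ (A : weightLE B (⌊ρ⌋₊ - 1) →ₗ[ℝ] QLE B ⌊ρ⌋₊ →ₗ[ℝ] W)
        (k : weightLE B (⌊ρ⌋₊ - 1)) (q : QLE B ⌊ρ⌋₊),
        pairW (toCK A) (starGL (k : HGL B) (q : HGL B)) = A k q) ∧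
      (∀ (A : weightLE B (⌊ρ⌋₊ - 1) →ₗ[ℝ] QLE B ⌊ρ⌋₊ →ₗ[ℝ] W) (f : Forest B),
        toCK (applyCK (PiHat f) A) = LinearMap.rTensor W (PiHat f) (toCK A))) ∧
    -- Where `⟨π(f), f⟩ ≠ 0`, the map `Π_f` is the projection onto `H_CK ⊤ π(f)` with the formula
    -- `h ⊤ p ↦ (⟨p, f⟩ / ⟨π(f), f⟩) h ⊤ π(f)`.
    (∀ f : Forest B, pair (piCK (fo f)) (fo f) ≠ 0 →
      (∀ (h : HCK B), ∀ p ∈ Prim B, PiProj f (growth h p)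
        = (pair p (fo f) / pair (piCK (fo f)) (fo f)) • growth h (piCK (fo f))) ∧
      PiProj f ∘ₗ PiProj f = PiProj f ∧
      LinearMap.range (PiProj f) = LinearMap.range (growth.flip (piCK (fo f)))) ∧
    -- (1)
    (∀ y ∈ HCKPos B,
      {f : Forest B | PiHat f y ≠ 0}.Finite ∧
      (y = ∑ᶠ f : Forest B, (pair (fo f) (fo f))⁻¹ • PiHat f y) ∧
      ((∀ f : Forest B, pair (piCK (fo f)) (fo f) = 0 → PiHat f y = 0) →
        y = ∑ᶠ f : Forest B,
          (pair (piCK (fo f)) (fo f) / pair (fo f) (fo f)) • PiProj f y)) ∧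
    -- (2)
    (∀ f : Forest B,
      IsControlledPath ρ T ω X (fun r => applyCK (PiHat f) (H r)) ∧
      (∀ s t, 0 ≤ s → s ≤ t → t ≤ T →
        RoughIntegrable X (fun r => applyCK (PiHat f) (H r)) s t) ∧
      AlmostEqual ρ T ω (coordIntegral X H f)
        (fun s t => labelSum B ⌊ρ⌋₊ fun g => davieTerm X H g f s t) ∧
      (pair (piCK (fo f)) (fo f) ≠ 0 →
        IsControlledPath ρ T ω X (fun r => applyCK (PiProj f) (H r)) ∧
        (∀ s t, 0 ≤ s → s ≤ t → t ≤ T →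
          RoughIntegrable X (fun r => applyCK (PiProj f) (H r)) s t ∧
          roughIntegral X (fun r => applyCK (PiProj f) (H r)) s t
            = (pair (piCK (fo f)) (fo f))⁻¹ • coordIntegral X H f s t) ∧
        AlmostEqual ρ T ω (roughIntegral X fun r => applyCK (PiProj f) (H r))
          (fun s t => (pair (piCK (fo f)) (fo f))⁻¹ •
            labelSum B ⌊ρ⌋₊ fun g => davieTerm X H g f s t))) ∧
    -- (3)
    (∀ s t, 0 ≤ s → s ≤ t → t ≤ T →
      RoughIntegrable X H s t ∧
      roughIntegral X H s t = labelSum B ⌊ρ⌋₊ fun f => coordIntegral X H f s t) ∧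
    AlmostEqual ρ T ω (roughIntegral X H)
      (fun s t => labelSum B ⌊ρ⌋₊ fun f => labelSum B ⌊ρ⌋₊ fun g => davieTerm X H g f s t) := by
  refine ⟨⟨growthPrim_injective, range_growthPrim, range_piCK, fun p hp => piCK_of_mem_Prim hp,
    fun h hh p hp => piCK_growth_of_mem_HCKPos hh hp, fun f h p hp => PiHat_growth f h hp,
    pairingIdent_bijective _, pairW_toCK_star, toCK_applyCK_PiHat⟩,
    fun f hf => ⟨fun h p hp => PiProj_growth f h hp, PiProj_comp_self hf, range_PiProj hf⟩,
    fun y hy => ⟨finite_PiHat_ne_zero hy, (finsum_PiHat hy).symm,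
      fun h => (finsum_PiProj hy h).symm⟩, ?_⟩
  have hI : ∀ f s t, 0 ≤ s → s ≤ t → t ≤ T →
      HasPartitionLimit (localApprox X fun r => applyCK (PiHat f) (H r)) s t
        (coordIntegral X H f s t) := fun f s t hs hst ht =>
    ((coordIntegral_spec hρ hT hω hX hH f).1 s t hs hst ht).hasPartitionLimit
  have hD : ∀ f, AlmostEqual ρ T ω (coordIntegral X H f)
      fun s t => labelSum B ⌊ρ⌋₊ fun g => davieTerm X H g f s t := fun f =>
    (coordIntegral_spec hρ hT hω hX hH f).2.congr (fun _ _ _ _ _ => rfl)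
      fun s t _ _ _ => labelSum_davieTerm X H f s t
  have hP : ∀ f s t, 0 ≤ s → s ≤ t → t ≤ T →
      HasPartitionLimit (localApprox X fun r => applyCK (PiProj f) (H r)) s t
        ((pair (piCK (fo f)) (fo f))⁻¹ • coordIntegral X H f s t) := fun f s t hs hst ht => by
    rw [show localApprox X (fun r => applyCK (PiProj f) (H r)) = _ from
      funext fun u => funext fun v => localApprox_PiProj X H f u v]
    exact (hI f s t hs hst ht).const_smul _
  -- The local approximation of `H` is a finite combination of the coordinate ones, so existence and
  -- decomposition of its integral follow from linearity of partition limits, without sewing again.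
  have hS : ∀ s t, 0 ≤ s → s ≤ t → t ≤ T → HasPartitionLimit (localApprox X H) s t
      (labelSum B ⌊ρ⌋₊ fun f => coordIntegral X H f s t) := fun s t hs hst ht => by
    rw [labelSum_eq, show localApprox X H = _ from
      funext fun u => funext fun v => localApprox_eq_sum X H u v]
    exact HasPartitionLimit.sum _ _ fun f _ => hI f s t hs hst ht
  refine ⟨fun f => ⟨hH.applyCK_PiHat f, (coordIntegral_spec hρ hT hω hX hH f).1, hD f, fun _ =>
    ⟨hH.applyCK_PiProj f, fun s t hs hst ht => ⟨⟨_, hP f s t hs hst ht⟩,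
      roughIntegral_eq hst (hP f s t hs hst ht)⟩,
      ((hD f).const_smul _).congr (fun s t hs hst ht => roughIntegral_eq hst (hP f s t hs hst ht))
        fun _ _ _ _ _ => rfl⟩⟩,
    fun s t hs hst ht => ⟨⟨_, hS s t hs hst ht⟩, roughIntegral_eq hst (hS s t hs hst ht)⟩, ?_⟩
  refine (AlmostEqual.sum (Forest.ofWeightLE B ⌊ρ⌋₊) fun f _ =>
    (hD f).const_smul (f.symm : ℝ)⁻¹).congr (fun s t hs hst ht => ?_) fun s t _ _ _ => ?_
  · rw [roughIntegral_eq hst (hS s t hs hst ht), labelSum_eq]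
  · rw [labelSum_eq]
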